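/- **Theorem 2.4.** Let $B:\mathbb{R}^2\to\mathbb{R}$ satisfy $B\in L^p_{\rm loc}(\mathbb{R}^2)$ for some $p>2$ and $|B(x)|=\mathcal{O}(|x|^{-\tau})$ as $|x|\to\infty$ for some $\tau>2$. Put $$\alpha=\frac1{2\pi}\int_{\mathbb{R}^2}B\,dx,\qquad h(x)=-\frac1{2\pi}\int_{\mathbb{R}^2}B(y)\log|x-y|\,dy,\qquad A_h=(\partial_{x_2}h,\,-\partial_{x_1}h),$$ and, for $\rho>0$, let $g_+(\rho;r)=1$ if $0\le r\le\rho$ and $g_+(\rho;r)=\rho^{-\alpha}r^{\alpha}$ if $r>\rho$, and $$k_+(\rho)=\inf_{x\in\mathbb{R}^2}\frac{e^{-h(x)}}{g_+(\rho;|x|)},\qquad K_+(\rho)=\sup_{x\in\mathbb{R}^2}\frac{e^{-h(x)}}{g_+(\rho;|x|)},\qquad \beta_+(B;\rho)=\Big(\frac{k_+(\rho)}{K_+(\rho)}\Big)^2 .$$ Suppose that $\alpha$ is an integer with $\alpha\ge 0$. Let $A$ be either $A_h$ or any vector field in $L^\infty(\mathbb{R}^2;\mathbb{R}^2)$ such that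 $\partial_{x_1}A_2-\partial_{x_2}A_1=B$ in the sense of distributions. Then for every $\rho>0$ and every $u\in H^1(\mathbb{R}^2)$ (complex-valued) the function $|(i\nabla+A)u|^2+B|u|^2$ is integrable on $\mathbb{R}^2$, and $$Q_+[u]:=\int_{\mathbb{R}^2}\big(|(i\nabla+A)u|^2+B|u|^2\big)\,dx\ \ge\ \beta_+(B;\rho)\,\frac{\alpha}{4\alpha+\pi}\int_{\mathbb{R}^2}\frac{|u|^2}{\rho^2+|x|^2\big(1+\log^2(|x|/\rho)\big)}\,dx .$$ -/

import Mathlib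

open MeasureTheory
open scoped ENNReal ContDiff

noncomputable section

namespace PauliHardy

/-- The Euclidean plane. -/
abbrev Plane : Type := EuclideanSpace ℝ (Fin 2)

/-- The classical partial derivative `∂ f / ∂ x_j` at `x` (the coordinates are numbered `0, 1`). -/
def partialDeriv (j : Fin 2) (f : Plane → ℝ) (x : Plane) : ℝ :=
  fderiv ℝ f x (EuclideanSpace.single j 1)

/-- Test functions: real-valued, smooth, compactly supported. -/
structure IsTest (φ : Plane → ℝ) : Prop where
  smooth : ContDiff ℝ ∞ φ
  compact : HasCompactSupport φ

/-- `u ∈ H¹(ℝ²; ℂ)` with weak gradient `Du = (∂₀ u, ∂₁ u)`. -/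
structure IsH1 (u : Plane → ℂ) (Du : Fin 2 → Plane → ℂ) : Prop where
  memLp : MemLp u 2 volume
  memLp_grad : ∀ j, MemLp (Du j) 2 volume
  weak_grad : ∀ j, ∀ φ : Plane → ℝ, IsTest φ →
    ∫ x, ((partialDeriv j φ x : ℝ) : ℂ) * u x = -∫ x, ((φ x : ℝ) : ℂ) * Du j x

/-- The assumption on the magnetic field: `B ∈ L^p_loc(ℝ²)` for some `p > 2`, and
`|B(x)| = O(|x|^{-τ})` as `|x| → ∞` for some `τ > 2`. -/
structure AdmissibleField (B : Plane → ℝ) : Prop where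
  locally_memLp : ∃ p : ℝ≥0∞, 2 < p ∧ ∀ K : Set Plane, IsCompact K →
    MemLp B p (volume.restrict K)
  decay : ∃ τ : ℝ, 2 < τ ∧ ∃ C R : ℝ, ∀ᵐ x : Plane, R ≤ ‖x‖ → |B x| ≤ C * ‖x‖ ^ (-τ)

/-- The normalized flux `α = (1 / 2π) ∫ B`. -/
def flux (B : Plane → ℝ) : ℝ :=
  1 / (2 * Real.pi) * ∫ x, B x

/-- The scalar potential `h(x) = -(1 / 2π) ∫ B(y) log |x - y| dy`. -/
def scalarPotential (B : Plane → ℝ) (x : Plane) : ℝ :=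
  -(1 / (2 * Real.pi)) * ∫ y, B y * Real.log ‖x - y‖

/-- The vector potential `A_h = (∂₁ h, -∂₀ h)` (coordinates numbered `0, 1`). Here `h` is of
class `C¹` when `B` is admissible, so that the derivatives are classical ones. -/
def vectorPotential (B : Plane → ℝ) (x : Plane) : Plane :=
  !₂[partialDeriv 1 (scalarPotential B) x, -partialDeriv 0 (scalarPotential B) x]

/-- `A ∈ L^∞(ℝ²; ℝ²)` and `∂₀ A₁ - ∂₁ A₀ = B` in the sense of distributions. -/
structure IsBoundedPotential (B : Plane → ℝ) (A : Plane → Plane) : Prop where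
  bounded : MemLp A ∞ volume
  curl_eq : ∀ φ : Plane → ℝ, IsTest φ →
    ∫ x, (A x 0 * partialDeriv 1 φ x - A x 1 * partialDeriv 0 φ x) = ∫ x, B x * φ x

/-- `g₊(ρ; r)`, for flux `α`: it is `1` for `r ≤ ρ` and `ρ^{-α} r^α` for `r > ρ`. -/
def gPlus (α ρ r : ℝ) : ℝ :=
  if r ≤ ρ then 1 else ρ ^ (-α) * r ^ α

/-- `k₊(ρ) = inf_x e^{-h(x)} / g₊(ρ; |x|)`. -/
def kPlus (B : Plane → ℝ) (ρ : ℝ) : ℝ :=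
  ⨅ x : Plane, Real.exp (-scalarPotential B x) / gPlus (flux B) ρ ‖x‖

/-- `K₊(ρ) = sup_x e^{-h(x)} / g₊(ρ; |x|)`. -/
def KPlus (B : Plane → ℝ) (ρ : ℝ) : ℝ :=
  ⨆ x : Plane, Real.exp (-scalarPotential B x) / gPlus (flux B) ρ ‖x‖

/-- `β₊(B; ρ) = (k₊(ρ) / K₊(ρ))²`. -/
def betaPlus (B : Plane → ℝ) (ρ : ℝ) : ℝ :=
  (kPlus B ρ / KPlus B ρ) ^ 2

/-- The density `|(i∇ + A) u|² + B |u|²`, for a function `u` with weak gradient `Du`. -/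
def pauliDensity (B : Plane → ℝ) (A : Plane → Plane) (u : Plane → ℂ) (Du : Fin 2 → Plane → ℂ)
    (x : Plane) : ℝ :=
  (∑ j : Fin 2, ‖Complex.I * Du j x + ((A x j : ℝ) : ℂ) * u x‖ ^ 2) + B x * ‖u x‖ ^ 2

/-- The Pauli form `Q₊[u] = ∫ (|(i∇ + A) u|² + B |u|²) dx`. -/
def QPlus (B : Plane → ℝ) (A : Plane → Plane) (u : Plane → ℂ) (Du : Fin 2 → Plane → ℂ) : ℝ :=
  ∫ x, pauliDensity B A u Du x

end PauliHardy

end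

/-!
Two potentials of the same field differ by a gradient: `A = A_h + ∇φ`. With `F = h + i φ` and
`v = exp F • u`, the form `Q₊[u]` becomes `∫ exp (-2 h) |(∂₀ - i ∂₁) v|²`, and the bounds
`k₊ g₊ ≤ exp (-h) ≤ K₊ g₊` replace the weight by the radial one `g₊²` at the cost of the factor
`β₊`. What remains is a Hardy inequality for `v` with the weight `g₊²`. In polar coordinates
`|(∂₀ - i ∂₁) v|²` is a square plus the divergence of a flux that contains a free function `s(r)`;
completing the square, one needs `s` to satisfy a Riccati inequality, which has an explicit solution
in the disc `r ≤ ρ` and another one in its exterior. The two fluxes through the circle `r = ρ`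
differ by `(α - 1) / 4 * |v|²`, which has the right sign since `1 ≤ α`. The identities are proved
for smooth compactly supported `u` and mollified potentials, and pass to the limit.
-/

namespace PauliHardy

open Set Filter Topology Module ComplexConjugate

/-! ### Admissible fields and their Newtonian potential -/

section Decay

theorem rpow_neg_norm_le {E : Type*} [SeminormedAddCommGroup E] {x : E} {τ : ℝ}
    (hτ : 0 ≤ τ) (hx : 1 ≤ ‖x‖) :
    ‖x‖ ^ (-τ) ≤ 2 ^ τ * (1 + ‖x‖) ^ (-τ) := by
  calc ‖x‖ ^ (-τ) ≤ ((1 + ‖x‖) / 2) ^ (-τ) :=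
        Real.rpow_le_rpow_of_nonpos (by positivity) (by linarith) (by linarith)
    _ = 2 ^ τ * (1 + ‖x‖) ^ (-τ) := by
        rw [Real.div_rpow (by positivity) two_pos.le, Real.rpow_neg two_pos.le, div_inv_eq_mul,
          mul_comm]

theorem norm_mul_rpow_le {E F : Type*} [SeminormedAddCommGroup E] [SeminormedAddCommGroup F]
    {f : E → F} {p q s : ℝ} (hpq : p.HolderConjugate q) (hs : 0 ≤ s) (x y : E) :
    ‖f y‖ * ‖x - y‖ ^ (-s) ≤ ‖f y‖ + ‖f y‖ ^ p
      + (Metric.ball (0 : E) 1).indicator (fun z => ‖z‖ ^ (-(s * q))) (x - y) := by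
  rcases lt_or_ge ‖x - y‖ 1 with h | h
  · rw [indicator_of_mem (by simpa using h), ← neg_mul, Real.rpow_mul (norm_nonneg _)]
    calc ‖f y‖ * ‖x - y‖ ^ (-s) ≤ ‖f y‖ ^ p / p + (‖x - y‖ ^ (-s)) ^ q / q :=
          Real.young_inequality_of_nonneg (norm_nonneg _) (by positivity) hpq
      _ ≤ ‖f y‖ ^ p + (‖x - y‖ ^ (-s)) ^ q := by
          gcongr
          · exact div_le_self (by positivity) hpq.lt.le
          · exact div_le_self (by positivity) hpq.symm.lt.le
      _ ≤ _ := by linarith [norm_nonneg (f y)]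
  · rw [indicator_of_notMem (by simpa using h), add_zero]
    calc ‖f y‖ * ‖x - y‖ ^ (-s) ≤ ‖f y‖ * 1 := by
          gcongr; exact Real.rpow_le_one_of_one_le_of_nonpos h (by linarith)
      _ ≤ _ := by rw [mul_one]; exact le_add_of_nonneg_right (by positivity)

variable {E F : Type*} [NormedAddCommGroup E] [NormedSpace ℝ E] [FiniteDimensional ℝ E]
  [MeasurableSpace E] [BorelSpace E] [NormedAddCommGroup F] {μ : Measure E} [μ.IsAddHaarMeasure]

theorem integrable_of_norm_le_rpow {f : E → F} {C R σ : ℝ} (hσ : finrank ℝ E < σ)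
    (hf : LocallyIntegrable f μ) (hd : ∀ᵐ x ∂μ, R ≤ ‖x‖ → ‖f x‖ ≤ C * ‖x‖ ^ (-σ)) :
    Integrable f μ := by
  have hσ0 : 0 ≤ σ := (Nat.cast_nonneg _).trans hσ.le
  set K := Metric.closedBall (0 : E) (max R 1)
  have hout : IntegrableOn f Kᶜ μ := by
    refine Integrable.mono' (((integrable_one_add_norm hσ).const_mul
      (|C| * 2 ^ σ)).integrableOn) hf.aestronglyMeasurable.restrict ?_
    rw [ae_restrict_iff' Metric.isClosed_closedBall.measurableSet.compl]
    filter_upwards [hd] with x hx hxK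
    have hxR : max R 1 < ‖x‖ := by simpa [K] using hxK
    calc ‖f x‖ ≤ |C| * ‖x‖ ^ (-σ) :=
          (hx ((le_max_left _ _).trans hxR.le)).trans (by gcongr; exact le_abs_self C)
      _ ≤ |C| * (2 ^ σ * (1 + ‖x‖) ^ (-σ)) := by
          gcongr; exact rpow_neg_norm_le hσ0 ((le_max_right _ _).trans hxR.le)
      _ = |C| * 2 ^ σ * (1 + ‖x‖) ^ (-σ) := by ring
  rw [← integrableOn_univ, ← union_compl_self K]
  exact (hf.integrableOn_isCompact (isCompact_closedBall _ _)).union hout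

theorem exists_riesz_bound {f : E → F} {p q s : ℝ} (hpq : p.HolderConjugate q) (hs : 0 ≤ s)
    (hsq : s * q < finrank ℝ E) (hf : Integrable f μ) (hfp : Integrable (fun y => ‖f y‖ ^ p) μ) :
    ∃ C : ℝ, ∀ x : E, Integrable (fun y => ‖f y‖ * ‖x - y‖ ^ (-s)) μ ∧
      ∫ y, ‖f y‖ * ‖x - y‖ ^ (-s) ∂μ ≤ C := by
  have hdim : 1 ≤ finrank ℝ E := by
    have : 0 < finrank ℝ E := by exact_mod_cast (mul_nonneg hs hpq.symm.nonneg).trans_lt hsq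
    exact this
  set k : E → ℝ := (Metric.ball (0 : E) 1).indicator fun z => ‖z‖ ^ (-(s * q))
  have hk : Integrable k μ := by
    rw [integrable_indicator_iff Metric.isOpen_ball.measurableSet]
    refine integrableOn_ball_of_norm_le_rpow (C := 1) hdim hsq (ae_of_all _ fun x => ?_)
      (by fun_prop : Measurable fun z : E => ‖z‖ ^ (-(s * q))).aestronglyMeasurable
    rw [one_mul, Real.norm_of_nonneg (by positivity)]
  have hdom : ∀ x, Integrable (fun y => ‖f y‖ + ‖f y‖ ^ p + k (x - y)) μ := fun x =>
    (hf.norm.add hfp).add (hk.comp_sub_left x)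
  refine ⟨(∫ y, ‖f y‖ ∂μ) + (∫ y, ‖f y‖ ^ p ∂μ) + ∫ y, k y ∂μ, fun x => ?_⟩
  have hint : Integrable (fun y => ‖f y‖ * ‖x - y‖ ^ (-s)) μ := by
    have hmeas : Measurable fun y => ‖x - y‖ ^ (-s) := by fun_prop
    refine (hdom x).mono' (hf.norm.aestronglyMeasurable.mul hmeas.aestronglyMeasurable)
      (ae_of_all _ fun y => ?_)
    rw [Real.norm_of_nonneg (by positivity)]
    exact norm_mul_rpow_le hpq hs x y
  refine ⟨hint, (integral_mono hint (hdom x) (norm_mul_rpow_le hpq hs x)).trans_eq ?_⟩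
  rw [integral_add (f := fun y => ‖f y‖ + ‖f y‖ ^ p) (hf.norm.add hfp) (hk.comp_sub_left x),
    integral_add hf.norm hfp, integral_sub_left_eq_self k]

end Decay

section Field

variable {B : Plane → ℝ}

theorem AdmissibleField.locallyIntegrable (hB : AdmissibleField B) : LocallyIntegrable B := by
  obtain ⟨p, hp, hloc⟩ := hB.locally_memLp
  refine MeasureTheory.locallyIntegrable_iff.2 fun K hK => ?_
  have : IsFiniteMeasure (volume.restrict K) := ⟨by simpa using hK.measure_lt_top⟩
  exact (hloc K hK).integrable (le_trans (by norm_num) hp.le)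

theorem AdmissibleField.exists_integrable_mul_rpow (hB : AdmissibleField B) :
    ∃ δ : ℝ, 0 < δ ∧ Integrable (fun y => B y * (1 + ‖y‖) ^ δ) := by
  obtain ⟨τ, hτ, C, R, hd⟩ := hB.decay
  set δ := (τ - 2) / 2 with hδ
  have hδ0 : 0 < δ := by linarith
  have hcont : Continuous fun y : Plane => (1 + ‖y‖) ^ δ := by
    fun_prop (disch := intros; positivity)
  refine ⟨δ, hδ0, integrable_of_norm_le_rpow (C := C * 2 ^ δ) (R := max R 1) (σ := (τ + 2) / 2)
    (by simp; linarith) ?_ ?_⟩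
  · exact MeasureTheory.locallyIntegrable_iff.2 fun K hK =>
      (hB.locallyIntegrable.integrableOn_isCompact hK).mul_continuousOn hcont.continuousOn hK
  · filter_upwards [hd] with x hx hxR
    have hx1 : 1 ≤ ‖x‖ := (le_max_right _ _).trans hxR
    calc ‖B x * (1 + ‖x‖) ^ δ‖ = |B x| * (1 + ‖x‖) ^ δ := by
          rw [norm_mul, Real.norm_eq_abs, Real.norm_of_nonneg (by positivity)]
      _ ≤ C * ‖x‖ ^ (-τ) * (2 * ‖x‖) ^ δ := by
          have h := hx ((le_max_left _ _).trans hxR)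
          have : 0 ≤ C * ‖x‖ ^ (-τ) := (abs_nonneg _).trans h
          gcongr
          linarith
      _ = C * 2 ^ δ * (‖x‖ ^ (-τ) * ‖x‖ ^ δ) := by
          rw [Real.mul_rpow two_pos.le (norm_nonneg x)]; ring
      _ = C * 2 ^ δ * ‖x‖ ^ (-((τ + 2) / 2)) := by
          rw [← Real.rpow_add (by linarith), hδ]; ring_nf

theorem AdmissibleField.integrable (hB : AdmissibleField B) : Integrable B := by
  obtain ⟨τ, hτ, C, R, hd⟩ := hB.decay
  exact integrable_of_norm_le_rpow (by simpa using hτ) hB.locallyIntegrable hd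

theorem AdmissibleField.exists_integrable_rpow (hB : AdmissibleField B) :
    ∃ p : ℝ, 2 < p ∧ Integrable (fun y => ‖B y‖ ^ p) := by
  obtain ⟨p₀, hp₀, hloc⟩ := hB.locally_memLp
  obtain ⟨p, hp, hpp₀⟩ := ENNReal.lt_iff_exists_nnreal_btwn.1 hp₀
  have hp2 : 2 < (p : ℝ) := by exact_mod_cast hp
  obtain ⟨τ, hτ, C, R, hd⟩ := hB.decay
  refine ⟨p, hp2, integrable_of_norm_le_rpow (σ := τ * p) (C := C ^ (p : ℝ)) (R := max R 1) ?_
    (MeasureTheory.locallyIntegrable_iff.2 fun K hK => ?_) ?_⟩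
  · simp only [finrank_euclideanSpace_fin, Nat.cast_ofNat]
    nlinarith
  · have : IsFiniteMeasure (volume.restrict K) := ⟨by simpa using hK.measure_lt_top⟩
    simpa [IntegrableOn] using ((hloc K hK).mono_exponent hpp₀.le).integrable_norm_rpow'
  · filter_upwards [hd] with x hx hxR
    have hx1 : 1 ≤ ‖x‖ := (le_max_right _ _).trans hxR
    have h := hx ((le_max_left _ _).trans hxR)
    have hC : 0 ≤ C := nonneg_of_mul_nonneg_left ((abs_nonneg _).trans h) (by positivity)
    calc ‖‖B x‖ ^ (p : ℝ)‖ = |B x| ^ (p : ℝ) := by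
          rw [Real.norm_of_nonneg (by positivity), Real.norm_eq_abs]
      _ ≤ (C * ‖x‖ ^ (-τ)) ^ (p : ℝ) := by gcongr
      _ = C ^ (p : ℝ) * ‖x‖ ^ (-(τ * p)) := by
          rw [Real.mul_rpow hC (by positivity), ← Real.rpow_mul (norm_nonneg x), neg_mul]

theorem AdmissibleField.exists_riesz_bound (hB : AdmissibleField B) :
    ∃ s₀ : ℝ, 1 < s₀ ∧ s₀ ≤ 2 ∧ ∀ s, 0 ≤ s → s < s₀ → ∃ C : ℝ, ∀ x : Plane,
      Integrable (fun y => ‖B y‖ * ‖x - y‖ ^ (-s)) ∧ ∫ y, ‖B y‖ * ‖x - y‖ ^ (-s) ≤ C := by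
  obtain ⟨p, hp, hI⟩ := hB.exists_integrable_rpow
  obtain ⟨q, hpq⟩ : ∃ q : ℝ, p.HolderConjugate q :=
    ⟨_, Real.HolderConjugate.conjExponent (by linarith)⟩
  have hq1 : 1 < q := hpq.symm.lt
  have hq2 : q < 2 := by
    rw [hpq.conjugate_eq, div_lt_iff₀ (by linarith)]; linarith
  refine ⟨2 / q, by rw [lt_div_iff₀ (by linarith)]; linarith,
    by rw [div_le_iff₀ (by linarith)]; linarith, fun s hs hsq => ?_⟩
  rw [lt_div_iff₀ (by linarith)] at hsq
  exact PauliHardy.exists_riesz_bound hpq hs (by simpa using hsq) hB.integrable hI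

theorem AdmissibleField.exists_newton_bound (hB : AdmissibleField B) :
    ∃ C : ℝ, ∀ x : Plane,
      Integrable (fun y => ‖B y‖ * ‖x - y‖⁻¹) ∧ ∫ y, ‖B y‖ * ‖x - y‖⁻¹ ≤ C := by
  obtain ⟨s₀, hs₀, -, h⟩ := hB.exists_riesz_bound
  simpa only [Real.rpow_neg_one] using h 1 zero_le_one hs₀

theorem AdmissibleField.integrable_mul_log (hB : AdmissibleField B) (x : Plane) :
    Integrable (fun y => B y * Real.log ‖x - y‖) := by
  obtain ⟨δ, hδ, hI⟩ := hB.exists_integrable_mul_rpow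
  obtain ⟨C, hC⟩ := hB.exists_newton_bound
  have hmeas : Measurable fun y => Real.log ‖x - y‖ := by fun_prop
  have hlog : ∀ y, |Real.log ‖x - y‖| ≤ ‖x - y‖⁻¹ + (1 + ‖x‖) ^ δ / δ * (1 + ‖y‖) ^ δ := by
    intro y
    have hpow : 0 ≤ (1 + ‖x‖) ^ δ / δ * (1 + ‖y‖) ^ δ := by positivity
    have hinv : 0 ≤ ‖x - y‖⁻¹ := by positivity
    rcases (norm_nonneg (x - y)).eq_or_lt with h0 | h0
    · rw [← h0]; simpa using hpow
    have hup : Real.log ‖x - y‖ ≤ (1 + ‖x‖) ^ δ / δ * (1 + ‖y‖) ^ δ := by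
      refine (Real.log_le_rpow_div h0.le hδ).trans ?_
      rw [div_mul_eq_mul_div, ← Real.mul_rpow (by positivity) (by positivity)]
      gcongr
      nlinarith [norm_sub_le x y, norm_nonneg x, norm_nonneg y]
    have hlo := Real.one_sub_inv_le_log_of_pos h0
    exact abs_le.2 ⟨by linarith, by linarith⟩
  refine (((hC x).1.add (hI.norm.const_mul ((1 + ‖x‖) ^ δ / δ)))).mono'
    (hB.integrable.aestronglyMeasurable.mul hmeas.aestronglyMeasurable) (ae_of_all _ fun y => ?_)
  calc ‖B y * Real.log ‖x - y‖‖ = ‖B y‖ * |Real.log ‖x - y‖| := by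
        rw [norm_mul, Real.norm_eq_abs (Real.log _)]
    _ ≤ ‖B y‖ * (‖x - y‖⁻¹ + (1 + ‖x‖) ^ δ / δ * (1 + ‖y‖) ^ δ) := by gcongr; exact hlog y
    _ = ‖B y‖ * ‖x - y‖⁻¹ + (1 + ‖x‖) ^ δ / δ * ‖B y * (1 + ‖y‖) ^ δ‖ := by
        rw [norm_mul, Real.norm_of_nonneg (by positivity : 0 ≤ (1 + ‖y‖) ^ δ)]; ring

end Field

theorem le_two_mul_rpow_add_rpow {r t u s : ℝ} (ht : 0 ≤ t) (hu : 0 ≤ u) (hs₁ : 1 ≤ s)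
    (hs₂ : s ≤ 2) (hr₁ : r ≤ t + u) (hr₂ : r ≤ t ^ 2 + u ^ 2) : r ≤ 2 * (t ^ s + u ^ s) := by
  wlog htu : t ≤ u generalizing t u
  · rw [add_comm (t ^ s)]
    exact this hu ht (by linarith) (by linarith) (le_of_not_ge htu)
  have ht' : 0 ≤ t ^ s := by positivity
  have hu' : 0 ≤ u ^ s := by positivity
  rcases le_total u 1 with h1 | h1
  · have sq_le : ∀ v : ℝ, 0 ≤ v → v ≤ 1 → v ^ 2 ≤ v ^ s := fun v hv hv1 => by
      rw [← Real.rpow_two]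
      exact Real.rpow_le_rpow_of_exponent_ge' hv hv1 (by linarith) hs₂
    linarith [sq_le t ht (htu.trans h1), sq_le u hu h1]
  · linarith [Real.self_le_rpow_of_one_le h1 hs₁]

theorem abs_log_sub_le {s x t : ℝ} (hs₁ : 1 ≤ s) (hs₂ : s ≤ 2) (hx : 0 < x) (hxt : |x - 1| ≤ t)
    (htx : t ≤ x + 1) :
    |Real.log x - (x ^ 2 - 1 - t ^ 2) / 2| ≤ 4 * (t ^ s + (t / x) ^ s) := by
  have ht : 0 ≤ t := (abs_nonneg _).trans hxt
  obtain ⟨hlo, hhi⟩ := abs_le.1 hxt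
  have hsq : (x - 1) ^ 2 ≤ t ^ 2 := sq_le_sq' hlo hhi
  have hup : Real.log x ≤ x - 1 := Real.log_le_sub_one_of_pos hx
  have hdown : 1 - x⁻¹ ≤ Real.log x := Real.one_sub_inv_le_log_of_pos hx
  have hlin : |Real.log x - (x ^ 2 - 1 - t ^ 2) / 2| ≤ 2 * (t + t / x) := by
    have hinv : x⁻¹ - 1 ≤ t / x := by
      rw [inv_eq_one_div, div_sub_one hx.ne']
      gcongr
      linarith
    rw [abs_le]
    constructor <;> nlinarith [show 0 ≤ t / x by positivity]
  have hquad : |Real.log x - (x ^ 2 - 1 - t ^ 2) / 2| ≤ t ^ 2 + (t / x) ^ 2 := by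
    have hcross : (x - 1) + (x⁻¹ - 1) ≤ t * (t / x) := by
      calc (x - 1) + (x⁻¹ - 1) = (x - 1) ^ 2 / x := by field_simp; ring
        _ ≤ t ^ 2 / x := by gcongr
        _ = t * (t / x) := by ring
    rw [abs_le]
    constructor <;> nlinarith [sq_nonneg (t - t / x), sq_nonneg (t / x)]
  have htx' : 0 ≤ t / x := by positivity
  linarith [le_two_mul_rpow_add_rpow ht htx' hs₁ hs₂
    (r := |Real.log x - (x ^ 2 - 1 - t ^ 2) / 2| / 2) (by linarith)
    (by linarith [sq_nonneg t, sq_nonneg (t / x)])]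

theorem abs_log_norm_add_sub_le {E : Type*} [NormedAddCommGroup E] [InnerProductSpace ℝ E]
    {s : ℝ} (hs₁ : 1 ≤ s) (hs₂ : s ≤ 2) {z k : E} (hz : z ≠ 0) (hzk : z + k ≠ 0) :
    |Real.log ‖z + k‖ - Real.log ‖z‖ - inner ℝ z k / ‖z‖ ^ 2|
      ≤ 4 * ‖k‖ ^ s * (‖z‖ ^ (-s) + ‖z + k‖ ^ (-s)) := by
  have ha : 0 < ‖z‖ := norm_pos_iff.2 hz
  have hb : 0 < ‖z + k‖ := norm_pos_iff.2 hzk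
  have hdiff : |‖z + k‖ / ‖z‖ - 1| ≤ ‖k‖ / ‖z‖ := by
    rw [div_sub_one ha.ne', abs_div, abs_of_pos ha]
    gcongr
    simpa using abs_norm_sub_norm_le (z + k) z
  have hsum : ‖k‖ / ‖z‖ ≤ ‖z + k‖ / ‖z‖ + 1 := by
    rw [div_add_one ha.ne']
    gcongr
    simpa using norm_sub_le (z + k) z
  have hinner : inner ℝ z k / ‖z‖ ^ 2
      = ((‖z + k‖ / ‖z‖) ^ 2 - 1 - (‖k‖ / ‖z‖) ^ 2) / 2 := by
    rw [show inner ℝ z k = (‖z + k‖ ^ 2 - ‖z‖ ^ 2 - ‖k‖ ^ 2) / 2 by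
      linarith [norm_add_sq_real z k]]
    field_simp
  rw [← Real.log_div hb.ne' ha.ne', hinner]
  refine (abs_log_sub_le hs₁ hs₂ (by positivity) hdiff hsum).trans_eq ?_
  rw [div_div_div_cancel_right₀ ha.ne', Real.div_rpow (norm_nonneg _) ha.le,
    Real.div_rpow (norm_nonneg _) hb.le, Real.rpow_neg ha.le, Real.rpow_neg hb.le]
  ring

theorem hasFDerivAt_of_norm_sub_le_rpow {E F : Type*} [NormedAddCommGroup E] [NormedSpace ℝ E]
    [NormedAddCommGroup F] [NormedSpace ℝ F] {f : E → F} {f' : E →L[ℝ] F} {x : E} {C s : ℝ}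
    (hs : 1 < s) (h : ∀ k, ‖f (x + k) - f x - f' k‖ ≤ C * ‖k‖ ^ s) : HasFDerivAt f f' x := by
  rw [hasFDerivAt_iff_isLittleO_nhds_zero]
  have hpow : (fun k : E => ‖k‖ ^ s) =o[𝓝 0] fun k => k := by
    have hlim : Tendsto (fun k : E => ‖k‖ ^ (s - 1)) (𝓝 0) (𝓝 0) := by
      simpa [Real.zero_rpow (by linarith : s - 1 ≠ 0)] using
        (continuous_norm.rpow_const fun _ : E => Or.inr (by linarith : 0 ≤ s - 1)).tendsto 0
    have := ((Asymptotics.isLittleO_one_iff ℝ).2 hlim).mul_isBigO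
      (Asymptotics.isBigO_refl (fun k : E => ‖k‖) (𝓝 0))
    simpa only [← Real.rpow_add_one' (norm_nonneg _) (by linarith : s - 1 + 1 ≠ 0), sub_add_cancel,
      one_mul] using (this.congr_right fun _ => one_mul _).of_norm_right
  refine (Asymptotics.IsBigO.of_bound C (Eventually.of_forall fun k => ?_)).trans_isLittleO hpow
  rw [Real.norm_of_nonneg (by positivity : 0 ≤ ‖k‖ ^ s)]
  exact h k

/-- The integrand of the gradient of the Newtonian potential `x ↦ ∫ B(y) log |x - y| dy`, as a
linear form. It vanishes at `y = x`, by the convention `1 / 0 = 0`. -/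
noncomputable def newtonKernel (B : Plane → ℝ) (x y : Plane) : Plane →L[ℝ] ℝ :=
  (B y / ‖x - y‖ ^ 2) • innerSL ℝ (x - y)

theorem newtonKernel_apply (B : Plane → ℝ) (x y v : Plane) :
    newtonKernel B x y v = B y * (inner ℝ (x - y) v / ‖x - y‖ ^ 2) := by
  simp only [newtonKernel, smul_apply, innerSL_apply_apply, smul_eq_mul]
  ring

theorem norm_newtonKernel (B : Plane → ℝ) (x y : Plane) :
    ‖newtonKernel B x y‖ = ‖B y‖ * ‖x - y‖⁻¹ := by
  rw [newtonKernel, norm_smul, innerSL_apply_norm, norm_div, norm_pow, norm_norm]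
  rcases eq_or_ne ‖x - y‖ 0 with h | h
  · simp [h]
  · field_simp

section Potential

variable {B : Plane → ℝ}

theorem AdmissibleField.integrable_newtonKernel (hB : AdmissibleField B) (x : Plane) :
    Integrable (newtonKernel B x) := by
  obtain ⟨C, hC⟩ := hB.exists_newton_bound
  have hinv : Measurable fun y => (‖x - y‖ ^ 2)⁻¹ := by fun_prop
  have hlin : Measurable fun y => innerSL ℝ (x - y) := by fun_prop
  exact (hC x).1.mono' ((hB.integrable.aestronglyMeasurable.mul hinv.aestronglyMeasurable).smul
    hlin.aestronglyMeasurable) (Eventually.of_forall fun y => (norm_newtonKernel B x y).le)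

theorem norm_log_sub_newtonKernel_le {s : ℝ} (hs₁ : 1 ≤ s) (hs₂ : s ≤ 2) {x y k : Plane}
    (hx : y ≠ x) (hxk : y ≠ x + k) :
    ‖B y * Real.log ‖x + k - y‖ - B y * Real.log ‖x - y‖ - newtonKernel B x y k‖
      ≤ 4 * ‖k‖ ^ s * (‖B y‖ * ‖x - y‖ ^ (-s) + ‖B y‖ * ‖x + k - y‖ ^ (-s)) := by
  have hshift : x - y + k = x + k - y := by abel
  have htaylor := abs_log_norm_add_sub_le hs₁ hs₂ (sub_ne_zero.2 hx.symm)
    (hshift ▸ sub_ne_zero.2 hxk.symm)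
  rw [hshift] at htaylor
  rw [newtonKernel_apply, ← mul_sub, ← mul_sub, norm_mul, Real.norm_eq_abs (_ - _ - _)]
  refine (mul_le_mul_of_nonneg_left htaylor (norm_nonneg _)).trans_eq ?_
  ring

theorem AdmissibleField.hasFDerivAt_integral_mul_log (hB : AdmissibleField B) (x : Plane) :
    HasFDerivAt (fun x => ∫ y, B y * Real.log ‖x - y‖) (∫ y, newtonKernel B x y) x := by
  obtain ⟨s₀, hs₀, hs₀2, hriesz⟩ := hB.exists_riesz_bound
  obtain ⟨s, hs, hss₀⟩ := exists_between hs₀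
  obtain ⟨C, hC⟩ := hriesz s (by linarith) hss₀
  refine hasFDerivAt_of_norm_sub_le_rpow (C := 8 * C) hs fun k => ?_
  have hlog := hB.integrable_mul_log
  have hker : Integrable fun y => newtonKernel B x y k :=
    (hB.integrable_newtonKernel x).apply_continuousLinearMap k
  rw [ContinuousLinearMap.integral_apply (hB.integrable_newtonKernel x),
    ← integral_sub (hlog (x + k)) (hlog x),
    ← integral_sub (by exact (hlog (x + k)).sub (hlog x)) hker]
  calc _ ≤ ∫ y, 4 * ‖k‖ ^ s * (‖B y‖ * ‖x - y‖ ^ (-s) + ‖B y‖ * ‖x + k - y‖ ^ (-s)) := by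
        refine norm_integral_le_of_norm_le (((hC x).1.add (hC (x + k)).1).const_mul _) ?_
        filter_upwards [(ae_iff.2 (by simp) : ∀ᵐ y : Plane, y ≠ x),
          (ae_iff.2 (by simp) : ∀ᵐ y : Plane, y ≠ x + k)] with y hx hxk
        exact norm_log_sub_newtonKernel_le hs.le (by linarith) hx hxk
    _ = 4 * ‖k‖ ^ s * ((∫ y, ‖B y‖ * ‖x - y‖ ^ (-s)) + ∫ y, ‖B y‖ * ‖x + k - y‖ ^ (-s)) := by
        rw [integral_const_mul, integral_add (hC x).1 (hC (x + k)).1]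
    _ ≤ 4 * ‖k‖ ^ s * (C + C) := by
        gcongr
        exacts [(hC x).2, (hC (x + k)).2]
    _ = 8 * C * ‖k‖ ^ s := by ring

theorem AdmissibleField.hasFDerivAt_scalarPotential (hB : AdmissibleField B) (x : Plane) :
    HasFDerivAt (scalarPotential B) ((-(1 / (2 * Real.pi))) • ∫ y, newtonKernel B x y) x :=
  (hB.hasFDerivAt_integral_mul_log x).const_mul _

theorem AdmissibleField.differentiable_scalarPotential (hB : AdmissibleField B) :
    Differentiable ℝ (scalarPotential B) := fun x =>
  (hB.hasFDerivAt_scalarPotential x).differentiableAt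

theorem AdmissibleField.exists_norm_fderiv_scalarPotential_le (hB : AdmissibleField B) :
    ∃ C : ℝ, 0 ≤ C ∧ ∀ x, ‖fderiv ℝ (scalarPotential B) x‖ ≤ C := by
  obtain ⟨C, hC⟩ := hB.exists_newton_bound
  have hC0 : 0 ≤ C := (integral_nonneg fun y => by positivity).trans (hC 0).2
  refine ⟨1 / (2 * Real.pi) * C, by positivity, fun x => ?_⟩
  rw [(hB.hasFDerivAt_scalarPotential x).fderiv, norm_smul, norm_neg,
    Real.norm_of_nonneg (by positivity)]
  gcongr
  refine (norm_integral_le_integral_norm _).trans ?_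
  simpa only [norm_newtonKernel] using (hC x).2

end Potential

section Product

variable {a b c d : ℝ}

theorem intervalIntegral_prod_eq_setIntegral {E : Type*} [NormedAddCommGroup E] [NormedSpace ℝ E]
    (hab : a ≤ b) (hcd : c ≤ d) {f : ℝ × ℝ → E} (hf : ContinuousOn f (Icc a b ×ˢ Icc c d)) :
    ∫ r in a..b, ∫ θ in c..d, f (r, θ) = ∫ p in Ioc a b ×ˢ Ioc c d, f p := by
  have hint : IntegrableOn f (Ioc a b ×ˢ Ioc c d) :=
    (hf.integrableOn_compact (isCompact_Icc.prod isCompact_Icc)).mono_set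
      (Set.prod_mono Ioc_subset_Icc_self Ioc_subset_Icc_self)
  rw [Measure.volume_eq_prod, setIntegral_prod _ (by rwa [← Measure.volume_eq_prod]),
    intervalIntegral.integral_of_le hab]
  simp only [intervalIntegral.integral_of_le hcd]

theorem intervalIntegral_prod_mono (hab : a ≤ b) (hcd : c ≤ d) {f g : ℝ × ℝ → ℝ}
    (hf : ContinuousOn f (Icc a b ×ˢ Icc c d)) (hg : ContinuousOn g (Icc a b ×ˢ Icc c d))
    (h : ∀ p : ℝ × ℝ, a < p.1 → p.1 ≤ b → f p ≤ g p) :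
    ∫ r in a..b, ∫ θ in c..d, f (r, θ) ≤ ∫ r in a..b, ∫ θ in c..d, g (r, θ) := by
  have hint : ∀ {k : ℝ × ℝ → ℝ}, ContinuousOn k (Icc a b ×ˢ Icc c d) →
      IntegrableOn k (Ioc a b ×ˢ Ioc c d) := fun hk =>
    (hk.integrableOn_compact (isCompact_Icc.prod isCompact_Icc)).mono_set
      (Set.prod_mono Ioc_subset_Icc_self Ioc_subset_Icc_self)
  rw [intervalIntegral_prod_eq_setIntegral hab hcd hf,
    intervalIntegral_prod_eq_setIntegral hab hcd hg]
  exact setIntegral_mono_on (hint hf) (hint hg) (measurableSet_Ioc.prod measurableSet_Ioc)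
    fun p hp => h p hp.1.1 hp.1.2

end Product

theorem plane_eq_sum (v : Plane) :
    v = v 0 • EuclideanSpace.single 0 1 + v 1 • EuclideanSpace.single 1 1 := by
  ext i; fin_cases i <;> simp

theorem clm_apply_plane {E : Type*} [NormedAddCommGroup E] [NormedSpace ℝ E] (L : Plane →L[ℝ] E)
    (v : Plane) :
    L v = v 0 • L (EuclideanSpace.single 0 1) + v 1 • L (EuclideanSpace.single 1 1) := by
  conv_lhs => rw [plane_eq_sum v]
  rw [map_add, map_smul, map_smul]

/-- The point of the plane with polar coordinates `p = (r, θ)`. -/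
noncomputable def polarPt (p : ℝ × ℝ) : Plane := !₂[p.1 * Real.cos p.2, p.1 * Real.sin p.2]

theorem contDiff_polarPt {n : WithTop ℕ∞} : ContDiff ℝ n polarPt := by
  refine contDiff_euclidean.2 fun i => ?_
  fin_cases i <;> simp only [polarPt, Fin.zero_eta, Fin.mk_one, PiLp.toLp_apply,
    Matrix.cons_val_zero, Matrix.cons_val_one] <;> fun_prop

theorem norm_polarPt (p : ℝ × ℝ) : ‖polarPt p‖ = |p.1| := by
  rw [EuclideanSpace.norm_eq, ← Real.sqrt_sq_eq_abs]
  congr 1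
  simp only [polarPt, Fin.sum_univ_two, Real.norm_eq_abs, sq_abs, PiLp.toLp_apply,
    Matrix.cons_val_zero, Matrix.cons_val_one]
  linear_combination p.1 ^ 2 * Real.sin_sq_add_cos_sq p.2

theorem polarPt_add_two_pi (r θ : ℝ) : polarPt (r, θ + 2 * Real.pi) = polarPt (r, θ) := by
  simp [polarPt]

theorem differentiableAt_polarPt (p : ℝ × ℝ) : DifferentiableAt ℝ polarPt p :=
  contDiff_polarPt.differentiable one_ne_zero p

theorem fderiv_polarPt (p u : ℝ × ℝ) :
    fderiv ℝ polarPt p u = !₂[u.1 * Real.cos p.2 - u.2 * (p.1 * Real.sin p.2),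
      u.1 * Real.sin p.2 + u.2 * (p.1 * Real.cos p.2)] := by
  have hcoord : ∀ i, HasFDerivAt (fun q => polarPt q i)
      ((EuclideanSpace.proj i).comp (fderiv ℝ polarPt p)) p := fun i =>
    (EuclideanSpace.proj (𝕜 := ℝ) i).hasFDerivAt.comp p (differentiableAt_polarPt p).hasFDerivAt
  have hcos : HasFDerivAt (fun q => polarPt q 0) _ p :=
    hasFDerivAt_fst.mul' (hasFDerivAt_snd (p := p)).cos
  have hsin : HasFDerivAt (fun q => polarPt q 1) _ p :=
    hasFDerivAt_fst.mul' (hasFDerivAt_snd (p := p)).sin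
  ext i
  fin_cases i
  · refine (congrArg (fun L => L u) ((hcoord 0).unique hcos)).trans ?_
    simp
    ring
  · refine (congrArg (fun L => L u) ((hcoord 1).unique hsin)).trans ?_
    simp
    ring

theorem integral_eq_integral_polar {E : Type*} [NormedAddCommGroup E] [NormedSpace ℝ E]
    (f : Plane → E) :
    ∫ x, f x = ∫ p in Ioi (0 : ℝ) ×ˢ Ioo (-Real.pi) Real.pi, p.1 • f (polarPt p) := by
  have hcart : ∫ x, f x = ∫ p : ℝ × ℝ, f (!₂[p.1, p.2]) := by
    rw [← (PiLp.volume_preserving_toLp (Fin 2)).integral_comp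
        (MeasurableEquiv.toLp 2 (Fin 2 → ℝ)).measurableEmbedding,
      ← (volume_preserving_finTwoArrow ℝ).symm.integral_comp
        (MeasurableEquiv.finTwoArrow (α := ℝ)).symm.measurableEmbedding]
    rfl
  rw [hcart, ← integral_comp_polarCoord_symm, polarCoord_target]
  rfl

theorem integral_eq_intervalIntegral_polar {E : Type*} [NormedAddCommGroup E] [NormedSpace ℝ E]
    {R : ℝ} (hR : 0 ≤ R) {f : Plane → E} {g : ℝ × ℝ → E}
    (hg : ContinuousOn g (Icc 0 R ×ˢ Icc (-Real.pi) Real.pi))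
    (hfg : ∀ p : ℝ × ℝ, 0 < p.1 → p.1 • f (polarPt p) = g p)
    (hf : ∀ x, R < ‖x‖ → f x = 0) :
    ∫ x, f x = ∫ r in (0)..R, ∫ θ in (-Real.pi)..Real.pi, g (r, θ) := by
  have hpi : -Real.pi ≤ Real.pi := by linarith [Real.pi_pos]
  rw [integral_eq_integral_polar, intervalIntegral_prod_eq_setIntegral hR hpi hg]
  calc ∫ p in Ioi (0 : ℝ) ×ˢ Ioo (-Real.pi) Real.pi, p.1 • f (polarPt p)
      = ∫ p in Ioc (0 : ℝ) R ×ˢ Ioo (-Real.pi) Real.pi, p.1 • f (polarPt p) := by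
        refine setIntegral_eq_of_subset_of_forall_sdiff_eq_zero
          (measurableSet_Ioi.prod measurableSet_Ioo)
          (Set.prod_mono Ioc_subset_Ioi_self le_rfl) ?_
        rintro p ⟨⟨hr : 0 < p.1, hθ⟩, hp⟩
        have hRp : R < p.1 := by
          by_contra! hle
          exact hp ⟨⟨hr, hle⟩, hθ⟩
        rw [hf _ (by rwa [norm_polarPt, abs_of_pos hr]), smul_zero]
    _ = ∫ p in Ioc (0 : ℝ) R ×ˢ Ioo (-Real.pi) Real.pi, g p :=
        setIntegral_congr_fun (measurableSet_Ioc.prod measurableSet_Ioo) fun p hp => hfg p hp.1.1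
    _ = ∫ p in Ioc (0 : ℝ) R ×ˢ Ioc (-Real.pi) Real.pi, g p := by
        refine setIntegral_congr_set ?_
        rw [Measure.volume_eq_prod]
        exact Measure.set_prod_ae_eq (ae_eq_refl _) Ioo_ae_eq_Ioc

section Gradient

variable {B : Plane → ℝ} {φ : Plane → ℝ}

theorem gradient_apply (φ : Plane → ℝ) (x : Plane) (j : Fin 2) :
    gradient φ x j = partialDeriv j φ x := by
  rw [partialDeriv, ← inner_gradient_left, EuclideanSpace.inner_single_right]
  simp

theorem IsTest.continuous_gradient (hφ : IsTest φ) : Continuous (gradient φ) :=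
  (InnerProductSpace.toDual ℝ Plane).symm.continuous.comp (hφ.smooth.continuous_fderiv (by simp))

theorem IsTest.integrable_gradient (hφ : IsTest φ) : Integrable (gradient φ) :=
  hφ.continuous_gradient.integrable_of_hasCompactSupport
    ((hφ.compact.fderiv (𝕜 := ℝ)).comp_left (map_zero _))

theorem IsTest.comp_add_right (hφ : IsTest φ) (y : Plane) : IsTest fun x => φ (x + y) :=
  ⟨hφ.smooth.comp (contDiff_id.add contDiff_const),
    hφ.compact.comp_homeomorph (Homeomorph.addRight y)⟩

theorem polar_fderiv_self {ψ : Plane → ℝ} (hψ : Differentiable ℝ ψ) {p : ℝ × ℝ} (hp : 0 < p.1) :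
    p.1 • (fderiv ℝ ψ (polarPt p) (polarPt p) / ‖polarPt p‖ ^ 2)
      = fderiv ℝ (ψ ∘ polarPt) p (1, 0) := by
  have hpt : polarPt p = p.1 • fderiv ℝ polarPt p (1, 0) := by
    rw [fderiv_polarPt]
    ext i
    fin_cases i <;> simp [polarPt]
  rw [fderiv_comp p (hψ _) (differentiableAt_polarPt p), ContinuousLinearMap.comp_apply,
    norm_polarPt, sq_abs, smul_eq_mul]
  conv_lhs => enter [2, 1]; rw [congrArg (fderiv ℝ ψ (polarPt p)) hpt, map_smul, smul_eq_mul]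
  field_simp

theorem integral_fderiv_self_div_norm_sq {ψ : Plane → ℝ} (hψ : ContDiff ℝ 1 ψ)
    (hc : HasCompactSupport ψ) : ∫ x, fderiv ℝ ψ x x / ‖x‖ ^ 2 = -(2 * Real.pi * ψ 0) := by
  obtain ⟨R₀, hR₀, hsupp⟩ := hc.exists_pos_le_norm
  obtain ⟨R₁, -, hsupp'⟩ := (hc.fderiv (𝕜 := ℝ)).exists_pos_le_norm
  set R := max R₀ R₁
  have hR : 0 < R := lt_max_of_lt_left hR₀
  set Ψ : ℝ × ℝ → ℝ := ψ ∘ polarPt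
  have hΨ : ContDiff ℝ 1 Ψ := hψ.comp contDiff_polarPt
  have hcont : Continuous fun p => fderiv ℝ Ψ p (1, 0) :=
    (hΨ.continuous_fderiv one_ne_zero).clm_apply continuous_const
  have hcircle : ∀ θ, Ψ (R, θ) = 0 := fun θ => hsupp _ (by
    rw [norm_polarPt, abs_of_pos hR]; exact le_max_left _ _)
  have horigin : ∀ θ, Ψ (0, θ) = ψ 0 := fun θ => congrArg ψ (by
    ext i; fin_cases i <;> simp [polarPt])
  have hdiv := integral2_divergence_prod_of_hasFDerivAt Ψ (fun _ => (0 : ℝ)) (fderiv ℝ Ψ)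
    (fun _ => 0) 0 (-Real.pi) R Real.pi hΨ.continuous.continuousOn continuousOn_const
    (fun x _ => (hΨ.differentiable one_ne_zero x).hasFDerivAt)
    (fun x _ => hasFDerivAt_const _ _)
    (by simpa only [zero_apply, add_zero] using
      hcont.continuousOn.integrableOn_compact (isCompact_uIcc.prod isCompact_uIcc))
  simp only [zero_apply, add_zero, hcircle, horigin, intervalIntegral.integral_zero,
    intervalIntegral.integral_const, sub_self, zero_sub, smul_eq_mul] at hdiv
  rw [integral_eq_intervalIntegral_polar hR.le hcont.continuousOn
    (fun p hp => polar_fderiv_self (hψ.differentiable one_ne_zero) hp) fun x hx => by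
      rw [hsupp' x ((le_max_right _ _).trans hx.le), zero_apply, zero_div], hdiv]
  ring

theorem IsTest.integral_inner_gradient_div_norm_sq (hφ : IsTest φ) (y : Plane) :
    ∫ x, inner ℝ (x - y) (gradient φ x) / ‖x - y‖ ^ 2 = -(2 * Real.pi * φ y) := by
  have hψ := hφ.comp_add_right y
  have h := integral_fderiv_self_div_norm_sq (hψ.smooth.of_le (by simp)) hψ.compact
  rw [zero_add] at h
  rw [← h, ← integral_add_right_eq_self _ y]
  congr 1 with x
  rw [add_sub_cancel_right, inner_gradient_right, fderiv_comp_add_right]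
  rfl

theorem AdmissibleField.integrable_newtonKernel_apply (hB : AdmissibleField B) {G : Plane → Plane}
    (hG : Integrable G) : Integrable (Function.uncurry fun x y => newtonKernel B x y (G x))
      (volume.prod volume) := by
  obtain ⟨C, hC⟩ := hB.exists_newton_bound
  have hle : ∀ x y, ‖newtonKernel B x y (G x)‖ ≤ ‖G x‖ * (‖B y‖ * ‖x - y‖⁻¹) := fun x y => by
    rw [mul_comm, ← norm_newtonKernel]
    exact (newtonKernel B x y).le_opNorm _
  have hmeas : AEStronglyMeasurable (Function.uncurry fun x y => newtonKernel B x y (G x))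
      (volume.prod volume) := by
    have hsub : AEStronglyMeasurable (fun p : Plane × Plane => p.1 - p.2) (volume.prod volume) :=
      (by fun_prop : Continuous fun p : Plane × Plane => p.1 - p.2).aestronglyMeasurable
    have hinv : Measurable fun p : Plane × Plane => (‖p.1 - p.2‖ ^ 2)⁻¹ := by fun_prop
    simp only [Function.uncurry_def, newtonKernel_apply, div_eq_mul_inv]
    exact hB.integrable.aestronglyMeasurable.comp_snd.mul
      ((hsub.inner hG.aestronglyMeasurable.comp_fst).mul hinv.aestronglyMeasurable)
  have hslice : ∀ x, Integrable fun y => newtonKernel B x y (G x) := fun x =>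
    (hB.integrable_newtonKernel x).apply_continuousLinearMap (G x)
  rw [integrable_prod_iff hmeas]
  refine ⟨Eventually.of_forall hslice, (hG.norm.mul_const C).mono'
    hmeas.norm.integral_prod_right' (Eventually.of_forall fun x => ?_)⟩
  rw [Real.norm_of_nonneg (integral_nonneg fun y => norm_nonneg _)]
  calc _ ≤ ∫ y, ‖G x‖ * (‖B y‖ * ‖x - y‖⁻¹) :=
        integral_mono (hslice x).norm ((hC x).1.const_mul _) (hle x)
    _ ≤ _ := by
        rw [integral_const_mul]
        gcongr
        exact (hC x).2

theorem AdmissibleField.integral_fderiv_scalarPotential_gradient (hB : AdmissibleField B)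
    (hφ : IsTest φ) :
    ∫ x, fderiv ℝ (scalarPotential B) x (gradient φ x) = ∫ x, B x * φ x := by
  have hgrad : ∀ x, fderiv ℝ (scalarPotential B) x (gradient φ x)
      = -(1 / (2 * Real.pi)) * ∫ y, newtonKernel B x y (gradient φ x) := fun x => by
    rw [(hB.hasFDerivAt_scalarPotential x).fderiv, smul_apply, smul_eq_mul,
      ContinuousLinearMap.integral_apply (hB.integrable_newtonKernel x)]
  simp_rw [hgrad]
  rw [integral_const_mul,
    integral_integral_swap (hB.integrable_newtonKernel_apply hφ.integrable_gradient),
    ← integral_const_mul]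
  congr 1 with y
  simp_rw [newtonKernel_apply]
  rw [integral_const_mul, hφ.integral_inner_gradient_div_norm_sq]
  field_simp

theorem AdmissibleField.isBoundedPotential (hB : AdmissibleField B) :
    IsBoundedPotential B (vectorPotential B) := by
  obtain ⟨C, -, hC⟩ := hB.exists_norm_fderiv_scalarPotential_le
  have hbound : ∀ j x, |partialDeriv j (scalarPotential B) x| ≤ C := fun j x =>
    ((fderiv ℝ (scalarPotential B) x).le_opNorm _).trans (by simpa using hC x)
  have hmeas : ∀ j, Measurable (partialDeriv j (scalarPotential B)) := fun j =>
    measurable_fderiv_apply_const ℝ _ _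
  refine ⟨memLp_top_of_bound (C := C + C) ?_ (Eventually.of_forall fun x => ?_), fun φ hφ => ?_⟩
  · have hpi : Measurable fun x => ![partialDeriv 1 (scalarPotential B) x,
        -partialDeriv 0 (scalarPotential B) x] := by
      refine measurable_pi_iff.2 fun i => ?_
      fin_cases i
      exacts [hmeas 1, (hmeas 0).neg]
    exact ((MeasurableEquiv.toLp 2 (Fin 2 → ℝ)).measurable.comp hpi).aestronglyMeasurable
  · rw [plane_eq_sum (vectorPotential B x)]
    refine (norm_add_le _ _).trans ?_
    simpa [norm_smul, vectorPotential] using add_le_add (hbound 1 x) (hbound 0 x)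
  · rw [← hB.integral_fderiv_scalarPotential_gradient hφ]
    congr 1 with x
    rw [clm_apply_plane, gradient_apply, gradient_apply]
    simp only [vectorPotential, partialDeriv, PiLp.toLp_apply, Matrix.cons_val_zero,
      Matrix.cons_val_one, smul_eq_mul]
    ring

theorem AdmissibleField.exists_integral_mul_le (hB : AdmissibleField B) :
    ∃ C : ℝ, 0 ≤ C ∧ ∀ φ : Plane → ℝ, IsTest φ →
      ∫ x, B x * φ x ≤ C * ∫ x, ‖gradient φ x‖ := by
  obtain ⟨C, hC0, hC⟩ := hB.exists_norm_fderiv_scalarPotential_le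
  refine ⟨C, hC0, fun φ hφ => ?_⟩
  rw [← hB.integral_fderiv_scalarPotential_gradient hφ, ← integral_const_mul]
  refine (Real.le_norm_self _).trans (norm_integral_le_of_norm_le
    (hφ.integrable_gradient.norm.const_mul C) (Eventually.of_forall fun x => ?_))
  exact (fderiv ℝ (scalarPotential B) x).le_of_opNorm_le (hC x) _

end Gradient

/-! ### The Hardy inequality with radial weight -/

section Current

variable {E : Type*} [NormedAddCommGroup E] [NormedSpace ℝ E] {w : E → ℂ} {p : E}

/-- The component `Im (w̄ ∂ᵥ w)` of the probability current of `w` in the direction `v`. -/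
noncomputable def current (w : E → ℂ) (v p : E) : ℝ :=
  (conj (w p) * fderiv ℝ w p v).im

theorem differentiableAt_current (hw : ContDiffAt ℝ 2 w p) (v : E) :
    DifferentiableAt ℝ (current w v) p := by
  have hconj : DifferentiableAt ℝ (fun q => conj (w q)) p :=
    Complex.conjCLE.differentiableAt.comp p (hw.differentiableAt two_ne_zero)
  have hderiv : DifferentiableAt ℝ (fun q => fderiv ℝ w q v) p :=
    ((hw.fderiv_right (m := 1) (by norm_num)).differentiableAt one_ne_zero).clm_apply
      (differentiableAt_const v)
  exact Complex.imCLM.differentiableAt.comp p (hconj.mul hderiv)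

theorem fderiv_current (hw : ContDiffAt ℝ 2 w p) (u v : E) :
    fderiv ℝ (current w v) p u = (conj (fderiv ℝ w p u) * fderiv ℝ w p v
      + conj (w p) * fderiv ℝ (fderiv ℝ w) p u v).im := by
  have hconj : HasDerivAt (fun t : ℝ => conj (w (p + t • u))) (conj (fderiv ℝ w p u)) 0 :=
    HasDerivAt.star ((hw.differentiableAt two_ne_zero).hasFDerivAt.hasLineDerivAt u)
  have hderiv : HasDerivAt (fun t : ℝ => fderiv ℝ w (p + t • u) v)
      (fderiv ℝ (fderiv ℝ w) p u v) 0 :=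
    (ContinuousLinearMap.apply ℝ ℂ v).hasFDerivAt.comp_hasDerivAt 0
      (((hw.fderiv_right (m := 1) (by norm_num)).differentiableAt
        one_ne_zero).hasFDerivAt.hasLineDerivAt u)
  have him : HasDerivAt (fun t : ℝ => current w v (p + t • u)) _ 0 :=
    Complex.imCLM.hasFDerivAt.comp_hasDerivAt 0 (hconj.mul hderiv)
  simpa using ((differentiableAt_current hw v).hasFDerivAt.hasLineDerivAt u).unique him

theorem fderiv_current_sub_fderiv_current (hw : ContDiffAt ℝ 2 w p) (u v : E) :
    fderiv ℝ (current w v) p u - fderiv ℝ (current w u) p v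
      = 2 * (conj (fderiv ℝ w p u) * fderiv ℝ w p v).im := by
  rw [fderiv_current hw, fderiv_current hw, (hw.isSymmSndFDerivAt (by simp)) u v]
  simp only [Complex.add_im, Complex.mul_im, Complex.conj_re, Complex.conj_im]
  ring

theorem current_periodic {c : E} (hw : Function.Periodic w c) (v : E) :
    Function.Periodic (current w v) c := by
  intro q
  have hderiv : fderiv ℝ w (q + c) = fderiv ℝ w q := by
    rw [← fderiv_comp_add_right c]
    exact congrArg (fun f => fderiv ℝ f q) (funext hw)
  simp only [current, hw q, hderiv]

end Current

section Strip

variable {w : ℝ × ℝ → ℂ} {s : ℝ → ℝ} {p : ℝ × ℝ}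

/-- The density `Im (w̄ ∂₂ w) + s |w|²` on a circle, in polar coordinates `p = (r, θ)`. -/
noncomputable def stripFlux (w : ℝ × ℝ → ℂ) (s : ℝ → ℝ) (p : ℝ × ℝ) : ℝ :=
  current w (0, 1) p + s p.1 * ‖w p‖ ^ 2

/-- The divergence of the field `(stripFlux w s, -Im (w̄ ∂₁ w))`, in which the second derivatives
of `w` cancel. -/
noncomputable def stripDensity (w : ℝ × ℝ → ℂ) (s : ℝ → ℝ) (p : ℝ × ℝ) : ℝ :=
  2 * (conj (fderiv ℝ w p (1, 0)) * fderiv ℝ w p (0, 1)).im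
    + (deriv s p.1 * ‖w p‖ ^ 2 + 2 * s p.1 * (conj (w p) * fderiv ℝ w p (1, 0)).re)

theorem differentiableAt_comp_fst_mul_norm_sq (hw : DifferentiableAt ℝ w p)
    (hs : DifferentiableAt ℝ s p.1) :
    DifferentiableAt ℝ (fun q : ℝ × ℝ => s q.1 * ‖w q‖ ^ 2) p :=
  (hs.comp p differentiableAt_fst).mul (hw.norm_sq ℝ)

theorem fderiv_comp_fst_mul_norm_sq (hw : DifferentiableAt ℝ w p)
    (hs : DifferentiableAt ℝ s p.1) :
    fderiv ℝ (fun q : ℝ × ℝ => s q.1 * ‖w q‖ ^ 2) p (1, 0)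
      = deriv s p.1 * ‖w p‖ ^ 2 + 2 * s p.1 * (conj (w p) * fderiv ℝ w p (1, 0)).re := by
  have hline : HasDerivAt (fun t : ℝ => s (p + t • ((1 : ℝ), (0 : ℝ))).1) (deriv s p.1) 0 := by
    have h := HasDerivAt.comp_const_add p.1 0 ((add_zero p.1).symm ▸ hs.hasDerivAt)
    simpa using h
  have hnorm := (hw.hasFDerivAt.hasLineDerivAt (1, 0)).norm_sq
  have h := ((differentiableAt_comp_fst_mul_norm_sq hw hs).hasFDerivAt.hasLineDerivAt
    (1, 0)).unique (hline.mul hnorm)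
  simp only [zero_smul, add_zero, Complex.inner] at h
  rw [h, mul_comm (conj (w p))]
  ring

theorem differentiableAt_stripFlux (hw : ContDiffAt ℝ 2 w p) (hs : DifferentiableAt ℝ s p.1) :
    DifferentiableAt ℝ (stripFlux w s) p :=
  (differentiableAt_current hw _).add
    (differentiableAt_comp_fst_mul_norm_sq (hw.differentiableAt two_ne_zero) hs)

theorem fderiv_stripFlux_sub_fderiv_current (hw : ContDiffAt ℝ 2 w p)
    (hs : DifferentiableAt ℝ s p.1) :
    fderiv ℝ (stripFlux w s) p (1, 0) - fderiv ℝ (current w (1, 0)) p (0, 1)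
      = stripDensity w s p := by
  have hw' := hw.differentiableAt two_ne_zero
  have hsum : fderiv ℝ (stripFlux w s) p = fderiv ℝ (current w (0, 1)) p
      + fderiv ℝ (fun q : ℝ × ℝ => s q.1 * ‖w q‖ ^ 2) p :=
    fderiv_add (differentiableAt_current hw _) (differentiableAt_comp_fst_mul_norm_sq hw' hs)
  rw [hsum, add_apply, add_sub_right_comm,
    fderiv_current_sub_fderiv_current hw, fderiv_comp_fst_mul_norm_sq hw' hs, stripDensity]

theorem continuousAt_stripDensity (hw : ContDiffAt ℝ 2 w p) (hs : ContDiffAt ℝ 1 s p.1) :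
    ContinuousAt (stripDensity w s) p := by
  have hderiv : ∀ v, ContinuousAt (fun q => fderiv ℝ w q v) p := fun v =>
    (hw.fderiv_right (m := 1) (by norm_num)).continuousAt.clm_apply continuousAt_const
  have hs₀ : ContinuousAt (fun q : ℝ × ℝ => s q.1) p :=
    ContinuousAt.comp (f := Prod.fst) hs.continuousAt continuousAt_fst
  have hs₁ : ContinuousAt (fun q : ℝ × ℝ => deriv s q.1) p := by
    refine ContinuousAt.comp (f := Prod.fst) (g := deriv s) ?_ continuousAt_fst
    have h : ContinuousAt (fun r => fderiv ℝ s r 1) p.1 :=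
      (hs.fderiv_right (m := 0) (by norm_num)).continuousAt.clm_apply continuousAt_const
    simpa only [fderiv_apply_one_eq_deriv] using h
  have him : ContinuousAt
      (fun q => (conj (fderiv ℝ w q (1, 0)) * fderiv ℝ w q (0, 1)).im) p :=
    Complex.continuous_im.continuousAt.comp
      ((Complex.continuous_conj.continuousAt.comp (hderiv _)).mul (hderiv _))
  have hre : ContinuousAt (fun q => (conj (w q) * fderiv ℝ w q (1, 0)).re) p :=
    Complex.continuous_re.continuousAt.comp
      ((Complex.continuous_conj.continuousAt.comp hw.continuousAt).mul (hderiv _))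
  exact (him.const_mul 2).add
    ((hs₁.mul (hw.continuousAt.norm.pow 2)).add ((hs₀.const_mul 2).mul hre))

theorem integral_stripDensity {a b : ℝ} (hab : a ≤ b)
    (hw : ∀ p : ℝ × ℝ, p.1 ∈ Icc a b → ContDiffAt ℝ 2 w p)
    (hs : ∀ r ∈ Icc a b, ContDiffAt ℝ 1 s r)
    (hper : Function.Periodic w (0, 2 * Real.pi)) :
    ∫ r in a..b, ∫ θ in (-Real.pi)..Real.pi, stripDensity w s (r, θ) =
      (∫ θ in (-Real.pi)..Real.pi, stripFlux w s (b, θ))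
        - ∫ θ in (-Real.pi)..Real.pi, stripFlux w s (a, θ) := by
  set T : Set (ℝ × ℝ) := uIcc a b ×ˢ uIcc (-Real.pi) Real.pi
  have hT : ∀ p ∈ T, p.1 ∈ Icc a b := fun p hp => uIcc_of_le hab ▸ hp.1
  have hT' : ∀ p ∈ Ioo (min a b) (max a b) ×ˢ
      Ioo (min (-Real.pi) Real.pi) (max (-Real.pi) Real.pi), p.1 ∈ Icc a b := fun p hp => by
    simpa only [min_eq_left hab, max_eq_right hab] using Ioo_subset_Icc_self hp.1
  have hs' : ∀ r ∈ Icc a b, DifferentiableAt ℝ s r := fun r hr =>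
    (hs r hr).differentiableAt one_ne_zero
  have hF : ∀ p : ℝ × ℝ, p.1 ∈ Icc a b → HasFDerivAt (stripFlux w s) _ p := fun p hp =>
    (differentiableAt_stripFlux (hw p hp) (hs' _ hp)).hasFDerivAt
  have hG : ∀ p : ℝ × ℝ, p.1 ∈ Icc a b → HasFDerivAt (-current w (1, 0)) _ p := fun p hp =>
    (differentiableAt_current (hw p hp) _).hasFDerivAt.neg
  have hdiv : ∀ p : ℝ × ℝ, p.1 ∈ Icc a b → fderiv ℝ (stripFlux w s) p (1, 0)
      + (-fderiv ℝ (current w (1, 0)) p) (0, 1) = stripDensity w s p := fun p hp => by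
    rw [← fderiv_stripFlux_sub_fderiv_current (hw p hp) (hs' _ hp),
      neg_apply, sub_eq_add_neg]
  have hint : IntegrableOn (fun p => fderiv ℝ (stripFlux w s) p (1, 0)
      + (-fderiv ℝ (current w (1, 0)) p) (0, 1)) T :=
    ContinuousOn.integrableOn_compact (isCompact_uIcc.prod isCompact_uIcc) <|
      ContinuousOn.congr (f := stripDensity w s) (fun p hp => (continuousAt_stripDensity
        (hw _ (hT p hp)) (hs _ (hT p hp))).continuousWithinAt) fun p hp => hdiv p (hT p hp)
  have hends : ∀ r, current w (1, 0) (r, Real.pi) = current w (1, 0) (r, -Real.pi) := fun r => by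
    rw [← current_periodic hper (1, 0) (r, -Real.pi), Prod.mk_add_mk, add_zero]
    congr 2
    ring
  have h := integral2_divergence_prod_of_hasFDerivAt (stripFlux w s) (-current w (1, 0))
    _ _ a (-Real.pi) b Real.pi
    (fun p hp => (hF p (hT p hp)).continuousAt.continuousWithinAt)
    (fun p hp => (hG p (hT p hp)).continuousAt.continuousWithinAt)
    (fun p hp => hF p (hT' p hp)) (fun p hp => hG p (hT' p hp)) hint
  simp only [Pi.neg_apply, hends, sub_self, zero_add] at h
  rw [← h]
  refine intervalIntegral.integral_congr fun r hr => intervalIntegral.integral_congr fun θ _ => ?_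
  exact (hdiv (r, θ) (uIcc_of_le hab ▸ hr)).symm

end Strip

/-- Twice the Wirtinger derivative, `∂₀ v - i ∂₁ v`. -/
noncomputable def dz (v : Plane → ℂ) (x : Plane) : ℂ :=
  fderiv ℝ v x (EuclideanSpace.single 0 1) - Complex.I * fderiv ℝ v x (EuclideanSpace.single 1 1)

/-- The radial profile `1 / (ρ² + r² (1 + log² (r / ρ)))` of the weight of the Hardy inequality. -/
noncomputable def hardyWeight (ρ r : ℝ) : ℝ :=
  1 / (ρ ^ 2 + r ^ 2 * (1 + Real.log (r / ρ) ^ 2))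

section Weight

variable {α ρ r : ℝ}

theorem hardyWeight_nonneg (ρ r : ℝ) : 0 ≤ hardyWeight ρ r := by
  unfold hardyWeight
  positivity

theorem hardyWeight_le (hρ : 0 < ρ) (r : ℝ) : hardyWeight ρ r ≤ 1 / ρ ^ 2 :=
  one_div_le_one_div_of_le (by positivity) (le_add_of_nonneg_right (by positivity))

theorem continuous_hardyWeight (hρ : 0 < ρ) : Continuous (hardyWeight ρ) := by
  have hdenom : Continuous (fun r : ℝ => ρ ^ 2 + r ^ 2 * (1 + Real.log (r / ρ) ^ 2)) := by
    have heq : (fun r : ℝ => ρ ^ 2 + r ^ 2 * (1 + Real.log (r / ρ) ^ 2))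
        = fun r => ρ ^ 2 + (r ^ 2 + ρ ^ 2 * (r / ρ * Real.log (r / ρ)) ^ 2) := by
      funext r
      field_simp
    rw [heq]
    exact continuous_const.add ((continuous_id.pow 2).add (continuous_const.mul
      ((Real.continuous_mul_log.comp (continuous_id.div_const ρ)).pow 2)))
  exact continuous_const.div hdenom fun r => by positivity

theorem gPlus_of_le (h : r ≤ ρ) : gPlus α ρ r = 1 := if_pos h

theorem gPlus_of_ge (hρ : 0 < ρ) (h : ρ ≤ r) : gPlus α ρ r = (r / ρ) ^ α := by
  rcases h.eq_or_lt with rfl | h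
  · rw [gPlus_of_le le_rfl, div_self hρ.ne', Real.one_rpow]
  · rw [gPlus, if_neg (not_le.2 h), Real.div_rpow (hρ.trans h).le hρ.le, Real.rpow_neg hρ.le,
      mul_comm, div_eq_mul_inv]

theorem gPlus_pos (hρ : 0 < ρ) : 0 < gPlus α ρ r := by
  rcases le_total r ρ with h | h
  · rw [gPlus_of_le h]
    exact one_pos
  · rw [gPlus_of_ge hρ h]
    exact Real.rpow_pos_of_pos (div_pos (hρ.trans_le h) hρ) α

theorem continuous_gPlus (hα : 0 ≤ α) (hρ : 0 < ρ) : Continuous (gPlus α ρ) := by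
  refine continuous_if_le continuous_id continuous_const continuousOn_const
    (continuous_const.mul (Real.continuous_rpow_const hα)).continuousOn ?_
  rintro r rfl
  rw [← Real.rpow_add hρ, neg_add_cancel, Real.rpow_zero]

end Weight

theorem fderiv_comp_polarPt {v : Plane → ℂ} (hv : Differentiable ℝ v) (p u : ℝ × ℝ) :
    fderiv ℝ (v ∘ polarPt) p u = fderiv ℝ v (polarPt p) (fderiv ℝ polarPt p u) :=
  DFunLike.congr_fun (fderiv_comp p (hv _) (differentiableAt_polarPt p)) u

theorem norm_dz_polarPt {v : Plane → ℂ} (hv : Differentiable ℝ v) {p : ℝ × ℝ} (hp : p.1 ≠ 0) :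
    ‖dz v (polarPt p)‖ = ‖fderiv ℝ (v ∘ polarPt) p (1, 0)
      - Complex.I * fderiv ℝ (v ∘ polarPt) p (0, 1) / p.1‖ := by
  have hp' : (p.1 : ℂ) ≠ 0 := by exact_mod_cast hp
  suffices h : fderiv ℝ (v ∘ polarPt) p (1, 0)
      - Complex.I * fderiv ℝ (v ∘ polarPt) p (0, 1) / p.1
      = Complex.exp (p.2 * Complex.I) * dz v (polarPt p) by
    rw [h, norm_mul, Complex.norm_exp_ofReal_mul_I, one_mul]
  rw [fderiv_comp_polarPt hv, fderiv_comp_polarPt hv, clm_apply_plane,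
    clm_apply_plane _ (fderiv ℝ polarPt p (0, 1)), fderiv_polarPt, fderiv_polarPt,
    Complex.exp_mul_I, dz]
  simp only [Matrix.cons_val_zero, Matrix.cons_val_one, Complex.real_smul]
  push_cast
  field_simp
  linear_combination
    (p.1 * Complex.sin p.2 * fderiv ℝ v (polarPt p) (EuclideanSpace.single 1 1)) * Complex.I_sq

theorem continuous_dz {v : Plane → ℂ} (hv : ContDiff ℝ 1 v) : Continuous (dz v) := by
  have h : Continuous (fderiv ℝ v) := hv.continuous_fderiv one_ne_zero
  exact (h.clm_apply continuous_const).sub (continuous_const.mul (h.clm_apply continuous_const))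

theorem hasCompactSupport_dz {v : Plane → ℂ} (hv : HasCompactSupport v) :
    HasCompactSupport (dz v) :=
  (hv.fderiv (𝕜 := ℝ)).mono' fun x hx => subset_closure fun h => hx (by simp [dz, h])

section Wirtinger

variable {v : Plane → ℂ} {β ρ : ℝ} {p : ℝ × ℝ}

/-- The function `v` in polar coordinates `(r, θ)`, multiplied by `(r / ρ) ^ β`. -/
noncomputable def polarWeighted (β ρ : ℝ) (v : Plane → ℂ) (p : ℝ × ℝ) : ℂ :=
  (p.1 / ρ) ^ β • v (polarPt p)

theorem polarWeighted_zero (ρ : ℝ) (v : Plane → ℂ) : polarWeighted 0 ρ v = v ∘ polarPt := by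
  funext p
  simp only [polarWeighted, Real.rpow_zero, one_smul, Function.comp]

theorem polarWeighted_periodic (β ρ : ℝ) (v : Plane → ℂ) :
    Function.Periodic (polarWeighted β ρ v) (0, 2 * Real.pi) := by
  rintro ⟨r, θ⟩
  simp only [polarWeighted, Prod.mk_add_mk, add_zero, polarPt_add_two_pi]

theorem contDiffAt_polarWeighted {n : WithTop ℕ∞} (hv : ContDiff ℝ n v) (hρ : ρ ≠ 0)
    (h : β = 0 ∨ p.1 ≠ 0) : ContDiffAt ℝ n (polarWeighted β ρ v) p := by
  have hcomp : ContDiffAt ℝ n (v ∘ polarPt) p := (hv.comp contDiff_polarPt).contDiffAt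
  rcases h with rfl | hp
  · rwa [polarWeighted_zero]
  · exact ((contDiffAt_fst.div_const ρ).rpow_const_of_ne (div_ne_zero hp hρ)).smul hcomp

theorem fderiv_polarWeighted (hv : Differentiable ℝ v) (hρ : 0 < ρ) (hp : 0 < p.1) (u : ℝ × ℝ) :
    fderiv ℝ (polarWeighted β ρ v) p u
      = (u.1 * β / p.1) • polarWeighted β ρ v p
        + (p.1 / ρ) ^ β • fderiv ℝ (v ∘ polarPt) p u := by
  have hcomp : DifferentiableAt ℝ (v ∘ polarPt) p := (hv _).comp p (differentiableAt_polarPt p)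
  have hpow : HasDerivAt (fun r : ℝ => (r / ρ) ^ β) (β / p.1 * (p.1 / ρ) ^ β) p.1 := by
    refine (((hasDerivAt_id p.1).div_const ρ).rpow_const
      (Or.inl (div_pos hp hρ).ne')).congr_deriv ?_
    rw [id, Real.rpow_sub_one (div_pos hp hρ).ne']
    field_simp
  have hpow' : HasFDerivAt (fun q : ℝ × ℝ => (q.1 / ρ) ^ β) _ p :=
    HasDerivAt.comp_hasFDerivAt p hpow (hasFDerivAt_fst (𝕜 := ℝ) (p := p))
  rw [(show HasFDerivAt (polarWeighted β ρ v) _ p from hpow'.smul hcomp.hasFDerivAt).fderiv]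
  simp only [add_apply, smul_apply, ContinuousLinearMap.smulRight_apply,
    ContinuousLinearMap.coe_fst', polarWeighted, smul_smul, smul_eq_mul]
  rw [add_comm]
  congr 2
  ring

theorem rpow_mul_norm_dz_polarPt (hv : Differentiable ℝ v) (hρ : 0 < ρ) (hp : 0 < p.1) :
    (p.1 / ρ) ^ β * ‖dz v (polarPt p)‖
      = ‖fderiv ℝ (polarWeighted β ρ v) p (1, 0) - β / p.1 * polarWeighted β ρ v p
        - Complex.I * fderiv ℝ (polarWeighted β ρ v) p (0, 1) / p.1‖ := by
  have hpos : 0 ≤ (p.1 / ρ) ^ β := by positivity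
  rw [norm_dz_polarPt hv hp.ne', fderiv_polarWeighted hv hρ hp, fderiv_polarWeighted hv hρ hp,
    ← Real.norm_of_nonneg hpos, ← norm_smul, Real.norm_of_nonneg hpos]
  congr 1
  simp only [Complex.real_smul]
  push_cast
  ring

end Wirtinger

section Riccati

variable {β r s s' q : ℝ}

theorem mul_norm_sub_I_mul_div_sq (hr : r ≠ 0) (z w : ℂ) :
    r * ‖z - Complex.I * w / r‖ ^ 2 = r * ‖z‖ ^ 2 + ‖w‖ ^ 2 / r + 2 * (conj z * w).im := by
  simp only [← Complex.normSq_eq_norm_sq, Complex.normSq_apply, Complex.sub_re, Complex.sub_im,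
    Complex.div_ofReal_re, Complex.div_ofReal_im, Complex.mul_re, Complex.mul_im, Complex.I_re,
    Complex.I_im, Complex.conj_re, Complex.conj_im]
  field_simp
  ring

theorem norm_sub_ofReal_mul_sq (z w : ℂ) (t : ℝ) :
    ‖w - t * z‖ ^ 2 = ‖w‖ ^ 2 - 2 * t * (conj z * w).re + t ^ 2 * ‖z‖ ^ 2 := by
  simp only [← Complex.normSq_eq_norm_sq, Complex.normSq_apply, Complex.sub_re, Complex.sub_im,
    Complex.mul_re, Complex.mul_im, Complex.ofReal_re, Complex.ofReal_im, Complex.conj_re,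
    Complex.conj_im]
  ring

/-- Completing the square in `zr` leaves the Riccati expression `s' + (s + β) ^ 2 / r + r * q` as
the coefficient of `‖z‖ ^ 2`. -/
theorem strip_pointwise (hr : 0 < r) (h : s' + (s + β) ^ 2 / r + r * q ≤ 0) (z zr zt : ℂ) :
    2 * (conj zr * zt).im + (s' * ‖z‖ ^ 2 + 2 * s * (conj z * zr).re)
      ≤ r * (‖zr - β / r * z - Complex.I * zt / r‖ ^ 2 - q * ‖z‖ ^ 2) := by
  have hshift : zr - β / r * z - Complex.I * zt / r
      = zr - Complex.I * (zt - Complex.I * (β * z)) / r := by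
    linear_combination (-β * z / r) * Complex.I_sq
  have hcross : (conj zr * (zt - Complex.I * (β * z))).im
      = (conj zr * zt).im - β * (conj z * zr).re := by
    simp only [Complex.sub_re, Complex.sub_im, Complex.mul_re, Complex.mul_im, Complex.I_re,
      Complex.I_im, Complex.ofReal_re, Complex.ofReal_im, Complex.conj_re, Complex.conj_im]
    ring
  have hsq : r * ‖zr - ((s + β) / r : ℝ) * z‖ ^ 2
      = r * ‖zr‖ ^ 2 - 2 * (s + β) * (conj z * zr).re + (s + β) ^ 2 / r * ‖z‖ ^ 2 := by
    rw [norm_sub_ofReal_mul_sq]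
    field_simp
  have hRiccati := mul_nonpos_of_nonpos_of_nonneg h (sq_nonneg ‖z‖)
  have hnonneg : 0 ≤ r * ‖zr - ((s + β) / r : ℝ) * z‖ ^ 2
      + ‖zt - Complex.I * (β * z)‖ ^ 2 / r := by positivity
  rw [hshift, mul_sub, mul_norm_sub_I_mul_div_sq hr.ne', hcross]
  linarith

end Riccati

section RadialWeights

variable {α ρ r : ℝ}

/-- The constant `α / (4 α + π)` of the Hardy inequality. -/
noncomputable def hardyConst (α : ℝ) : ℝ :=
  α / (4 * α + Real.pi)

theorem hardyConst_nonneg (hα : 0 ≤ α) : 0 ≤ hardyConst α := by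
  unfold hardyConst
  positivity

theorem hardyConst_le (hα : 0 ≤ α) : hardyConst α ≤ 1 / 4 := by
  rw [hardyConst, div_le_div_iff₀ (by positivity) (by norm_num)]
  linarith [Real.pi_pos]

theorem hardyConst_mul_le (hα : 1 ≤ α) (L : ℝ) :
    hardyConst α * (L + 2 / (3 * α)) ^ 2 ≤ (1 + L ^ 2) / 4 := by
  have : 0 < α := zero_lt_one.trans_le hα
  set t := 2 / (3 * α) with ht
  have htα : α * t = 2 / 3 := by rw [ht]; field_simp
  have ht1 : α * t ^ 2 ≤ 4 / 9 := by
    have : t ≤ 2 / 3 := by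
      rw [ht, div_le_div_iff₀ (by positivity) (by norm_num)]
      linarith
    calc α * t ^ 2 = α * t * t := by ring
      _ ≤ 4 / 9 := by rw [htα]; linarith
  have hCauchySchwarz : (L + t) ^ 2 ≤ (1 + t ^ 2) * (1 + L ^ 2) := by
    linarith [sq_nonneg (1 - t * L)]
  have hconst : α * (1 + t ^ 2) ≤ (4 * α + Real.pi) / 4 := by
    linarith [Real.pi_gt_three]
  rw [hardyConst, div_mul_eq_mul_div, div_le_iff₀ (by positivity)]
  calc α * (L + t) ^ 2 ≤ α * ((1 + t ^ 2) * (1 + L ^ 2)) := by gcongr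
    _ = α * (1 + t ^ 2) * (1 + L ^ 2) := by ring
    _ ≤ (4 * α + Real.pi) / 4 * (1 + L ^ 2) := by gcongr
    _ = (1 + L ^ 2) / 4 * (4 * α + Real.pi) := by ring

/-- The solution of the Riccati inequality (see `strip_pointwise`) used in the disc `r ≤ ρ`. -/
noncomputable def innerWeight (ρ r : ℝ) : ℝ :=
  -(r ^ 2 / (4 * ρ ^ 2))

theorem contDiff_innerWeight {n : WithTop ℕ∞} (ρ : ℝ) : ContDiff ℝ n (innerWeight ρ) :=
  ((contDiff_id.pow 2).div_const _).neg

theorem deriv_innerWeight (ρ r : ℝ) : deriv (innerWeight ρ) r = -(r / (2 * ρ ^ 2)) := by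
  have h : HasDerivAt (innerWeight ρ) _ r := ((hasDerivAt_pow 2 r).div_const (4 * ρ ^ 2)).neg
  rw [h.deriv]
  simp only [Nat.cast_ofNat, Nat.reduceSub, pow_one]
  ring

theorem innerWeight_riccati (hα : 0 ≤ α) (hr : 0 < r) (hrρ : r ≤ ρ) :
    deriv (innerWeight ρ) r + (innerWeight ρ r + 0) ^ 2 / r
      + r * (hardyConst α * hardyWeight ρ r) ≤ 0 := by
  have hρ : 0 < ρ := hr.trans_le hrρ
  have hweight : hardyConst α * hardyWeight ρ r ≤ 1 / 4 * (1 / ρ ^ 2) :=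
    mul_le_mul (hardyConst_le hα) (hardyWeight_le hρ r) (hardyWeight_nonneg ρ r) (by norm_num)
  have hratio : r ^ 2 / ρ ^ 2 ≤ 1 := by
    rw [div_le_one (by positivity)]
    gcongr
  calc deriv (innerWeight ρ) r + (innerWeight ρ r + 0) ^ 2 / r
        + r * (hardyConst α * hardyWeight ρ r)
      ≤ -(r / (2 * ρ ^ 2)) + (innerWeight ρ r + 0) ^ 2 / r + r * (1 / 4 * (1 / ρ ^ 2)) := by
        rw [deriv_innerWeight]
        gcongr
    _ = r / ρ ^ 2 * (1 / 16 * (r ^ 2 / ρ ^ 2) - 1 / 4) := by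
        rw [innerWeight]
        field_simp
        ring
    _ ≤ 0 := mul_nonpos_of_nonneg_of_nonpos (by positivity) (by linarith)

/-- The solution of the Riccati inequality (see `strip_pointwise`) used in the exterior `ρ ≤ r`;
the shift `2 / (3 α)` makes its value at `ρ` equal to `-α / 4`. -/
noncomputable def outerWeight (α ρ r : ℝ) : ℝ :=
  -α + 1 / (2 * (Real.log (r / ρ) + 2 / (3 * α)))

theorem log_div_add_pos (hα : 0 < α) (hρ : 0 < ρ) (hr : ρ ≤ r) :
    0 < Real.log (r / ρ) + 2 / (3 * α) :=
  add_pos_of_nonneg_of_pos (Real.log_nonneg ((one_le_div hρ).2 hr)) (by positivity)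

theorem contDiffAt_outerWeight {n : WithTop ℕ∞} (hα : 0 < α) (hρ : 0 < ρ) (hr : ρ ≤ r) :
    ContDiffAt ℝ n (outerWeight α ρ) r :=
  contDiffAt_const.add (contDiffAt_const.div (contDiffAt_const.mul
    (((contDiffAt_id.div_const ρ).log (div_pos (hρ.trans_le hr) hρ).ne').add contDiffAt_const))
    (mul_pos two_pos (log_div_add_pos hα hρ hr)).ne')

theorem deriv_outerWeight (hα : 0 < α) (hρ : 0 < ρ) (hr : ρ ≤ r) :
    deriv (outerWeight α ρ) r = -(1 / (2 * r * (Real.log (r / ρ) + 2 / (3 * α)) ^ 2)) := by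
  have hr0 : 0 < r := hρ.trans_le hr
  have hd := log_div_add_pos hα hρ hr
  have hlog : HasDerivAt (fun r => Real.log (r / ρ) + 2 / (3 * α)) (1 / r) r := by
    refine ((((hasDerivAt_id r).div_const ρ).log (div_pos hr0 hρ).ne').add_const _).congr_deriv ?_
    rw [id]
    field_simp
  have h : HasDerivAt (outerWeight α ρ) _ r :=
    ((hasDerivAt_const r (1 : ℝ)).fun_div (hlog.const_mul 2)
      (mul_pos two_pos hd).ne').const_add (-α)
  rw [h.deriv]
  field_simp
  ring

theorem outerWeight_riccati (hα : 1 ≤ α) (hρ : 0 < ρ) (hr : ρ ≤ r) :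
    deriv (outerWeight α ρ) r + (outerWeight α ρ r + α) ^ 2 / r
      + r * (hardyConst α * hardyWeight ρ r) ≤ 0 := by
  have hα0 : 0 < α := zero_lt_one.trans_le hα
  have hr0 : 0 < r := hρ.trans_le hr
  have hd := log_div_add_pos hα0 hρ hr
  have hconst := hardyConst_mul_le hα (Real.log (r / ρ))
  rw [deriv_outerWeight hα0 hρ hr, outerWeight]
  set L := Real.log (r / ρ)
  set d := L + 2 / (3 * α)
  have hweight : r * (hardyConst α * hardyWeight ρ r) ≤ 1 / (4 * r * d ^ 2) := by
    calc r * (hardyConst α * hardyWeight ρ r)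
        ≤ r * ((1 + L ^ 2) / (4 * d ^ 2) * (1 / (r ^ 2 * (1 + L ^ 2)))) := by
          gcongr
          · exact hardyWeight_nonneg ρ r
          · rw [le_div_iff₀ (by positivity)]
            linarith
          · exact one_div_le_one_div_of_le (by positivity) (le_add_of_nonneg_left (sq_nonneg ρ))
      _ = 1 / (4 * r * d ^ 2) := by field_simp
  calc -(1 / (2 * r * d ^ 2)) + (-α + 1 / (2 * d) + α) ^ 2 / r
        + r * (hardyConst α * hardyWeight ρ r)
      ≤ -(1 / (2 * r * d ^ 2)) + (-α + 1 / (2 * d) + α) ^ 2 / r + 1 / (4 * r * d ^ 2) := by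
        gcongr
    _ = 0 := by
        field_simp
        ring

end RadialWeights

section RadialHardy

variable {v : Plane → ℂ} {α β ρ : ℝ}

theorem integral_stripFlux_sub_le {a b : ℝ} {s q : ℝ → ℝ} {F : ℝ × ℝ → ℝ}
    (hv : ContDiff ℝ 2 v) (hρ : 0 < ρ) (ha : 0 ≤ a) (hab : a ≤ b) (hβ : β = 0 ∨ 0 < a)
    (hs : ∀ r ∈ Icc a b, ContDiffAt ℝ 1 s r)
    (hRiccati : ∀ r ∈ Ioc a b, deriv s r + (s r + β) ^ 2 / r + r * q r ≤ 0)
    (hF : Continuous F) (hF_eq : ∀ p : ℝ × ℝ, p.1 ∈ Ioc a b →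
      F p = p.1 * (((p.1 / ρ) ^ β) ^ 2 *
        (‖dz v (polarPt p)‖ ^ 2 - q p.1 * ‖v (polarPt p)‖ ^ 2))) :
    (∫ θ in (-Real.pi)..Real.pi, stripFlux (polarWeighted β ρ v) s (b, θ))
        - ∫ θ in (-Real.pi)..Real.pi, stripFlux (polarWeighted β ρ v) s (a, θ)
      ≤ ∫ r in a..b, ∫ θ in (-Real.pi)..Real.pi, F (r, θ) := by
  have hw : ∀ p : ℝ × ℝ, p.1 ∈ Icc a b → ContDiffAt ℝ 2 (polarWeighted β ρ v) p := fun p hp =>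
    contDiffAt_polarWeighted hv hρ.ne' (hβ.imp_right fun h => (h.trans_le hp.1).ne')
  rw [← integral_stripDensity hab hw hs (polarWeighted_periodic β ρ v)]
  refine intervalIntegral_prod_mono hab (neg_le_self Real.pi_pos.le) (fun p hp =>
    (continuousAt_stripDensity (hw p hp.1) (hs _ hp.1)).continuousWithinAt) hF.continuousOn
    fun p hap hpb => ?_
  have hp0 : 0 < p.1 := ha.trans_lt hap
  have hpow : 0 ≤ (p.1 / ρ) ^ β := by positivity
  refine (strip_pointwise hp0 (hRiccati _ ⟨hap, hpb⟩) (polarWeighted β ρ v p) _ _).trans_eq ?_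
  rw [← rpow_mul_norm_dz_polarPt (hv.differentiable two_ne_zero) hρ hp0, hF_eq p ⟨hap, hpb⟩,
    polarWeighted, norm_smul, Real.norm_of_nonneg hpow]
  ring

theorem stripFlux_inner_sub_outer (hv : Differentiable ℝ v) (hα : α ≠ 0) (hρ : 0 < ρ) (θ : ℝ) :
    stripFlux (polarWeighted 0 ρ v) (innerWeight ρ) (ρ, θ)
        - stripFlux (polarWeighted α ρ v) (outerWeight α ρ) (ρ, θ)
      = (α - 1) / 4 * ‖v (polarPt (ρ, θ))‖ ^ 2 := by
  have hvalue : ∀ β, polarWeighted β ρ v (ρ, θ) = v (polarPt (ρ, θ)) := fun β => by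
    simp only [polarWeighted, div_self hρ.ne', Real.one_rpow, one_smul]
  have hcurrent : ∀ β, current (polarWeighted β ρ v) (0, 1) (ρ, θ)
      = current (v ∘ polarPt) (0, 1) (ρ, θ) := fun β => by
    simp only [current, fderiv_polarWeighted (p := (ρ, θ)) hv hρ hρ, hvalue, div_self hρ.ne',
      Real.one_rpow, one_smul, zero_mul, zero_div, zero_smul, zero_add, Function.comp]
  have hinner : innerWeight ρ ρ = -(1 / 4) := by
    rw [innerWeight]
    field_simp
  have houter : outerWeight α ρ ρ = -α / 4 := by
    rw [outerWeight, div_self hρ.ne', Real.log_one]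
    field_simp
    ring
  simp only [stripFlux, hvalue, hcurrent, hinner, houter]
  ring

theorem intervalIntegrable_stripFlux {w : ℝ × ℝ → ℂ} {r : ℝ}
    (hw : ∀ θ, ContDiffAt ℝ 2 w (r, θ)) (s : ℝ → ℝ) (a b : ℝ) :
    IntervalIntegrable (fun θ => stripFlux w s (r, θ)) volume a b := by
  have hcont : Continuous fun θ => current w (0, 1) (r, θ) + s r * ‖w (r, θ)‖ ^ 2 :=
    continuous_iff_continuousAt.2 fun θ =>
      have hpair : ContinuousAt (fun θ : ℝ => (r, θ)) θ := by fun_prop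
      ((differentiableAt_current (hw θ) _).continuousAt.comp hpair).add
        (continuousAt_const.mul (((hw θ).continuousAt.comp hpair).norm.pow 2))
  exact hcont.intervalIntegrable a b

theorem integral_stripFlux_outer_le_inner (hα : 1 ≤ α) (hρ : 0 < ρ) (hv : ContDiff ℝ 2 v) :
    ∫ θ in (-Real.pi)..Real.pi, stripFlux (polarWeighted α ρ v) (outerWeight α ρ) (ρ, θ)
      ≤ ∫ θ in (-Real.pi)..Real.pi, stripFlux (polarWeighted 0 ρ v) (innerWeight ρ) (ρ, θ) := by
  have hint : ∀ β s, IntervalIntegrable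
      (fun θ => stripFlux (polarWeighted β ρ v) s (ρ, θ)) volume (-Real.pi) Real.pi := fun β s =>
    intervalIntegrable_stripFlux
      (fun θ => contDiffAt_polarWeighted hv hρ.ne' (Or.inr hρ.ne')) s _ _
  refine intervalIntegral.integral_mono_on (neg_le_self Real.pi_pos.le) (hint _ _) (hint _ _)
    fun θ _ => sub_nonneg.1 ?_
  rw [stripFlux_inner_sub_outer (hv.differentiable two_ne_zero) (by positivity) hρ]
  exact mul_nonneg (by linarith) (sq_nonneg _)

theorem integral_disc_ge (hα : 0 ≤ α) (hρ : 0 < ρ) (hv : ContDiff ℝ 2 v) {F : ℝ × ℝ → ℝ}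
    (hF : Continuous F) (hF_eq : ∀ p : ℝ × ℝ, p.1 ∈ Ioc 0 ρ → F p = p.1 *
      (‖dz v (polarPt p)‖ ^ 2 - hardyConst α * hardyWeight ρ p.1 * ‖v (polarPt p)‖ ^ 2)) :
    ∫ θ in (-Real.pi)..Real.pi, stripFlux (polarWeighted 0 ρ v) (innerWeight ρ) (ρ, θ)
      ≤ ∫ r in (0)..ρ, ∫ θ in (-Real.pi)..Real.pi, F (r, θ) := by
  have hcenter : ∀ θ, stripFlux (polarWeighted 0 ρ v) (innerWeight ρ) (0, θ) = 0 := fun θ => by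
    have hcurrent : current (v ∘ polarPt) (0, 1) (0, θ) = 0 := by
      have hzero : (!₂[0, 0] : Plane) = 0 := by ext i; fin_cases i <;> rfl
      rw [current, fderiv_comp_polarPt (hv.differentiable two_ne_zero), fderiv_polarPt]
      simp only [zero_mul, mul_zero, sub_zero, add_zero, hzero, map_zero, Complex.zero_im]
    rw [stripFlux, polarWeighted_zero, hcurrent, innerWeight]
    ring
  have h := integral_stripFlux_sub_le hv hρ le_rfl hρ.le (Or.inl rfl)
    (fun r _ => (contDiff_innerWeight ρ).contDiffAt)
    (fun r hr => innerWeight_riccati hα hr.1 hr.2) hF fun p hp => by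
      rw [hF_eq p hp, Real.rpow_zero, one_pow, one_mul]
  simpa only [hcenter, intervalIntegral.integral_zero, sub_zero] using h

theorem integral_exterior_ge (hα : 1 ≤ α) (hρ : 0 < ρ) (hv : ContDiff ℝ 2 v) {R : ℝ}
    (hR : ρ ≤ R) (hv_zero : ∀ x, ‖x‖ = R → v x = 0) {F : ℝ × ℝ → ℝ} (hF : Continuous F)
    (hF_eq : ∀ p : ℝ × ℝ, p.1 ∈ Ioc ρ R → F p = p.1 * (((p.1 / ρ) ^ α) ^ 2 *
      (‖dz v (polarPt p)‖ ^ 2 - hardyConst α * hardyWeight ρ p.1 * ‖v (polarPt p)‖ ^ 2))) :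
    -∫ θ in (-Real.pi)..Real.pi, stripFlux (polarWeighted α ρ v) (outerWeight α ρ) (ρ, θ)
      ≤ ∫ r in ρ..R, ∫ θ in (-Real.pi)..Real.pi, F (r, θ) := by
  have hα0 : 0 < α := zero_lt_one.trans_le hα
  have hboundary : ∀ θ, stripFlux (polarWeighted α ρ v) (outerWeight α ρ) (R, θ) = 0 :=
    fun θ => by
      have hw : polarWeighted α ρ v (R, θ) = 0 := by
        rw [polarWeighted, hv_zero _ (by rw [norm_polarPt, abs_of_pos (hρ.trans_le hR)]), smul_zero]
      simp only [stripFlux, current, hw, map_zero, zero_mul, Complex.zero_im, norm_zero, ne_eq,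
        OfNat.ofNat_ne_zero, not_false_eq_true, zero_pow, mul_zero, add_zero]
  have h := integral_stripFlux_sub_le hv hρ hρ.le hR (Or.inr hρ)
    (fun r hr => contDiffAt_outerWeight hα0 hρ hr.1)
    (fun r hr => outerWeight_riccati hα hρ hr.1.le) hF hF_eq
  simpa only [hboundary, intervalIntegral.integral_zero, zero_sub] using h

theorem integrable_gPlus_sq_mul (hα : 0 ≤ α) (hρ : 0 < ρ) {φ : Plane → ℝ} (hφ : Continuous φ)
    (hφc : HasCompactSupport φ) : Integrable fun x => gPlus α ρ ‖x‖ ^ 2 * φ x :=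
  ((((continuous_gPlus hα hρ).comp continuous_norm).pow 2).mul
    hφ).integrable_of_hasCompactSupport hφc.mul_left

theorem integral_gPlus_sq_mul_nonneg (hα : 1 ≤ α) (hρ : 0 < ρ) (hv : ContDiff ℝ 2 v)
    (hc : HasCompactSupport v) :
    0 ≤ ∫ x, gPlus α ρ ‖x‖ ^ 2 *
      (‖dz v x‖ ^ 2 - hardyConst α * hardyWeight ρ ‖x‖ * ‖v x‖ ^ 2) := by
  have hα0 : 0 ≤ α := zero_le_one.trans hα
  set f : Plane → ℝ := fun x => gPlus α ρ ‖x‖ ^ 2 *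
    (‖dz v x‖ ^ 2 - hardyConst α * hardyWeight ρ ‖x‖ * ‖v x‖ ^ 2) with hf_def
  have hf : Continuous f := by
    have := continuous_dz (hv.of_le one_le_two)
    have := (continuous_gPlus hα0 hρ).comp (continuous_norm (E := Plane))
    have := (continuous_hardyWeight hρ).comp (continuous_norm (E := Plane))
    have := hv.continuous
    fun_prop
  obtain ⟨R₁, -, hR₁⟩ := hc.exists_pos_le_norm
  obtain ⟨R₂, -, hR₂⟩ := (hasCompactSupport_dz hc).exists_pos_le_norm
  set R := max ρ (max R₁ R₂)
  have hvR : ∀ x, R ≤ ‖x‖ → v x = 0 := fun x hx => hR₁ x ((le_max_of_le_right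
    (le_max_left _ _)).trans hx)
  have hfR : ∀ x, R < ‖x‖ → f x = 0 := fun x hx => by
    have hdz : dz v x = 0 := hR₂ x ((le_max_of_le_right (le_max_right _ _)).trans hx.le)
    simp only [hf_def, hvR x hx.le, hdz, norm_zero, ne_eq, OfNat.ofNat_ne_zero, not_false_eq_true,
      zero_pow, mul_zero, sub_zero]
  have hρR : ρ ≤ R := le_max_left _ _
  set F : ℝ × ℝ → ℝ := fun p => p.1 * f (polarPt p) with hF_def
  have hF : Continuous F := continuous_fst.mul (hf.comp (contDiff_polarPt (n := 0)).continuous)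
  have hFr : Continuous (fun r => ∫ θ in (-Real.pi)..Real.pi, F (r, θ)) :=
    intervalIntegral.continuous_parametric_intervalIntegral_of_continuous' hF _ _
  have hdisc := integral_disc_ge hα0 hρ hv hF fun p hp => by
    simp only [hF_def, hf_def, norm_polarPt, abs_of_pos hp.1, gPlus_of_le hp.2, one_pow, one_mul]
  have hext := integral_exterior_ge hα hρ hv hρR (fun x hx => hvR x hx.ge) hF fun p hp => by
    simp only [hF_def, hf_def, norm_polarPt, abs_of_pos (hρ.trans hp.1), gPlus_of_ge hρ hp.1.le]
  rw [integral_eq_intervalIntegral_polar (hρ.le.trans hρR) hF.continuousOn (fun _ _ => rfl) hfR,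
    ← intervalIntegral.integral_add_adjacent_intervals (hFr.intervalIntegrable 0 ρ)
    (hFr.intervalIntegrable ρ R)]
  linarith [integral_stripFlux_outer_le_inner hα hρ hv]

theorem gPlus_sq_hardy (hα : 1 ≤ α) (hρ : 0 < ρ) (hv : ContDiff ℝ 2 v)
    (hc : HasCompactSupport v) :
    hardyConst α * ∫ x, gPlus α ρ ‖x‖ ^ 2 * (‖v x‖ ^ 2 * hardyWeight ρ ‖x‖)
      ≤ ∫ x, gPlus α ρ ‖x‖ ^ 2 * ‖dz v x‖ ^ 2 := by
  have hα0 : 0 ≤ α := zero_le_one.trans hα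
  have hdz : Integrable fun x => gPlus α ρ ‖x‖ ^ 2 * ‖dz v x‖ ^ 2 :=
    integrable_gPlus_sq_mul hα0 hρ ((continuous_dz (hv.of_le one_le_two)).norm.pow 2)
      ((hasCompactSupport_dz hc).comp_left (g := fun z => ‖z‖ ^ 2) (by simp))
  have hpot : Integrable fun x => gPlus α ρ ‖x‖ ^ 2 * (‖v x‖ ^ 2 * hardyWeight ρ ‖x‖) :=
    integrable_gPlus_sq_mul hα0 hρ
      ((hv.continuous.norm.pow 2).mul ((continuous_hardyWeight hρ).comp continuous_norm))
      (hc.comp_left (g := fun z => ‖z‖ ^ 2) (by simp)).mul_right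
  rw [← integral_const_mul, ← sub_nonneg, ← integral_sub hdz (hpot.const_mul _)]
  refine (integral_gPlus_sq_mul_nonneg hα hρ hv hc).trans_eq (integral_congr_ae (ae_of_all _
    fun x => ?_))
  ring

end RadialHardy

/-! ### Mollification and gauge functions -/

theorem eLpNorm_two_sq {X E : Type*} [MeasurableSpace X] [NormedAddCommGroup E]
    (μ : Measure X) (f : X → E) : eLpNorm f 2 μ ^ 2 = ∫⁻ x, ‖f x‖ₑ ^ 2 ∂μ := by
  simpa using eLpNorm_nnreal_pow_eq_lintegral (μ := μ) (f := f) (p := 2) two_ne_zero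

/-- A sequence of bump functions shrinking to the origin. -/
noncomputable def bump (n : ℕ) : ContDiffBump (0 : Plane) where
  rIn := 1 / (2 * (n + 1))
  rOut := 1 / (n + 1)
  rIn_pos := by positivity
  rIn_lt_rOut := by
    have : (0 : ℝ) < n + 1 := by positivity
    gcongr
    linarith

/-- The standard mollifiers: nonnegative, smooth, supported in the closed ball of radius
`1 / (n + 1)`, with integral `1`. -/
noncomputable def mollifier (n : ℕ) : Plane → ℝ := (bump n).normed volume

section Mollify
variable {E : Type*} [NormedAddCommGroup E] [NormedSpace ℝ E]

/-- The convolution of `f` with the `n`-th mollifier. -/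
noncomputable def mollify (n : ℕ) (f : Plane → E) : Plane → E :=
  convolution (mollifier n) f (ContinuousLinearMap.lsmul ℝ ℝ) volume

theorem tendsto_bump_rOut : Tendsto (fun n => (bump n).rOut) atTop (𝓝 0) :=
  tendsto_one_div_add_atTop_nhds_zero_nat

theorem rOut_bump_le_one (n : ℕ) : (bump n).rOut ≤ 1 :=
  div_le_one_of_le₀ (by linarith [Nat.cast_nonneg (α := ℝ) n]) (by positivity)

theorem contDiff_mollifier (n : ℕ) : ContDiff ℝ ∞ (mollifier n) := (bump n).contDiff_normed

theorem hasCompactSupport_mollifier (n : ℕ) : HasCompactSupport (mollifier n) :=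
  (bump n).hasCompactSupport_normed

theorem mollifier_nonneg (n : ℕ) (x : Plane) : 0 ≤ mollifier n x := (bump n).nonneg_normed x

theorem isTest_mollifier_sub (n : ℕ) (x : Plane) : IsTest (fun y => mollifier n (x - y)) :=
  ⟨(contDiff_mollifier n).comp (contDiff_const.sub contDiff_id),
    (hasCompactSupport_mollifier n).comp_homeomorph (Homeomorph.subLeft x)⟩

theorem contDiff_mollify (n : ℕ) {f : Plane → E} (hf : LocallyIntegrable f) :
    ContDiff ℝ ∞ (mollify n f) :=
  (hasCompactSupport_mollifier n).contDiff_convolution_left (n := ⊤)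
    (ContinuousLinearMap.lsmul ℝ ℝ) (contDiff_mollifier n) hf

theorem mollify_eq (n : ℕ) (f : Plane → E) (x : Plane) :
    mollify n f x = ∫ y, mollifier n (x - y) • f y := by
  rw [mollify, convolution_eq_swap]
  rfl

theorem fderiv_mollify (n : ℕ) {f : Plane → E} (hf : LocallyIntegrable f) (x : Plane) (j : Fin 2) :
    fderiv ℝ (mollify n f) x (EuclideanSpace.single j 1)
      = -∫ y, partialDeriv j (fun y => mollifier n (x - y)) y • f y := by
  have h_smooth : ContDiff ℝ 1 (mollifier n) :=
    (contDiff_mollifier n).of_le (by exact_mod_cast le_top)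
  have h_fderiv := (hasCompactSupport_mollifier n).hasFDerivAt_convolution_left
    (ContinuousLinearMap.lsmul ℝ ℝ) h_smooth hf x
  have h_integrable := (((hasCompactSupport_mollifier n).fderiv (𝕜 := ℝ)).convolutionExists_left
    ((ContinuousLinearMap.lsmul ℝ ℝ).precompL Plane)
    (h_smooth.continuous_fderiv one_ne_zero) hf x).integrable_swap
  have h_reflect (y : Plane) :
      fderiv ℝ (fun y => mollifier n (x - y)) y = -fderiv ℝ (mollifier n) (x - y) := by
    have := (h_smooth.differentiable one_ne_zero (x - y)).hasFDerivAt.comp y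
      ((hasFDerivAt_id (𝕜 := ℝ) y).const_sub x)
    exact this.fderiv.trans (by ext v; simp)
  rw [show fderiv ℝ (mollify n f) x = _ from h_fderiv.fderiv, convolution_eq_swap,
    ContinuousLinearMap.integral_apply h_integrable, ← integral_neg]
  congr 1
  funext y
  simp [partialDeriv, h_reflect, ContinuousLinearMap.precompL_apply]

theorem ae_tendsto_mollify {f : Plane → E} [CompleteSpace E] (hf : LocallyIntegrable f) :
    ∀ᵐ x, Tendsto (fun n => mollify n f x) atTop (𝓝 (f x)) :=
  ContDiffBump.ae_convolution_tendsto_right_of_locallyIntegrable (φ := bump) (K := 2)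
    tendsto_bump_rOut (Eventually.of_forall fun n => by
      change (1 : ℝ) / (n + 1) ≤ 2 * (1 / (2 * (n + 1)))
      exact le_of_eq (by field_simp)) hf

theorem lintegral_mollifier (n : ℕ) : ∫⁻ y, ENNReal.ofReal (mollifier n y) = 1 := by
  rw [← ofReal_integral_eq_lintegral_ofReal (f := mollifier n) (bump n).integrable_normed
    (Eventually.of_forall (mollifier_nonneg n)),
    show ∫ y, mollifier n y = 1 from (bump n).integral_normed, ENNReal.ofReal_one]

theorem integral_mollifier_sub (n : ℕ) (x : Plane) : ∫ y, mollifier n (x - y) = 1 := by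
  rw [integral_sub_left_eq_self (mollifier n)]
  exact (bump n).integral_normed

theorem integrable_mollifier_sub (n : ℕ) (x : Plane) :
    Integrable (fun y => mollifier n (x - y)) :=
  (bump n).integrable_normed.comp_sub_left x

theorem norm_mollify_le (n : ℕ) {f : Plane → E} {C : ℝ} (hf : ∀ᵐ x, ‖f x‖ ≤ C) (x : Plane) :
    ‖mollify n f x‖ ≤ C := by
  rw [mollify_eq]
  calc _ ≤ ∫ y, mollifier n (x - y) * C := by
        refine norm_integral_le_of_norm_le ((integrable_mollifier_sub n x).mul_const C) ?_
        filter_upwards [hf] with y hy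
        rw [norm_smul, Real.norm_of_nonneg (mollifier_nonneg n _)]
        exact mul_le_mul_of_nonneg_left hy (mollifier_nonneg n _)
    _ = C := by rw [integral_mul_const, integral_mollifier_sub, one_mul]

theorem norm_mollify_sub_le [CompleteSpace E] (n : ℕ) {f : Plane → E} {C : ℝ} (hC : 0 ≤ C)
    (hf : Continuous f) (hL : ∀ x y, ‖f x - f y‖ ≤ C * ‖x - y‖) (x : Plane) :
    ‖mollify n f x - f x‖ ≤ C * (1 / (n + 1)) := by
  rw [← dist_eq_norm]
  refine ContDiffBump.dist_normed_convolution_le hf.aestronglyMeasurable fun y hy => ?_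
  rw [dist_eq_norm]
  refine (hL y x).trans ?_
  have : ‖y - x‖ ≤ 1 / (n + 1) := by simpa only [dist_eq_norm] using hy.le
  gcongr

theorem measurable_ofReal_mollifier (n : ℕ) :
    Measurable fun y => ENNReal.ofReal (mollifier n y) :=
  (contDiff_mollifier n).continuous.measurable.ennreal_ofReal

/-- Jensen's inequality for the probability measure whose density is the mollifier. -/
theorem enorm_mollify_sq_le (n : ℕ) {f : Plane → E} (hf : AEStronglyMeasurable f) (x : Plane) :
    ‖mollify n f x‖ₑ ^ 2
      ≤ ∫⁻ y, ENNReal.ofReal (mollifier n y) * ‖f (x - y)‖ₑ ^ 2 := by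
  set ν : Measure Plane := volume.withDensity fun y => ENNReal.ofReal (mollifier n y) with hν
  have : IsProbabilityMeasure ν :=
    ⟨by rw [hν, withDensity_apply _ MeasurableSet.univ, Measure.restrict_univ,
      lintegral_mollifier]⟩
  have hf_vol : AEStronglyMeasurable (fun y => f (x - y)) volume :=
    hf.comp_measurePreserving (Measure.measurePreserving_sub_left volume x)
  have hf_ν : AEStronglyMeasurable (fun y => f (x - y)) ν :=
    hf_vol.mono_ac (withDensity_absolutelyContinuous _ _)
  have h_le_L1 : ‖mollify n f x‖ₑ ≤ eLpNorm (fun y => f (x - y)) 1 ν := by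
    rw [eLpNorm_one_eq_lintegral_enorm, hν, lintegral_withDensity_eq_lintegral_mul₀
      (measurable_ofReal_mollifier n).aemeasurable hf_vol.enorm]
    refine (enorm_integral_le_lintegral_enorm _).trans_eq (lintegral_congr fun y => ?_)
    change ‖mollifier n y • f (x - y)‖ₑ = _
    rw [enorm_smul, Real.enorm_of_nonneg (mollifier_nonneg n y)]
    rfl
  calc ‖mollify n f x‖ₑ ^ 2 ≤ eLpNorm (fun y => f (x - y)) 2 ν ^ 2 := by
        gcongr
        exact h_le_L1.trans (eLpNorm_le_eLpNorm_of_exponent_le (by norm_num) hf_ν)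
    _ = ∫⁻ y, ‖f (x - y)‖ₑ ^ 2 ∂ν := eLpNorm_two_sq _ _
    _ = _ := by
        rw [hν, lintegral_withDensity_eq_lintegral_mul₀
          (measurable_ofReal_mollifier n).aemeasurable (hf_vol.enorm.pow_const _)]
        rfl

theorem eLpNorm_mollify_le (n : ℕ) {f : Plane → E} (hf : AEStronglyMeasurable f) :
    eLpNorm (mollify n f) 2 volume ≤ eLpNorm f 2 volume := by
  rw [← ENNReal.pow_le_pow_left_iff two_ne_zero, eLpNorm_two_sq,
    eLpNorm_two_sq]
  have h_meas : AEMeasurable (fun p : Plane × Plane => ENNReal.ofReal (mollifier n p.2)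
      * ‖f (p.1 - p.2)‖ₑ ^ 2) (volume.prod volume) :=
    ((measurable_ofReal_mollifier n).comp measurable_snd).aemeasurable.mul
      ((hf.comp_quasiMeasurePreserving
        (quasiMeasurePreserving_sub_of_right_invariant volume volume)).enorm.pow_const _)
  calc _ ≤ ∫⁻ x, ∫⁻ y, ENNReal.ofReal (mollifier n y) * ‖f (x - y)‖ₑ ^ 2 :=
        lintegral_mono (enorm_mollify_sq_le n hf)
    _ = ∫⁻ y, ∫⁻ x, ENNReal.ofReal (mollifier n y) * ‖f (x - y)‖ₑ ^ 2 :=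
        lintegral_lintegral_swap h_meas
    _ = ∫⁻ y, ENNReal.ofReal (mollifier n y) * ∫⁻ x, ‖f x‖ₑ ^ 2 := by
        refine lintegral_congr fun y => ?_
        rw [lintegral_const_mul' _ _ ENNReal.ofReal_ne_top,
          lintegral_sub_right_eq_self (fun x => ‖f x‖ₑ ^ 2)]
    _ = ∫⁻ x, ‖f x‖ₑ ^ 2 := by
        rw [lintegral_mul_const _ (measurable_ofReal_mollifier n), lintegral_mollifier, one_mul]

theorem mollify_sub (n : ℕ) {f g : Plane → E} (hf : LocallyIntegrable f)
    (hg : LocallyIntegrable g) : mollify n (f - g) = mollify n f - mollify n g := by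
  have hI : ∀ {f : Plane → E}, LocallyIntegrable f → ∀ x,
      Integrable (fun y => mollifier n (x - y) • f y) := fun hf x =>
    ((hasCompactSupport_mollifier n).convolutionExists_left (ContinuousLinearMap.lsmul ℝ ℝ)
      (contDiff_mollifier n).continuous hf x).integrable_swap
  funext x
  simp only [mollify_eq, Pi.sub_apply, smul_sub]
  exact integral_sub (hI hf x) (hI hg x)

theorem mollify_eq_zero {f : Plane → E} {R : ℝ} (hf : ∀ x, R ≤ ‖x‖ → f x = 0) (n : ℕ) {x : Plane}
    (hx : R + 1 ≤ ‖x‖) : mollify n f x = 0 := by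
  rw [mollify_eq]
  refine integral_eq_zero_of_ae (Eventually.of_forall fun y => ?_)
  rcases le_total R ‖y‖ with hy | hy
  · simp [hf y hy]
  · have h_notMem : x - y ∉ Function.support (mollifier n) := by
      rw [mollifier, ContDiffBump.support_normed_eq, mem_ball_zero_iff, not_lt]
      linarith [norm_sub_norm_le x y, rOut_bump_le_one n]
    simp [Function.notMem_support.1 h_notMem]

theorem tendsto_eLpNorm_mollify_sub_of_contDiff [CompleteSpace E] {g : Plane → E}
    (hg : ContDiff ℝ ∞ g) (hc : HasCompactSupport g) :
    Tendsto (fun n => eLpNorm (mollify n g - g) 2 volume) atTop (𝓝 0) := by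
  obtain ⟨R, -, h_supp⟩ := hc.exists_pos_le_norm
  obtain ⟨C, hC⟩ := (hc.fderiv (𝕜 := ℝ)).exists_bound_of_continuous
    (hg.continuous_fderiv (by simp))
  have hC0 : 0 ≤ C := (norm_nonneg _).trans (hC 0)
  have h_lip (x y : Plane) : ‖g x - g y‖ ≤ C * ‖x - y‖ :=
    Convex.norm_image_sub_le_of_norm_fderiv_le
      (fun z _ => hg.differentiable (by simp) z) (fun z _ => hC z) convex_univ
      (mem_univ y) (mem_univ x)
  set K := Metric.closedBall (0 : Plane) (R + 1)
  have hK {x : Plane} (hx : x ∉ K) : R + 1 < ‖x‖ := by simpa [K] using hx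
  have h_bound (n : ℕ) : eLpNorm (mollify n g - g) 2 volume ≤
      ENNReal.ofReal (C * (1 / (n + 1))) * volume K ^ (1 / (2 : ℝ≥0∞).toReal) := by
    refine eLpNorm_sub_le_of_dist_bdd volume (by norm_num)
      Metric.isClosed_closedBall.measurableSet (by positivity) (fun x => ?_)
      (Function.support_subset_iff'.2 fun x hx => mollify_eq_zero h_supp n (hK hx).le)
      (Function.support_subset_iff'.2 fun x hx => h_supp x (by linarith [hK hx]))
    rw [dist_eq_norm]
    exact norm_mollify_sub_le n hC0 hg.continuous h_lip x
  have h_lim : Tendsto (fun n : ℕ => ENNReal.ofReal (C * (1 / (n + 1)))) atTop (𝓝 0) := by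
    simpa using ENNReal.tendsto_ofReal
      ((tendsto_one_div_add_atTop_nhds_zero_nat (𝕜 := ℝ)).const_mul C)
  have hK_ne_top : volume K ^ (1 / (2 : ℝ≥0∞).toReal) ≠ ⊤ :=
    ENNReal.rpow_ne_top_of_nonneg (by positivity) measure_closedBall_lt_top.ne
  refine tendsto_of_tendsto_of_tendsto_of_le_of_le tendsto_const_nhds ?_ (fun _ => zero_le) h_bound
  simpa using ENNReal.Tendsto.mul_const h_lim (Or.inr hK_ne_top)

theorem tendsto_eLpNorm_mollify_sub [CompleteSpace E] {f : Plane → E} (hf : MemLp f 2 volume) :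
    Tendsto (fun n => eLpNorm (mollify n f - f) 2 volume) atTop (𝓝 0) := by
  rw [ENNReal.tendsto_nhds_zero]
  intro ε hε
  have hε3 : 0 < ε / 3 := ENNReal.div_pos hε.ne' (by norm_num)
  obtain ⟨δ, hδ0, hδ⟩ := ENNReal.lt_iff_exists_nnreal_btwn.1 hε3
  obtain ⟨g, hgc, hgs, hfg⟩ := hf.exist_eLpNorm_sub_le (by norm_num) (by norm_num)
    (NNReal.coe_pos.2 (ENNReal.coe_pos.1 hδ0))
  have hfg : eLpNorm (f - g) 2 volume ≤ ε / 3 := hfg.trans (by simpa using hδ.le)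
  have hg : MemLp g 2 volume := hgs.continuous.memLp_of_hasCompactSupport hgc
  have hfl : LocallyIntegrable f := hf.locallyIntegrable (by norm_num)
  have hgl : LocallyIntegrable g := hg.locallyIntegrable (by norm_num)
  filter_upwards [(ENNReal.tendsto_nhds_zero.1
    (tendsto_eLpNorm_mollify_sub_of_contDiff hgs hgc)) _ hε3] with n hn
  have h_split : mollify n f - f = mollify n (f - g) + (mollify n g - g) - (f - g) := by
    rw [mollify_sub n hfl hgl]; abel
  have h_meas₁ : AEStronglyMeasurable (mollify n (f - g)) :=
    (contDiff_mollify n (hfl.sub hgl)).continuous.aestronglyMeasurable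
  have h_meas₂ : AEStronglyMeasurable (mollify n g - g) :=
    ((contDiff_mollify n hgl).continuous.sub hgs.continuous).aestronglyMeasurable
  have h_meas₃ : AEStronglyMeasurable (f - g) := (hf.sub hg).aestronglyMeasurable
  rw [h_split]
  calc _ ≤ eLpNorm (mollify n (f - g) + (mollify n g - g)) 2 volume + eLpNorm (f - g) 2 volume :=
        eLpNorm_sub_le (h_meas₁.add h_meas₂) h_meas₃ (by norm_num)
    _ ≤ (eLpNorm (mollify n (f - g)) 2 volume + eLpNorm (mollify n g - g) 2 volume)
        + eLpNorm (f - g) 2 volume := by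
        gcongr
        exact eLpNorm_add_le h_meas₁ h_meas₂ (by norm_num)
    _ ≤ ε / 3 + ε / 3 + ε / 3 := by
        gcongr
        exact (eLpNorm_mollify_le n h_meas₃).trans hfg
    _ = ε := ENNReal.add_thirds ε

end Mollify

theorem fderiv_mollify_of_weak {E : Type*} [NormedAddCommGroup E] [NormedSpace ℝ E] (n : ℕ)
    {f g : Plane → E} {j : Fin 2} (hf : LocallyIntegrable f)
    (hw : ∀ φ : Plane → ℝ, IsTest φ → ∫ x, partialDeriv j φ x • f x = -∫ x, φ x • g x)
    (x : Plane) : fderiv ℝ (mollify n f) x (EuclideanSpace.single j 1) = mollify n g x := by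
  rw [fderiv_mollify n hf, hw _ (isTest_mollifier_sub n x), neg_neg, mollify_eq]

theorem abs_partialDeriv_le (f : Plane → ℝ) (j : Fin 2) (x : Plane) :
    |partialDeriv j f x| ≤ ‖fderiv ℝ f x‖ := by
  simpa [partialDeriv] using (fderiv ℝ f x).le_opNorm (EuclideanSpace.single j 1)

section TestFunctions

variable {φ : Plane → ℝ}

theorem IsTest.continuous_partialDeriv (hφ : IsTest φ) (j : Fin 2) :
    Continuous (partialDeriv j φ) :=
  (hφ.smooth.continuous_fderiv (by simp)).clm_apply continuous_const

theorem IsTest.hasCompactSupport_partialDeriv (hφ : IsTest φ) (j : Fin 2) :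
    HasCompactSupport (partialDeriv j φ) :=
  hφ.compact.fderiv_apply (𝕜 := ℝ) _

theorem IsTest.integrable_partialDeriv (hφ : IsTest φ) (j : Fin 2) :
    Integrable (partialDeriv j φ) :=
  (hφ.continuous_partialDeriv j).integrable_of_hasCompactSupport
    (hφ.hasCompactSupport_partialDeriv j)

end TestFunctions

section ScalarPotential

variable {B : Plane → ℝ} (hB : AdmissibleField B)

include hB

theorem AdmissibleField.continuous_scalarPotential : Continuous (scalarPotential B) :=
  hB.differentiable_scalarPotential.continuous

theorem AdmissibleField.weak_grad_scalarPotential (j : Fin 2) {φ : Plane → ℝ} (hφ : IsTest φ) :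
    ∫ x, partialDeriv j φ x • scalarPotential B x
      = -∫ x, φ x • partialDeriv j (scalarPotential B) x := by
  obtain ⟨C, -, hC⟩ := hB.exists_norm_fderiv_scalarPotential_le
  have h_cont := hB.continuous_scalarPotential
  have hφ_cont := hφ.smooth.continuous
  have h_int_fderiv : Integrable (fun x => φ x * partialDeriv j (scalarPotential B) x) :=
    (hφ_cont.integrable_of_hasCompactSupport hφ.compact).mul_bdd (c := C)
      (measurable_fderiv_apply_const ℝ _ _).aestronglyMeasurable
      (Eventually.of_forall fun x => (abs_partialDeriv_le _ _ x).trans (hC x))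
  have hφ_int_fderiv : Integrable (fun x => partialDeriv j φ x * scalarPotential B x) :=
    ((hφ.continuous_partialDeriv j).mul h_cont).integrable_of_hasCompactSupport
      (hφ.hasCompactSupport_partialDeriv j).mul_right
  have h_int : Integrable (fun x => φ x * scalarPotential B x) :=
    (hφ_cont.mul h_cont).integrable_of_hasCompactSupport hφ.compact.mul_right
  simp only [smul_eq_mul]
  rw [← neg_eq_iff_eq_neg]
  exact (integral_mul_fderiv_eq_neg_fderiv_mul_of_integrable hφ_int_fderiv h_int_fderiv h_int
    (fun x _ => hφ.smooth.differentiable (by simp) x)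
    (fun x _ => hB.differentiable_scalarPotential x)).symm

theorem AdmissibleField.fderiv_mollify_scalarPotential (n : ℕ) (j : Fin 2) (x : Plane) :
    fderiv ℝ (mollify n (scalarPotential B)) x (EuclideanSpace.single j 1)
      = mollify n (partialDeriv j (scalarPotential B)) x :=
  fderiv_mollify_of_weak n hB.continuous_scalarPotential.locallyIntegrable
    (fun _ hφ => hB.weak_grad_scalarPotential j hφ) x

end ScalarPotential

section BoundedPotential

variable {B : Plane → ℝ} {A : Plane → Plane} (hA : IsBoundedPotential B A)

include hA

theorem IsBoundedPotential.exists_bound : ∃ C : ℝ, ∀ j : Fin 2, ∀ᵐ x, ‖A x j‖ ≤ C := by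
  have hC : ∀ᵐ x, ‖A x‖ ≤ (eLpNorm A ∞ volume).toReal := by
    filter_upwards [ae_le_eLpNormEssSup (f := A) (μ := volume)] with x hx
    rw [← eLpNorm_exponent_top] at hx
    simpa using ENNReal.toReal_mono hA.bounded.eLpNorm_ne_top hx
  exact ⟨_, fun j => hC.mono fun x hx => (PiLp.norm_apply_le (A x) j).trans hx⟩

theorem IsBoundedPotential.aestronglyMeasurable (j : Fin 2) :
    AEStronglyMeasurable (fun x => A x j) :=
  (EuclideanSpace.proj (𝕜 := ℝ) j).continuous.comp_aestronglyMeasurable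
    hA.bounded.aestronglyMeasurable

theorem IsBoundedPotential.locallyIntegrable (j : Fin 2) : LocallyIntegrable (fun x => A x j) := by
  obtain ⟨C, hC⟩ := hA.exists_bound
  exact (memLp_top_of_bound (hA.aestronglyMeasurable j) C (hC j)).locallyIntegrable le_top

theorem IsBoundedPotential.integrable_mul (j : Fin 2) {f : Plane → ℝ} (hf : Integrable f) :
    Integrable (fun x => A x j * f x) := by
  obtain ⟨C, hC⟩ := hA.exists_bound
  exact hf.bdd_mul (hA.aestronglyMeasurable j) (hC j)

end BoundedPotential

section Potential

variable {a₀ a₁ : Plane → ℝ}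

theorem fderiv_smul_proj_comm {x : Plane} (h₀ : DifferentiableAt ℝ a₀ x)
    (h₁ : DifferentiableAt ℝ a₁ x)
    (h_curl : fderiv ℝ a₁ x (EuclideanSpace.single 0 1)
      = fderiv ℝ a₀ x (EuclideanSpace.single 1 1)) (u v : Plane) :
    fderiv ℝ (fun y => a₀ y • EuclideanSpace.proj (𝕜 := ℝ) (0 : Fin 2)
        + a₁ y • EuclideanSpace.proj (𝕜 := ℝ) (1 : Fin 2)) x u v
      = fderiv ℝ (fun y => a₀ y • EuclideanSpace.proj (𝕜 := ℝ) (0 : Fin 2)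
        + a₁ y • EuclideanSpace.proj (𝕜 := ℝ) (1 : Fin 2)) x v u := by
  have h := (h₀.hasFDerivAt.smul_const (EuclideanSpace.proj (𝕜 := ℝ) (0 : Fin 2))).fun_add
    (h₁.hasFDerivAt.smul_const (EuclideanSpace.proj (𝕜 := ℝ) (1 : Fin 2)))
  rw [h.fderiv]
  simp only [add_apply, ContinuousLinearMap.smulRight_apply, smul_apply, smul_eq_mul,
    PiLp.proj_apply]
  rw [clm_apply_plane (fderiv ℝ a₀ x) u, clm_apply_plane (fderiv ℝ a₀ x) v,
    clm_apply_plane (fderiv ℝ a₁ x) u, clm_apply_plane (fderiv ℝ a₁ x) v, h_curl]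
  simp only [smul_eq_mul]
  ring

theorem exists_partialDeriv_eq_of_curl_eq_zero (h₀ : ContDiff ℝ 1 a₀) (h₁ : ContDiff ℝ 1 a₁)
    (h_curl : ∀ x, partialDeriv 0 a₁ x = partialDeriv 1 a₀ x) :
    ∃ φ : Plane → ℝ, ContDiff ℝ 2 φ ∧ partialDeriv 0 φ = a₀ ∧ partialDeriv 1 φ = a₁ := by
  set L : Plane → Plane →L[ℝ] ℝ := fun y => a₀ y • EuclideanSpace.proj (𝕜 := ℝ) (0 : Fin 2)
    + a₁ y • EuclideanSpace.proj (𝕜 := ℝ) (1 : Fin 2) with hL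
  have hL_smooth : ContDiff ℝ 1 L := by fun_prop
  obtain ⟨φ, hφ⟩ := convex_univ.exists_forall_hasFDerivAt_of_fderiv_symmetric isOpen_univ
    (hL_smooth.differentiable one_ne_zero).differentiableOn fun x _ u v =>
      fderiv_smul_proj_comm (h₀.differentiable one_ne_zero x)
        (h₁.differentiable one_ne_zero x) (h_curl x) u v
  have hφL : fderiv ℝ φ = L := funext fun x => (hφ x (mem_univ x)).fderiv
  refine ⟨φ, ?_, ?_, ?_⟩
  · rw [show (2 : WithTop ℕ∞) = 1 + 1 from one_add_one_eq_two.symm, contDiff_succ_iff_fderiv]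
    refine ⟨fun x => (hφ x (mem_univ x)).differentiableAt, by simp, ?_⟩
    rwa [hφL]
  all_goals
    funext x
    simp [partialDeriv, hφL, hL]

end Potential

section Gauge

variable {B : Plane → ℝ} {A A' : Plane → Plane}

theorem IsBoundedPotential.integral_partialDeriv_mul_sub (hA : IsBoundedPotential B A)
    (hA' : IsBoundedPotential B A') {ψ : Plane → ℝ} (hψ : IsTest ψ) :
    ∫ y, partialDeriv 0 ψ y • (A y 1 - A' y 1) = ∫ y, partialDeriv 1 ψ y • (A y 0 - A' y 0) := by
  have h_int (i j : Fin 2) := hA.integrable_mul i (hψ.integrable_partialDeriv j)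
  have h_int' (i j : Fin 2) := hA'.integrable_mul i (hψ.integrable_partialDeriv j)
  have h_curl := hA.curl_eq ψ hψ
  have h_curl' := hA'.curl_eq ψ hψ
  rw [integral_sub (h_int 0 1) (h_int 1 0)] at h_curl
  rw [integral_sub (h_int' 0 1) (h_int' 1 0)] at h_curl'
  have h_split (i j : Fin 2) : ∫ y, partialDeriv j ψ y • (A y i - A' y i)
      = (∫ y, A y i * partialDeriv j ψ y) - ∫ y, A' y i * partialDeriv j ψ y := by
    rw [← integral_sub (h_int i j) (h_int' i j)]
    refine integral_congr_ae (ae_of_all _ fun y => ?_)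
    simp only [smul_eq_mul]
    ring
  rw [h_split, h_split]
  linarith

theorem IsBoundedPotential.exists_partialDeriv_eq_mollify_sub (hA : IsBoundedPotential B A)
    (hA' : IsBoundedPotential B A') (n : ℕ) :
    ∃ φ : Plane → ℝ, ContDiff ℝ 2 φ ∧ ∀ j, partialDeriv j φ
      = mollify n (fun x => A x j) - mollify n (fun x => A' x j) := by
  have h_loc (j : Fin 2) : LocallyIntegrable fun x => A x j - A' x j :=
    (hA.locallyIntegrable j).sub (hA'.locallyIntegrable j)
  have h_smooth (j : Fin 2) : ContDiff ℝ 1 (mollify n fun x => A x j - A' x j) :=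
    (contDiff_mollify n (h_loc j)).of_le (by exact_mod_cast le_top)
  obtain ⟨φ, hφ, hφ₀, hφ₁⟩ := exists_partialDeriv_eq_of_curl_eq_zero (h_smooth 0) (h_smooth 1)
    fun x => by
      rw [partialDeriv, partialDeriv, fderiv_mollify n (h_loc 1), fderiv_mollify n (h_loc 0),
        hA.integral_partialDeriv_mul_sub hA' (isTest_mollifier_sub n x)]
  have h_sub (j : Fin 2) := mollify_sub n (hA.locallyIntegrable j) (hA'.locallyIntegrable j)
  refine ⟨φ, hφ, fun j => ?_⟩
  rw [← h_sub]
  fin_cases j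
  exacts [hφ₀, hφ₁]

theorem dz_ofReal_sub_I_mul {f φ : Plane → ℝ} {x : Plane} (hf : DifferentiableAt ℝ f x)
    (hφ : DifferentiableAt ℝ φ x) :
    Complex.I * dz (fun y => (f y : ℂ) - Complex.I * φ y) x
      = ((partialDeriv 1 f x + partialDeriv 0 φ x : ℝ) : ℂ)
        - Complex.I * (partialDeriv 1 φ x - partialDeriv 0 f x : ℝ) := by
  have h_fderiv (v : Plane) : fderiv ℝ (fun y => (f y : ℂ) - Complex.I * φ y) x v
      = (fderiv ℝ f x v : ℂ) - Complex.I * (fderiv ℝ φ x v : ℂ) := by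
    have hf' := (Complex.ofRealCLM.hasFDerivAt (x := f x)).comp x hf.hasFDerivAt
    have hφ' := ((Complex.ofRealCLM.hasFDerivAt (x := φ x)).comp x
      hφ.hasFDerivAt).const_mul Complex.I
    exact (DFunLike.congr_fun (hf'.sub hφ').fderiv v).trans (by simp)
  simp only [dz, h_fderiv, partialDeriv]
  push_cast
  linear_combination (-(fderiv ℝ φ x (EuclideanSpace.single 0 1) : ℂ)
    - (fderiv ℝ f x (EuclideanSpace.single 1 1) : ℂ)
    + Complex.I * fderiv ℝ φ x (EuclideanSpace.single 1 1)) * Complex.I_sq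

theorem AdmissibleField.exists_gauge (hB : AdmissibleField B) (hA : IsBoundedPotential B A)
    (n : ℕ) :
    ∃ F : Plane → ℂ, ContDiff ℝ 2 F ∧ (∀ x, (F x).re = mollify n (scalarPotential B) x) ∧
      ∀ x, Complex.I * dz F x = ((mollify n (fun x => A x 0) x : ℝ) : ℂ)
        - Complex.I * ((mollify n (fun x => A x 1) x : ℝ) : ℂ) := by
  obtain ⟨φ, hφ, h_grad⟩ := hA.exists_partialDeriv_eq_mollify_sub hB.isBoundedPotential n
  set h := mollify n (scalarPotential B)
  have h_smooth : ContDiff ℝ 2 h :=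
    mod_cast contDiff_infty.1
      (contDiff_mollify n hB.continuous_scalarPotential.locallyIntegrable) 2
  have h_partial (j : Fin 2) (x : Plane) :
      partialDeriv j h x = mollify n (partialDeriv j (scalarPotential B)) x :=
    hB.fderiv_mollify_scalarPotential n j x
  refine ⟨fun x => (h x : ℂ) - Complex.I * φ x, (Complex.ofRealCLM.contDiff.comp h_smooth).sub
    (contDiff_const.mul (Complex.ofRealCLM.contDiff.comp hφ)), fun x => by simp, fun x => ?_⟩
  have h_vec₀ : mollify n (fun x => vectorPotential B x 0) x = partialDeriv 1 h x :=
    (h_partial 1 x).symm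
  have h_vec₁ : mollify n (fun x => vectorPotential B x 1) x = -partialDeriv 0 h x := by
    rw [h_partial, mollify_eq, mollify_eq, ← integral_neg]
    simp [vectorPotential]
  rw [dz_ofReal_sub_I_mul (h_smooth.differentiable two_ne_zero x)
    (hφ.differentiable two_ne_zero x), h_grad, h_grad, Pi.sub_apply, Pi.sub_apply, h_vec₀, h_vec₁,
    add_sub_cancel, sub_neg_eq_add, add_sub_cancel_right]

end Gauge

/-- The operator `(P₁ - i P₂) u`, where `P = i∇ + a` and `u` has gradient `Du`. -/
noncomputable def pauliOp (a : Fin 2 → Plane → ℝ) (u : Plane → ℂ) (Du : Fin 2 → Plane → ℂ)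
    (x : Plane) : ℂ :=
  (Complex.I * Du 0 x + (a 0 x : ℂ) * u x)
    - Complex.I * (Complex.I * Du 1 x + (a 1 x : ℂ) * u x)

/-- The classical gradient of a complex-valued function. -/
noncomputable def cgrad (u : Plane → ℂ) (j : Fin 2) (x : Plane) : ℂ :=
  fderiv ℝ u x (EuclideanSpace.single j 1)

theorem norm_dz_exp_mul {F u : Plane → ℂ} {a : Fin 2 → Plane → ℝ} {x : Plane}
    (hF : DifferentiableAt ℝ F x) (hu : DifferentiableAt ℝ u x)
    (hFa : Complex.I * dz F x = (a 0 x : ℂ) - Complex.I * (a 1 x : ℂ)) :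
    ‖dz (fun x => Complex.exp (F x) * u x) x‖
      = Real.exp (F x).re * ‖pauliOp a u (cgrad u) x‖ := by
  have h_fderiv (v : Plane) : fderiv ℝ (fun x => Complex.exp (F x) * u x) x v
      = Complex.exp (F x) * fderiv ℝ u x v + u x * (Complex.exp (F x) * fderiv ℝ F x v) :=
    (DFunLike.congr_fun (hF.hasFDerivAt.cexp.mul hu.hasFDerivAt).fderiv v).trans (by simp)
  have h_dz : Complex.I * dz (fun x => Complex.exp (F x) * u x) x
      = Complex.exp (F x) * pauliOp a u (cgrad u) x := by
    simp only [dz] at hFa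
    rw [dz, h_fderiv, h_fderiv, pauliOp, cgrad, cgrad]
    linear_combination Complex.exp (F x) * u x * hFa
  simpa only [norm_mul, Complex.norm_I, one_mul, Complex.norm_exp] using congrArg norm h_dz

/-! ### The Hardy inequality for smooth functions -/

section PauliOperator

variable {a : Fin 2 → Plane → ℝ} {u : Plane → ℂ}

theorem continuous_cgrad (hu : ContDiff ℝ 1 u) (j : Fin 2) : Continuous (cgrad u j) :=
  (hu.continuous_fderiv one_ne_zero).clm_apply continuous_const

theorem hasCompactSupport_cgrad (hc : HasCompactSupport u) (j : Fin 2) :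
    HasCompactSupport (cgrad u j) :=
  hc.fderiv_apply (𝕜 := ℝ) _

theorem norm_pauliOp_le {Du : Fin 2 → Plane → ℂ} {x : Plane} {C : ℝ} (ha : ∀ j, ‖a j x‖ ≤ C) :
    ‖pauliOp a u Du x‖ ≤ ‖Du 0 x‖ + ‖Du 1 x‖ + 2 * C * ‖u x‖ := by
  have h_component (j : Fin 2) :
      ‖Complex.I * Du j x + (a j x : ℂ) * u x‖ ≤ ‖Du j x‖ + C * ‖u x‖ := by
    refine (norm_add_le _ _).trans ?_
    rw [norm_mul, norm_mul, Complex.norm_I, one_mul, Complex.norm_real]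
    gcongr
    exact ha j
  refine (norm_sub_le _ _).trans ?_
  rw [norm_mul, Complex.norm_I, one_mul]
  linarith [h_component 0, h_component 1]

theorem continuous_pauliOp {Du : Fin 2 → Plane → ℂ} (ha : ∀ j, Continuous (a j))
    (hu : Continuous u) (hDu : ∀ j, Continuous (Du j)) : Continuous (pauliOp a u Du) := by
  unfold pauliOp
  fun_prop

end PauliOperator

section SmoothHardy

variable {u : Plane → ℂ} {ρ : ℝ}

section Gauge

variable {α : ℝ} {F : Plane → ℂ}

theorem mul_integral_norm_sq_le_of_le (hα : 0 ≤ α) (hρ : 0 < ρ) (hF : Continuous F) {m : ℝ}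
    (hm₀ : 0 ≤ m) (hm : ∀ x, m ≤ gPlus α ρ ‖x‖ * Real.exp (F x).re) (hu : Continuous u)
    (hc : HasCompactSupport u) :
    m ^ 2 * ∫ x, ‖u x‖ ^ 2 * hardyWeight ρ ‖x‖
      ≤ ∫ x, gPlus α ρ ‖x‖ ^ 2 * (‖Complex.exp (F x) * u x‖ ^ 2 * hardyWeight ρ ‖x‖) := by
  have h_weight : Continuous fun x : Plane => hardyWeight ρ ‖x‖ :=
    (continuous_hardyWeight hρ).comp continuous_norm
  have h_supp {w : Plane → ℂ} (hw : HasCompactSupport w) :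
      HasCompactSupport fun x => ‖w x‖ ^ 2 * hardyWeight ρ ‖x‖ :=
    (hw.comp_left (g := fun z : ℂ => ‖z‖ ^ 2) (by simp)).mul_right
  have h_int : Integrable fun x => ‖u x‖ ^ 2 * hardyWeight ρ ‖x‖ :=
    Continuous.integrable_of_hasCompactSupport (by fun_prop) (h_supp hc)
  rw [← integral_const_mul]
  refine integral_mono (h_int.const_mul _)
    (integrable_gPlus_sq_mul hα hρ (by fun_prop) (h_supp hc.mul_left)) fun x => ?_
  have h_nonneg := hardyWeight_nonneg ρ ‖x‖
  calc m ^ 2 * (‖u x‖ ^ 2 * hardyWeight ρ ‖x‖)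
      ≤ (gPlus α ρ ‖x‖ * Real.exp (F x).re) ^ 2 * (‖u x‖ ^ 2 * hardyWeight ρ ‖x‖) := by
        gcongr
        exact hm x
    _ = gPlus α ρ ‖x‖ ^ 2 * (‖Complex.exp (F x) * u x‖ ^ 2 * hardyWeight ρ ‖x‖) := by
        rw [norm_mul, Complex.norm_exp]
        ring

theorem integral_norm_sq_dz_le_of_le (hα : 0 ≤ α) (hρ : 0 < ρ) (hF : ContDiff ℝ 1 F)
    {a : Fin 2 → Plane → ℝ} (hFa : ∀ x, Complex.I * dz F x = (a 0 x : ℂ) - Complex.I * (a 1 x : ℂ))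
    {M : ℝ} (hM : ∀ x, gPlus α ρ ‖x‖ * Real.exp (F x).re ≤ M)
    (hu : ContDiff ℝ 1 u) (hc : HasCompactSupport u) :
    ∫ x, gPlus α ρ ‖x‖ ^ 2 * ‖dz (fun x => Complex.exp (F x) * u x) x‖ ^ 2
      ≤ M ^ 2 * ∫ x, ‖pauliOp a u (cgrad u) x‖ ^ 2 := by
  set v : Plane → ℂ := fun x => Complex.exp (F x) * u x
  have h_norm_dz (x : Plane) : ‖dz v x‖ = Real.exp (F x).re * ‖pauliOp a u (cgrad u) x‖ :=
    norm_dz_exp_mul (hF.differentiable one_ne_zero x) (hu.differentiable one_ne_zero x) (hFa x)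
  have hF_cont := hF.continuous
  have h_dz : Continuous (dz v) := continuous_dz (hF.cexp.mul hu)
  have h_supp : HasCompactSupport fun x => ‖dz v x‖ ^ 2 :=
    (hasCompactSupport_dz hc.mul_left).comp_left (g := fun z : ℂ => ‖z‖ ^ 2) (by simp)
  have h_int : Integrable fun x => ‖pauliOp a u (cgrad u) x‖ ^ 2 := by
    have h_eq : (fun x => ‖pauliOp a u (cgrad u) x‖ ^ 2)
        = fun x => Real.exp (-(F x).re) ^ 2 * ‖dz v x‖ ^ 2 := funext fun x => by
      rw [h_norm_dz, ← mul_pow, ← mul_assoc, ← Real.exp_add, neg_add_cancel, Real.exp_zero, one_mul]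
    rw [h_eq]
    exact Continuous.integrable_of_hasCompactSupport (by fun_prop) h_supp.mul_left
  rw [← integral_const_mul]
  refine integral_mono (integrable_gPlus_sq_mul hα hρ (by fun_prop) h_supp) (h_int.const_mul _)
    fun x => ?_
  calc gPlus α ρ ‖x‖ ^ 2 * ‖dz v x‖ ^ 2
      = (gPlus α ρ ‖x‖ * Real.exp (F x).re) ^ 2 * ‖pauliOp a u (cgrad u) x‖ ^ 2 := by
        rw [h_norm_dz]
        ring
    _ ≤ M ^ 2 * ‖pauliOp a u (cgrad u) x‖ ^ 2 := by
        have h_pos : 0 < gPlus α ρ ‖x‖ := gPlus_pos hρ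
        gcongr
        exact hM x

theorem hardy_of_gauge (hα : 1 ≤ α) (hρ : 0 < ρ) (hF : ContDiff ℝ 2 F)
    {a : Fin 2 → Plane → ℝ} (hFa : ∀ x, Complex.I * dz F x = (a 0 x : ℂ) - Complex.I * (a 1 x : ℂ))
    {m M : ℝ} (hm₀ : 0 ≤ m) (hm : ∀ x, m ≤ gPlus α ρ ‖x‖ * Real.exp (F x).re)
    (hM : ∀ x, gPlus α ρ ‖x‖ * Real.exp (F x).re ≤ M)
    (hu : ContDiff ℝ 2 u) (hc : HasCompactSupport u) :
    m ^ 2 * (hardyConst α * ∫ x, ‖u x‖ ^ 2 * hardyWeight ρ ‖x‖)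
      ≤ M ^ 2 * ∫ x, ‖pauliOp a u (cgrad u) x‖ ^ 2 := by
  have hα₀ : 0 ≤ α := zero_le_one.trans hα
  set v : Plane → ℂ := fun x => Complex.exp (F x) * u x
  calc m ^ 2 * (hardyConst α * ∫ x, ‖u x‖ ^ 2 * hardyWeight ρ ‖x‖)
      = hardyConst α * (m ^ 2 * ∫ x, ‖u x‖ ^ 2 * hardyWeight ρ ‖x‖) := mul_left_comm ..
    _ ≤ hardyConst α * ∫ x, gPlus α ρ ‖x‖ ^ 2 * (‖v x‖ ^ 2 * hardyWeight ρ ‖x‖) :=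
        mul_le_mul_of_nonneg_left (mul_integral_norm_sq_le_of_le hα₀ hρ hF.continuous hm₀ hm
          hu.continuous hc) (hardyConst_nonneg hα₀)
    _ ≤ ∫ x, gPlus α ρ ‖x‖ ^ 2 * ‖dz v x‖ ^ 2 :=
        gPlus_sq_hardy hα hρ (hF.cexp.mul hu) hc.mul_left
    _ ≤ M ^ 2 * ∫ x, ‖pauliOp a u (cgrad u) x‖ ^ 2 :=
        integral_norm_sq_dz_le_of_le hα₀ hρ (hF.of_le one_le_two) hFa hM (hu.of_le one_le_two) hc

end Gauge

theorem mul_exp_le_div {k g h h' δ : ℝ} (hk : 0 < k) (hkg : k * g ≤ Real.exp (-h))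
    (hδ : |h' - h| ≤ δ) : g * Real.exp h' ≤ Real.exp δ / k := by
  rw [le_div_iff₀ hk]
  calc g * Real.exp h' * k = k * g * Real.exp h' := by ring
    _ ≤ Real.exp (-h) * Real.exp h' := by gcongr
    _ = Real.exp (h' - h) := by rw [← Real.exp_add, neg_add_eq_sub]
    _ ≤ Real.exp δ := Real.exp_le_exp.2 (le_of_abs_le hδ)

theorem div_le_mul_exp {K g h h' δ : ℝ} (hK : 0 < K) (hKg : Real.exp (-h) ≤ K * g)
    (hδ : |h' - h| ≤ δ) : Real.exp (-δ) / K ≤ g * Real.exp h' := by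
  rw [div_le_iff₀ hK]
  calc Real.exp (-δ) ≤ Real.exp (h' - h) := Real.exp_le_exp.2 (neg_le_of_abs_le hδ)
    _ = Real.exp (-h) * Real.exp h' := by rw [← Real.exp_add, neg_add_eq_sub]
    _ ≤ K * g * Real.exp h' := by gcongr
    _ = g * Real.exp h' * K := by ring

variable {B : Plane → ℝ} {A : Plane → Plane}

theorem IsBoundedPotential.tendsto_integral_pauliOp_mollify (hA : IsBoundedPotential B A)
    (hu : ContDiff ℝ 1 u) (hc : HasCompactSupport u) :
    Tendsto (fun n => ∫ x, ‖pauliOp (fun j => mollify n fun x => A x j) u (cgrad u) x‖ ^ 2) atTop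
      (𝓝 (∫ x, ‖pauliOp (fun j x => A x j) u (cgrad u) x‖ ^ 2)) := by
  obtain ⟨C, hC⟩ := hA.exists_bound
  have h_cgrad := continuous_cgrad hu
  have hu_cont := hu.continuous
  have h_mollify (n : ℕ) (j : Fin 2) : Continuous (mollify n fun x => A x j) :=
    (contDiff_mollify n (hA.locallyIntegrable j)).continuous
  refine tendsto_integral_of_dominated_convergence
    (fun x => (‖cgrad u 0 x‖ + ‖cgrad u 1 x‖ + 2 * C * ‖u x‖) ^ 2) (fun n => ?_) ?_ ?_ ?_
  · exact ((continuous_pauliOp (h_mollify n) hu_cont h_cgrad).norm.pow 2).aestronglyMeasurable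
  · refine Continuous.integrable_of_hasCompactSupport (by fun_prop) ?_
    exact (((hasCompactSupport_cgrad hc 0).norm.add (hasCompactSupport_cgrad hc 1).norm).add
      hc.norm.mul_left).comp_left (g := fun t : ℝ => t ^ 2) (by simp)
  · refine fun n => Eventually.of_forall fun x => ?_
    rw [norm_pow, norm_norm]
    gcongr
    exact norm_pauliOp_le fun j => norm_mollify_le n (hC j) x
  · filter_upwards [ae_tendsto_mollify (hA.locallyIntegrable 0),
      ae_tendsto_mollify (hA.locallyIntegrable 1)] with x h₀ h₁
    have h_term {f : ℕ → ℝ} {b : ℝ} (hf : Tendsto f atTop (𝓝 b)) (z : ℂ) :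
        Tendsto (fun n => z + (f n : ℂ) * u x) atTop (𝓝 (z + b * u x)) :=
      (((Complex.continuous_ofReal.tendsto b).comp hf).mul_const (u x)).const_add z
    exact ((h_term h₀ _).sub ((h_term h₁ _).const_mul Complex.I)).norm.pow 2

theorem AdmissibleField.exists_abs_mollify_scalarPotential_sub_le (hB : AdmissibleField B) :
    ∃ M : ℝ, ∀ (n : ℕ) (x : Plane),
      |mollify n (scalarPotential B) x - scalarPotential B x| ≤ M * (1 / (n + 1)) := by
  obtain ⟨M, hM₀, hM⟩ := hB.exists_norm_fderiv_scalarPotential_le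
  exact ⟨M, fun n x => norm_mollify_sub_le n hM₀ hB.continuous_scalarPotential (fun y z =>
    convex_univ.norm_image_sub_le_of_norm_fderiv_le
      (fun w _ => hB.differentiable_scalarPotential w) (fun w _ => hM w)
      (mem_univ z) (mem_univ y)) x⟩

theorem AdmissibleField.hardy_lower_bound_smooth (hB : AdmissibleField B) (hα : 1 ≤ flux B)
    (hA : IsBoundedPotential B A) (hρ : 0 < ρ) {k K : ℝ} (hk : 0 < k) (hK : 0 < K)
    (h_lower : ∀ x, k * gPlus (flux B) ρ ‖x‖ ≤ Real.exp (-scalarPotential B x))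
    (h_upper : ∀ x, Real.exp (-scalarPotential B x) ≤ K * gPlus (flux B) ρ ‖x‖)
    (hu : ContDiff ℝ 2 u) (hc : HasCompactSupport u) :
    k ^ 2 * (hardyConst (flux B) * ∫ x, ‖u x‖ ^ 2 * hardyWeight ρ ‖x‖)
      ≤ K ^ 2 * ∫ x, ‖pauliOp (fun j x => A x j) u (cgrad u) x‖ ^ 2 := by
  obtain ⟨M, hM⟩ := hB.exists_abs_mollify_scalarPotential_sub_le
  set X := hardyConst (flux B) * ∫ x, ‖u x‖ ^ 2 * hardyWeight ρ ‖x‖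
  set T := ∫ x, ‖pauliOp (fun j x => A x j) u (cgrad u) x‖ ^ 2
  set δ : ℕ → ℝ := fun n => M * (1 / (n + 1))
  have h_mollified (n : ℕ) : (Real.exp (-δ n) / K) ^ 2 * X ≤ (Real.exp (δ n) / k) ^ 2
      * ∫ x, ‖pauliOp (fun j => mollify n fun x => A x j) u (cgrad u) x‖ ^ 2 := by
    obtain ⟨F, hF, hF_re, hFa⟩ := hB.exists_gauge hA n
    refine hardy_of_gauge hα hρ hF hFa (by positivity) (fun x => ?_) (fun x => ?_) hu hc
    · rw [hF_re]
      exact div_le_mul_exp hK (h_upper x) (hM n x)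
    · rw [hF_re]
      exact mul_exp_le_div hk (h_lower x) (hM n x)
  have hδ : Tendsto δ atTop (𝓝 0) := by
    simpa only [mul_zero] using tendsto_one_div_add_atTop_nhds_zero_nat.const_mul M
  have h_exp {f : ℕ → ℝ} (hf : Tendsto f atTop (𝓝 0)) :
      Tendsto (fun n => Real.exp (f n)) atTop (𝓝 1) := by
    simpa only [Real.exp_zero, Function.comp_def] using (Real.continuous_exp.tendsto 0).comp hf
  have h_limit : (1 / K) ^ 2 * X ≤ (1 / k) ^ 2 * T :=
    le_of_tendsto_of_tendsto'
      ((((h_exp (by simpa only [neg_zero] using hδ.neg)).div_const K).pow 2).mul_const X)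
      ((((h_exp hδ).div_const k).pow 2).mul
        (hA.tendsto_integral_pauliOp_mollify (hu.of_le one_le_two) hc)) h_mollified
  rw [div_pow, div_pow, one_pow, div_mul_eq_mul_div, div_mul_eq_mul_div, one_mul, one_mul,
    div_le_div_iff₀ (by positivity) (by positivity)] at h_limit
  linarith

end SmoothHardy

/-! ### Approximation in `H¹` -/

theorem tendsto_zero_of_sq_le {ι : Type*} {l : Filter ι} {a b : ι → ℝ≥0∞} (h : ∀ i, a i ^ 2 ≤ b i)
    (hb : Tendsto b l (𝓝 0)) : Tendsto a l (𝓝 0) := by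
  have h_sqrt : Tendsto (fun i => b i ^ (1 / 2 : ℝ)) l (𝓝 0) := by
    simpa [Function.comp_def] using
      ((ENNReal.continuous_rpow_const (y := 1 / 2)).tendsto 0).comp hb
  refine tendsto_of_tendsto_of_tendsto_of_le_of_le tendsto_const_nhds h_sqrt (fun _ => zero_le)
    fun i => ?_
  calc a i = (a i ^ 2) ^ (1 / 2 : ℝ) := by
        rw [← ENNReal.rpow_natCast, ← ENNReal.rpow_mul, Nat.cast_two,
          mul_one_div_cancel two_ne_zero, ENNReal.rpow_one]
    _ ≤ b i ^ (1 / 2 : ℝ) := ENNReal.rpow_le_rpow (h i) one_half_pos.le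

section L2

variable {X E : Type*} [MeasurableSpace X] {μ : Measure X} [NormedAddCommGroup E]

theorem ofReal_integral_norm_sq {f : X → E} (hf : MemLp f 2 μ) :
    ENNReal.ofReal (∫ x, ‖f x‖ ^ 2 ∂μ) = eLpNorm f 2 μ ^ 2 := by
  rw [eLpNorm_two_sq, ofReal_integral_eq_lintegral_ofReal (hf.integrable_norm_pow two_ne_zero)
    (Eventually.of_forall fun x => by positivity)]
  congr 1 with x
  rw [ENNReal.ofReal_pow (norm_nonneg _), ofReal_norm]

theorem tendsto_eLpNorm_smul_of_tendsto_zero [NormedSpace ℝ E] {f : X → E} (hf : MemLp f 2 μ)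
    {c : ℕ → X → ℝ} (hc : ∀ n, AEStronglyMeasurable (c n) μ) (hc_le : ∀ n x, ‖c n x‖ ≤ 1)
    (hc_lim : ∀ x, Tendsto (fun n => c n x) atTop (𝓝 0)) :
    Tendsto (fun n => eLpNorm (fun x => c n x • f x) 2 μ) atTop (𝓝 0) := by
  refine tendsto_zero_of_sq_le (b := fun n => ∫⁻ x, ‖c n x • f x‖ₑ ^ 2 ∂μ)
    (fun n => (eLpNorm_two_sq _ _).le) ?_
  have h_limit := tendsto_lintegral_of_dominated_convergence' (μ := μ)
    (F := fun n x => ‖c n x • f x‖ₑ ^ 2) (f := fun _ => 0) (fun x => ‖f x‖ₑ ^ 2)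
    (fun n => ((hc n).smul hf.aestronglyMeasurable).enorm.pow_const 2)
    (fun n => Eventually.of_forall fun x => ?_) ?_ (Eventually.of_forall fun x => ?_)
  · simpa using h_limit
  · refine pow_le_pow_left' ?_ 2
    rw [enorm_smul, ← ofReal_norm (c n x)]
    exact mul_le_of_le_one_left zero_le (ENNReal.ofReal_le_one.2 (hc_le n x))
  · rw [← eLpNorm_two_sq]
    exact ENNReal.pow_ne_top hf.eLpNorm_ne_top
  · simpa [Function.comp_def] using
      ((ENNReal.continuous_pow 2).tendsto _).comp ((hc_lim x).smul_const (f x)).enorm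

/-- Convergence in `L²(μ; ℂ)`, for honest functions rather than classes modulo null sets. -/
structure L2Tendsto (μ : Measure X) (f : ℕ → X → ℂ) (g : X → ℂ) : Prop where
  memLp : ∀ n, MemLp (f n) 2 μ
  memLp_lim : MemLp g 2 μ
  tendsto : Tendsto (fun n => eLpNorm (f n - g) 2 μ) atTop (𝓝 0)

namespace L2Tendsto

variable {f f' : ℕ → X → ℂ} {g g' : X → ℂ}

theorem const (hg : MemLp g 2 μ) : L2Tendsto μ (fun _ => g) g :=
  ⟨fun _ => hg, hg, by simp⟩

theorem of_le_add {a b : ℕ → ℝ≥0∞} (hf : ∀ n, MemLp (f n) 2 μ) (hg : MemLp g 2 μ)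
    (h : ∀ n, eLpNorm (f n - g) 2 μ ≤ a n + b n) (ha : Tendsto a atTop (𝓝 0))
    (hb : Tendsto b atTop (𝓝 0)) : L2Tendsto μ f g :=
  ⟨hf, hg, tendsto_of_tendsto_of_tendsto_of_le_of_le tendsto_const_nhds
    (by simpa only [add_zero] using ha.add hb) (fun _ => zero_le) h⟩

theorem add (h : L2Tendsto μ f g) (h' : L2Tendsto μ f' g') :
    L2Tendsto μ (fun n x => f n x + f' n x) (fun x => g x + g' x) := by
  refine of_le_add (fun n => (h.memLp n).add (h'.memLp n)) (h.memLp_lim.add h'.memLp_lim)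
    (fun n => ?_) h.tendsto h'.tendsto
  have h_split : ((fun x => f n x + f' n x) - fun x => g x + g' x) = (f n - g) + (f' n - g') :=
    funext fun x => add_sub_add_comm ..
  rw [h_split]
  exact eLpNorm_add_le ((h.memLp n).sub h.memLp_lim).aestronglyMeasurable
    ((h'.memLp n).sub h'.memLp_lim).aestronglyMeasurable one_le_two

theorem bdd_mul (h : L2Tendsto μ f g) {m : X → ℂ} (hm : AEStronglyMeasurable m μ) {C : ℝ}
    (hC : ∀ᵐ x ∂μ, ‖m x‖ ≤ C) : L2Tendsto μ (fun n x => m x * f n x) (fun x => m x * g x) := by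
  have h_memLp {φ : X → ℂ} (hφ : MemLp φ 2 μ) : MemLp (fun x => m x * φ x) 2 μ :=
    hφ.of_le_mul (c := C) (hm.mul hφ.aestronglyMeasurable) (by
      filter_upwards [hC] with x hx
      rw [norm_mul]
      gcongr)
  refine of_le_add (b := fun _ => 0) (fun n => h_memLp (h.memLp n)) (h_memLp h.memLp_lim)
    (a := fun n => ENNReal.ofReal C * eLpNorm (f n - g) 2 μ) (fun n => ?_) ?_ tendsto_const_nhds
  · rw [add_zero]
    refine eLpNorm_le_mul_eLpNorm_of_ae_le_mul ?_ 2
    filter_upwards [hC] with x hx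
    rw [Pi.sub_apply, Pi.sub_apply, ← mul_sub, norm_mul]
    gcongr
  · simpa only [mul_zero] using
      ENNReal.Tendsto.const_mul h.tendsto (Or.inr ENNReal.ofReal_ne_top)

theorem integral_norm_sq (h : L2Tendsto μ f g) :
    Tendsto (fun n => ∫ x, ‖f n x‖ ^ 2 ∂μ) atTop (𝓝 (∫ x, ‖g x‖ ^ 2 ∂μ)) := by
  have h_eq {φ : X → ℂ} (hφ : MemLp φ 2 μ) :
      ∫ x, ‖φ x‖ ^ 2 ∂μ = (eLpNorm φ 2 μ).toReal ^ 2 := by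
    rw [← ENNReal.toReal_pow, ← ofReal_integral_norm_sq hφ, ENNReal.toReal_ofReal (by positivity)]
  have h_Lp : Tendsto (fun n => (h.memLp n).toLp (f n)) atTop (𝓝 (h.memLp_lim.toLp g)) :=
    (Lp.tendsto_Lp_iff_tendsto_eLpNorm'' _ _ _ _).2 h.tendsto
  simpa only [h_eq (h.memLp _), h_eq h.memLp_lim, Lp.norm_toLp] using h_Lp.norm.pow 2

theorem exists_seq_tendsto_ae (h : L2Tendsto μ f g) :
    ∃ ns : ℕ → ℕ, StrictMono ns ∧ ∀ᵐ x ∂μ, Tendsto (fun i => f (ns i) x) atTop (𝓝 (g x)) :=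
  (tendstoInMeasure_of_tendsto_eLpNorm two_ne_zero (fun n => (h.memLp n).aestronglyMeasurable)
    h.memLp_lim.aestronglyMeasurable h.tendsto).exists_seq_tendsto_ae

theorem comp_strictMono (h : L2Tendsto μ f g) {ns : ℕ → ℕ} (hns : StrictMono ns) :
    L2Tendsto μ (fun n => f (ns n)) g :=
  ⟨fun n => h.memLp (ns n), h.memLp_lim, h.tendsto.comp hns.tendsto_atTop⟩

theorem tendsto_sub (h : L2Tendsto μ f g) :
    Tendsto (fun p : ℕ × ℕ => eLpNorm (f p.1 - f p.2) 2 μ) atTop (𝓝 0) := by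
  rw [← prod_atTop_atTop_eq]
  have h_fst := h.tendsto.comp (tendsto_fst (f := atTop) (g := (atTop : Filter ℕ)))
  have h_snd := h.tendsto.comp (tendsto_snd (f := (atTop : Filter ℕ)) (g := atTop))
  refine tendsto_of_tendsto_of_tendsto_of_le_of_le tendsto_const_nhds
    (by simpa only [add_zero] using h_fst.add h_snd) (fun _ => zero_le) fun p => ?_
  rw [← sub_sub_sub_cancel_right (f p.1) (f p.2) g]
  exact eLpNorm_sub_le ((h.memLp _).sub h.memLp_lim).aestronglyMeasurable
    ((h.memLp _).sub h.memLp_lim).aestronglyMeasurable one_le_two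

theorem mul_of_cauchy (h : L2Tendsto μ f g) {m : X → ℂ}
    (hm : ∀ n, MemLp (fun x => m x * f n x) 2 μ)
    (h_cauchy : Tendsto (fun p : ℕ × ℕ => eLpNorm (fun x => m x * (f p.1 x - f p.2 x)) 2 μ)
      atTop (𝓝 0)) :
    L2Tendsto μ (fun n x => m x * f n x) (fun x => m x * g x) := by
  have h_cauchySeq : CauchySeq (fun n => (hm n).toLp _) := by
    rw [Lp.cauchySeq_Lp_iff_cauchySeq_eLpNorm]
    refine h_cauchy.congr fun p => eLpNorm_congr_ae ?_
    filter_upwards [(hm p.1).coeFn_toLp, (hm p.2).coeFn_toLp] with x h₁ h₂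
    rw [Pi.sub_apply, h₁, h₂, mul_sub]
  obtain ⟨G, hG⟩ := cauchySeq_tendsto_of_complete h_cauchySeq
  have h_lim : L2Tendsto μ (fun n x => m x * f n x) G := by
    refine ⟨hm, Lp.memLp G, ((Lp.tendsto_Lp_iff_tendsto_eLpNorm' _ _).1 hG).congr fun n =>
      eLpNorm_congr_ae ?_⟩
    filter_upwards [(hm n).coeFn_toLp] with x hx
    rw [Pi.sub_apply, Pi.sub_apply, hx]
  obtain ⟨ns, hns, h_ae⟩ := h_lim.exists_seq_tendsto_ae
  obtain ⟨ms, hms, h_ae'⟩ := (h.comp_strictMono hns).exists_seq_tendsto_ae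
  have hG_eq : (G : X → ℂ) =ᵐ[μ] fun x => m x * g x := by
    filter_upwards [h_ae, h_ae'] with x hx hx'
    exact tendsto_nhds_unique (hx.comp hms.tendsto_atTop) (hx'.const_mul (m x))
  exact ⟨hm, (memLp_congr_ae hG_eq).1 (Lp.memLp G),
    h_lim.tendsto.congr fun n => eLpNorm_congr_ae (EventuallyEq.rfl.sub hG_eq)⟩

end L2Tendsto

end L2

section Cutoff

/-- A fixed bump function, equal to `1` on the unit ball and supported in the ball of radius `2`. -/
noncomputable def cutoffBump : ContDiffBump (0 : Plane) where
  rIn := 1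
  rOut := 2
  rIn_pos := one_pos
  rIn_lt_rOut := one_lt_two

/-- A smooth cutoff, equal to `1` on the ball of radius `n + 1`. -/
noncomputable def cutoff (n : ℕ) (x : Plane) : ℝ :=
  cutoffBump ((1 / ((n : ℝ) + 1)) • x)

theorem contDiff_cutoff (n : ℕ) : ContDiff ℝ ∞ (cutoff n) :=
  cutoffBump.contDiff.comp (contDiff_const_smul _)

theorem hasCompactSupport_cutoff (n : ℕ) : HasCompactSupport (cutoff n) :=
  cutoffBump.hasCompactSupport.comp_smul (by positivity)

theorem cutoff_nonneg (n : ℕ) (x : Plane) : 0 ≤ cutoff n x := cutoffBump.nonneg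

theorem cutoff_le_one (n : ℕ) (x : Plane) : cutoff n x ≤ 1 := cutoffBump.le_one

theorem tendsto_cutoff (x : Plane) : Tendsto (fun n => cutoff n x) atTop (𝓝 1) := by
  have h_scale : Tendsto (fun n : ℕ => (1 / ((n : ℝ) + 1)) • x) atTop (𝓝 0) := by
    simpa only [zero_smul] using
      (tendsto_one_div_add_atTop_nhds_zero_nat (𝕜 := ℝ)).smul_const x
  have h_one : cutoffBump (0 : Plane) = 1 :=
    cutoffBump.one_of_mem_closedBall (Metric.mem_closedBall_self zero_le_one)
  exact h_one ▸ (cutoffBump.continuous.tendsto (0 : Plane)).comp h_scale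

theorem exists_norm_fderiv_cutoff_le :
    ∃ C : ℝ, ∀ (n : ℕ) (x : Plane), ‖fderiv ℝ (cutoff n) x‖ ≤ C * (1 / ((n : ℝ) + 1)) := by
  obtain ⟨C, hC⟩ := (cutoffBump.hasCompactSupport.fderiv (𝕜 := ℝ)).exists_bound_of_continuous
    ((cutoffBump.contDiff (n := 1)).continuous_fderiv one_ne_zero)
  refine ⟨C, fun n x => ?_⟩
  have h_fderiv : fderiv ℝ (cutoff n) x
      = (1 / ((n : ℝ) + 1)) • fderiv ℝ cutoffBump ((1 / ((n : ℝ) + 1)) • x) :=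
    fderiv_comp_smul _
  rw [h_fderiv, norm_smul, Real.norm_of_nonneg (by positivity), mul_comm]
  gcongr
  exact hC _

end Cutoff

section SmoothApproximation

/-- The truncated mollification of `f`, a smooth approximation with compact support. -/
noncomputable def cutoffMollify (n : ℕ) (f : Plane → ℂ) (x : Plane) : ℂ :=
  cutoff n x • mollify n f x

variable {f : Plane → ℂ}

theorem contDiff_cutoffMollify (n : ℕ) (hf : LocallyIntegrable f) :
    ContDiff ℝ ∞ (cutoffMollify n f) :=
  (contDiff_cutoff n).smul (contDiff_mollify n hf)

theorem hasCompactSupport_cutoffMollify (n : ℕ) (f : Plane → ℂ) :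
    HasCompactSupport (cutoffMollify n f) :=
  (hasCompactSupport_cutoff n).smul_right

theorem l2Tendsto_cutoffMollify (hf : MemLp f 2 volume) :
    L2Tendsto volume (fun n => cutoffMollify n f) f := by
  have hf_loc : LocallyIntegrable f := hf.locallyIntegrable one_le_two
  have h_tail : Tendsto (fun n => eLpNorm (fun x => (cutoff n x - 1) • f x) 2 volume) atTop
      (𝓝 0) := by
    refine tendsto_eLpNorm_smul_of_tendsto_zero hf
      (fun n => ((contDiff_cutoff n).continuous.sub continuous_const).aestronglyMeasurable)
      (fun n x => ?_) fun x => by simpa only [sub_self] using (tendsto_cutoff x).sub_const 1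
    rw [Real.norm_eq_abs, abs_le]
    constructor <;> linarith [cutoff_nonneg n x, cutoff_le_one n x]
  refine L2Tendsto.of_le_add (fun n => (contDiff_cutoffMollify n hf_loc).continuous
    |>.memLp_of_hasCompactSupport (hasCompactSupport_cutoffMollify n f)) hf (fun n => ?_)
    (tendsto_eLpNorm_mollify_sub hf) h_tail
  have h_cutoff := (contDiff_cutoff n).continuous
  have h_fst : AEStronglyMeasurable (fun x => cutoff n x • (mollify n f x - f x)) :=
    h_cutoff.aestronglyMeasurable.smul
      ((contDiff_mollify n hf_loc).continuous.aestronglyMeasurable.sub hf.aestronglyMeasurable)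
  have h_snd : AEStronglyMeasurable (fun x => (cutoff n x - 1) • f x) :=
    (h_cutoff.sub continuous_const).aestronglyMeasurable.smul hf.aestronglyMeasurable
  have h_split : cutoffMollify n f - f
      = (fun x => cutoff n x • (mollify n f x - f x)) + fun x => (cutoff n x - 1) • f x := by
    funext x
    simp only [cutoffMollify, Pi.sub_apply, Pi.add_apply]
    module
  rw [h_split]
  refine (eLpNorm_add_le h_fst h_snd one_le_two).trans ?_
  gcongr
  refine eLpNorm_mono fun x => ?_
  change ‖cutoff n x • (mollify n f x - f x)‖ ≤ ‖mollify n f x - f x‖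
  rw [norm_smul, Real.norm_of_nonneg (cutoff_nonneg n x)]
  exact mul_le_of_le_one_left (norm_nonneg _) (cutoff_le_one n x)

theorem tendsto_eLpNorm_partialDeriv_cutoff_smul (hf : MemLp f 2 volume) (j : Fin 2) :
    Tendsto (fun n => eLpNorm (fun x => partialDeriv j (cutoff n) x • mollify n f x) 2 volume)
      atTop (𝓝 0) := by
  obtain ⟨C, hC⟩ := exists_norm_fderiv_cutoff_le
  have h_bound (n : ℕ) : eLpNorm (fun x => partialDeriv j (cutoff n) x • mollify n f x) 2 volume
      ≤ ENNReal.ofReal (C * (1 / ((n : ℝ) + 1))) * eLpNorm f 2 volume := by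
    refine (eLpNorm_le_mul_eLpNorm_of_ae_le_mul (g := mollify n f) (c := C * (1 / ((n : ℝ) + 1)))
      (Eventually.of_forall fun x => ?_) 2).trans ?_
    · rw [norm_smul]
      gcongr
      exact (abs_partialDeriv_le _ _ _).trans (hC n x)
    · gcongr
      exact eLpNorm_mollify_le n hf.aestronglyMeasurable
  have h_rate : Tendsto (fun n : ℕ => ENNReal.ofReal (C * (1 / ((n : ℝ) + 1)))) atTop (𝓝 0) := by
    simpa only [mul_zero, ENNReal.ofReal_zero] using
      ENNReal.tendsto_ofReal ((tendsto_one_div_add_atTop_nhds_zero_nat (𝕜 := ℝ)).const_mul C)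
  exact tendsto_of_tendsto_of_tendsto_of_le_of_le tendsto_const_nhds
    (by simpa only [zero_mul] using
      ENNReal.Tendsto.mul_const h_rate (Or.inr hf.eLpNorm_ne_top))
    (fun _ => zero_le) h_bound

theorem memLp_cgrad {w : Plane → ℂ} (hw : ContDiff ℝ 1 w) (hc : HasCompactSupport w)
    (j : Fin 2) : MemLp (cgrad w j) 2 volume :=
  (continuous_cgrad hw j).memLp_of_hasCompactSupport (hasCompactSupport_cgrad hc j)

/-- A sequence of smooth compactly supported functions converging in `H¹` to the function `u` with
weak gradient `Du`. -/
structure IsH1Approx (w : ℕ → Plane → ℂ) (u : Plane → ℂ) (Du : Fin 2 → Plane → ℂ) : Prop where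
  smooth : ∀ n, ContDiff ℝ ∞ (w n)
  compact : ∀ n, HasCompactSupport (w n)
  tendsto : L2Tendsto volume w u
  tendsto_grad : ∀ j, L2Tendsto volume (fun n => cgrad (w n) j) (Du j)

variable {u : Plane → ℂ} {Du : Fin 2 → Plane → ℂ}

theorem IsH1.cgrad_mollify (hu : IsH1 u Du) (n : ℕ) (j : Fin 2) :
    cgrad (mollify n u) j = mollify n (Du j) := by
  funext x
  refine fderiv_mollify_of_weak n (hu.memLp.locallyIntegrable one_le_two) (fun φ hφ => ?_) x
  simpa only [Complex.real_smul] using hu.weak_grad j φ hφ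

theorem IsH1.cgrad_cutoffMollify (hu : IsH1 u Du) (n : ℕ) (j : Fin 2) (x : Plane) :
    cgrad (cutoffMollify n u) j x
      = cutoffMollify n (Du j) x + partialDeriv j (cutoff n) x • mollify n u x := by
  have h_cutoff := (contDiff_cutoff n).differentiable (by simp) x
  have h_mollify := (contDiff_mollify n (hu.memLp.locallyIntegrable one_le_two)).differentiable
    (by simp) x
  have h_fderiv : fderiv ℝ (cutoffMollify n u) x = _ := fderiv_fun_smul h_cutoff h_mollify
  rw [cutoffMollify, ← hu.cgrad_mollify n j, cgrad, h_fderiv]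
  rfl

theorem IsH1.isH1Approx_cutoffMollify (hu : IsH1 u Du) :
    IsH1Approx (fun n => cutoffMollify n u) u Du := by
  have h_smooth (n : ℕ) := contDiff_cutoffMollify n (hu.memLp.locallyIntegrable one_le_two)
  have h_supp (n : ℕ) := hasCompactSupport_cutoffMollify n u
  refine ⟨h_smooth, h_supp, l2Tendsto_cutoffMollify hu.memLp, fun j => ?_⟩
  have h_main := l2Tendsto_cutoffMollify (hu.memLp_grad j)
  refine L2Tendsto.of_le_add
    (fun n => memLp_cgrad ((h_smooth n).of_le (mod_cast le_top)) (h_supp n) j)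
    (hu.memLp_grad j) (fun n => ?_) h_main.tendsto
    (tendsto_eLpNorm_partialDeriv_cutoff_smul hu.memLp j)
  have h_partial : Continuous fun x => partialDeriv j (cutoff n) x • mollify n u x :=
    (((contDiff_cutoff n).continuous_fderiv (by simp)).clm_apply continuous_const).smul
      (contDiff_mollify n (hu.memLp.locallyIntegrable one_le_two)).continuous
  have h_split : cgrad (cutoffMollify n u) j - Du j = (cutoffMollify n (Du j) - Du j)
      + fun x => partialDeriv j (cutoff n) x • mollify n u x := by
    funext x
    rw [Pi.sub_apply, hu.cgrad_cutoffMollify, Pi.add_apply, Pi.sub_apply, add_sub_right_comm]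
  rw [h_split]
  exact eLpNorm_add_le ((h_main.memLp n).sub h_main.memLp_lim).aestronglyMeasurable
    h_partial.aestronglyMeasurable one_le_two

end SmoothApproximation

section FieldMultiplication

theorem AdmissibleField.abs {B : Plane → ℝ} (hB : AdmissibleField B) :
    AdmissibleField fun x => |B x| := by
  obtain ⟨⟨p, hp, h_loc⟩, τ, hτ, C, R, hC⟩ := hB
  exact ⟨⟨p, hp, fun K hK => (h_loc K hK).norm⟩, τ, hτ, C, R, by simpa only [abs_abs] using hC⟩

theorem norm_gradient_le (φ : Plane → ℝ) (x : Plane) :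
    ‖gradient φ x‖ ≤ |partialDeriv 0 φ x| + |partialDeriv 1 φ x| := by
  rw [EuclideanSpace.norm_eq, Fin.sum_univ_two, gradient_apply, gradient_apply]
  refine Real.sqrt_le_iff.2 ⟨by positivity, ?_⟩
  rw [Real.norm_eq_abs, Real.norm_eq_abs, add_sq]
  linarith [mul_nonneg (abs_nonneg (partialDeriv 0 φ x)) (abs_nonneg (partialDeriv 1 φ x))]

variable {v w : Plane → ℂ}

theorem isTest_norm_sq (hw : ContDiff ℝ ∞ w) (hc : HasCompactSupport w) :
    IsTest fun x => ‖w x‖ ^ 2 :=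
  ⟨hw.norm_sq ℝ, hc.comp_left (g := fun z : ℂ => ‖z‖ ^ 2) (by simp)⟩

theorem partialDeriv_norm_sq {x : Plane} (hw : DifferentiableAt ℝ w x) (j : Fin 2) :
    partialDeriv j (fun x => ‖w x‖ ^ 2) x = 2 * (cgrad w j x * conj (w x)).re := by
  have h_fderiv : fderiv ℝ (fun x => ‖w x‖ ^ 2) x = _ := hw.hasFDerivAt.norm_sq.fderiv
  simp only [partialDeriv, h_fderiv, cgrad, ContinuousLinearMap.comp_apply, smul_apply,
    innerSL_apply_apply, Complex.inner, nsmul_eq_mul, Nat.cast_ofNat]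

theorem norm_gradient_norm_sq_le {x : Plane} (hw : DifferentiableAt ℝ w x) :
    ‖gradient (fun x => ‖w x‖ ^ 2) x‖
      ≤ 2 * (‖w x‖ ^ 2 + ‖cgrad w 0 x‖ ^ 2 + ‖cgrad w 1 x‖ ^ 2) := by
  have h_partial (j : Fin 2) :
      |partialDeriv j (fun x => ‖w x‖ ^ 2) x| ≤ ‖w x‖ ^ 2 + ‖cgrad w j x‖ ^ 2 := by
    calc |partialDeriv j (fun x => ‖w x‖ ^ 2) x|
        = 2 * |(cgrad w j x * conj (w x)).re| := by rw [partialDeriv_norm_sq hw, abs_mul, abs_two]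
      _ ≤ 2 * (‖cgrad w j x‖ * ‖w x‖) := by
        rw [← RCLike.norm_conj (w x), ← norm_mul]
        gcongr
        exact Complex.abs_re_le_norm _
      _ ≤ ‖w x‖ ^ 2 + ‖cgrad w j x‖ ^ 2 := by
        linarith [two_mul_le_add_sq ‖cgrad w j x‖ ‖w x‖]
  calc ‖gradient (fun x => ‖w x‖ ^ 2) x‖ ≤ _ := norm_gradient_le _ x
    _ ≤ 2 * (‖w x‖ ^ 2 + ‖cgrad w 0 x‖ ^ 2 + ‖cgrad w 1 x‖ ^ 2) := by
      linarith [h_partial 0, h_partial 1, sq_nonneg ‖cgrad w 0 x‖, sq_nonneg ‖cgrad w 1 x‖]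

theorem cgrad_sub (hv : Differentiable ℝ v) (hw : Differentiable ℝ w) (j : Fin 2) :
    cgrad (v - w) j = cgrad v j - cgrad w j := by
  funext x
  rw [cgrad, fderiv_sub (hv x) (hw x)]
  rfl

variable {B b : Plane → ℝ}

theorem AdmissibleField.integrable_abs_mul_norm_sq (hB : AdmissibleField B) (hw : Continuous w)
    (hc : HasCompactSupport w) : Integrable fun x => |B x| * ‖w x‖ ^ 2 := by
  obtain ⟨M, hM⟩ := hc.exists_bound_of_continuous hw
  refine hB.integrable.abs.mul_bdd (c := M ^ 2) (by fun_prop) (Eventually.of_forall fun x => ?_)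
  rw [norm_pow, norm_norm]
  exact pow_le_pow_left₀ (norm_nonneg _) (hM x) 2

theorem AdmissibleField.exists_integral_abs_mul_norm_sq_le (hB : AdmissibleField B) :
    ∃ C : ℝ, 0 ≤ C ∧ ∀ w : Plane → ℂ, ContDiff ℝ ∞ w → HasCompactSupport w →
      ∫ x, |B x| * ‖w x‖ ^ 2
        ≤ C * ((∫ x, ‖w x‖ ^ 2) + (∫ x, ‖cgrad w 0 x‖ ^ 2) + ∫ x, ‖cgrad w 1 x‖ ^ 2) := by
  obtain ⟨C, hC₀, hC⟩ := hB.abs.exists_integral_mul_le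
  refine ⟨C * 2, by positivity, fun w hw hc => ?_⟩
  have hφ := isTest_norm_sq hw hc
  have h_int : Integrable fun x => ‖w x‖ ^ 2 :=
    (hw.continuous.memLp_of_hasCompactSupport hc).integrable_norm_pow two_ne_zero
  have h_int_grad (j : Fin 2) : Integrable fun x => ‖cgrad w j x‖ ^ 2 :=
    (memLp_cgrad (hw.of_le (mod_cast le_top)) hc j).integrable_norm_pow two_ne_zero
  have h_int_sum : Integrable fun x => ‖w x‖ ^ 2 + ‖cgrad w 0 x‖ ^ 2 := h_int.add (h_int_grad 0)
  calc ∫ x, |B x| * ‖w x‖ ^ 2 ≤ C * ∫ x, ‖gradient (fun x => ‖w x‖ ^ 2) x‖ := hC _ hφ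
    _ ≤ C * ∫ x, 2 * (‖w x‖ ^ 2 + ‖cgrad w 0 x‖ ^ 2 + ‖cgrad w 1 x‖ ^ 2) := by
      refine mul_le_mul_of_nonneg_left (integral_mono hφ.integrable_gradient.norm
        ((h_int_sum.add (h_int_grad 1)).const_mul 2) fun x => ?_) hC₀
      exact norm_gradient_norm_sq_le (hw.differentiable (by simp) x)
    _ = _ := by
      rw [integral_const_mul, integral_add h_int_sum (h_int_grad 1),
        integral_add h_int (h_int_grad 0), mul_assoc]

theorem norm_ofReal_sqrt_mul_sq {t : ℝ} (ht : 0 ≤ t) (z : ℂ) :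
    ‖((√t : ℝ) : ℂ) * z‖ ^ 2 = t * ‖z‖ ^ 2 := by
  rw [norm_mul, mul_pow, Complex.norm_real, Real.norm_eq_abs, sq_abs, Real.sq_sqrt ht]

theorem AdmissibleField.memLp_sqrt_mul (hB : AdmissibleField B) (hb : AEStronglyMeasurable b)
    (hb₀ : ∀ x, 0 ≤ b x) (hbB : ∀ x, b x ≤ |B x|) (hw : Continuous w) (hc : HasCompactSupport w) :
    MemLp (fun x => ((√(b x) : ℝ) : ℂ) * w x) 2 volume := by
  have h_meas : AEStronglyMeasurable fun x => ((√(b x) : ℝ) : ℂ) * w x :=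
    (Complex.continuous_ofReal.comp_aestronglyMeasurable
      (Real.continuous_sqrt.comp_aestronglyMeasurable hb)).mul hw.aestronglyMeasurable
  refine (memLp_two_iff_integrable_sq_norm h_meas).2 <|
    (hB.integrable_abs_mul_norm_sq hw hc).mono' (h_meas.norm.pow 2)
      (Eventually.of_forall fun x => ?_)
  rw [Real.norm_of_nonneg (by positivity), norm_ofReal_sqrt_mul_sq (hb₀ x)]
  gcongr
  exact hbB x

theorem AdmissibleField.exists_eLpNorm_sqrt_mul_sq_le (hB : AdmissibleField B)
    (hb : AEStronglyMeasurable b) (hb₀ : ∀ x, 0 ≤ b x) (hbB : ∀ x, b x ≤ |B x|) :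
    ∃ C : ℝ, ∀ w : Plane → ℂ, ContDiff ℝ ∞ w → HasCompactSupport w →
      eLpNorm (fun x => ((√(b x) : ℝ) : ℂ) * w x) 2 volume ^ 2
        ≤ ENNReal.ofReal C * (eLpNorm w 2 volume ^ 2 + eLpNorm (cgrad w 0) 2 volume ^ 2
          + eLpNorm (cgrad w 1) 2 volume ^ 2) := by
  obtain ⟨C, hC₀, hC⟩ := hB.exists_integral_abs_mul_norm_sq_le
  refine ⟨C, fun w hw hc => ?_⟩
  have h_grad := memLp_cgrad (hw.of_le (mod_cast le_top)) hc
  rw [← ofReal_integral_norm_sq (hB.memLp_sqrt_mul hb hb₀ hbB hw.continuous hc),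
    ← ofReal_integral_norm_sq (hw.continuous.memLp_of_hasCompactSupport hc),
    ← ofReal_integral_norm_sq (h_grad 0), ← ofReal_integral_norm_sq (h_grad 1),
    ← ENNReal.ofReal_add (by positivity) (by positivity),
    ← ENNReal.ofReal_add (by positivity) (by positivity), ← ENNReal.ofReal_mul hC₀]
  refine ENNReal.ofReal_le_ofReal (le_trans ?_ (hC w hw hc))
  simp only [fun x => norm_ofReal_sqrt_mul_sq (hb₀ x) (w x)]
  refine integral_mono_of_nonneg (Eventually.of_forall fun x => ?_)
    (hB.integrable_abs_mul_norm_sq hw.continuous hc) (Eventually.of_forall fun x => ?_)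
  · exact mul_nonneg (hb₀ x) (by positivity)
  · exact mul_le_mul_of_nonneg_right (hbB x) (by positivity)

theorem IsH1Approx.l2Tendsto_sqrt_mul {w : ℕ → Plane → ℂ} {u : Plane → ℂ}
    {Du : Fin 2 → Plane → ℂ} (h : IsH1Approx w u Du) (hB : AdmissibleField B)
    (hb : AEStronglyMeasurable b) (hb₀ : ∀ x, 0 ≤ b x) (hbB : ∀ x, b x ≤ |B x|) :
    L2Tendsto volume (fun n x => ((√(b x) : ℝ) : ℂ) * w n x)
      fun x => ((√(b x) : ℝ) : ℂ) * u x := by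
  obtain ⟨C, hC⟩ := hB.exists_eLpNorm_sqrt_mul_sq_le hb hb₀ hbB
  refine h.tendsto.mul_of_cauchy
    (fun n => hB.memLp_sqrt_mul hb hb₀ hbB (h.smooth n).continuous (h.compact n)) ?_
  have h_sq {a : ℕ × ℕ → ℝ≥0∞} (ha : Tendsto a atTop (𝓝 0)) :
      Tendsto (fun p => a p ^ 2) atTop (𝓝 0) := by
    simpa [Function.comp_def] using ((ENNReal.continuous_pow 2).tendsto _).comp ha
  have h_lim : Tendsto (fun p : ℕ × ℕ => ENNReal.ofReal C * (eLpNorm (w p.1 - w p.2) 2 volume ^ 2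
      + eLpNorm (cgrad (w p.1) 0 - cgrad (w p.2) 0) 2 volume ^ 2
      + eLpNorm (cgrad (w p.1) 1 - cgrad (w p.2) 1) 2 volume ^ 2)) atTop (𝓝 0) := by
    simpa only [add_zero, mul_zero] using ENNReal.Tendsto.const_mul
      (((h_sq h.tendsto.tendsto_sub).add (h_sq (h.tendsto_grad 0).tendsto_sub)).add
        (h_sq (h.tendsto_grad 1).tendsto_sub)) (Or.inr (ENNReal.ofReal_ne_top (r := C)))
  refine tendsto_zero_of_sq_le (fun p => ?_) h_lim
  have h_diff (n : ℕ) : Differentiable ℝ (w n) := (h.smooth n).differentiable (by simp)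
  rw [← cgrad_sub (h_diff _) (h_diff _), ← cgrad_sub (h_diff _) (h_diff _)]
  exact hC (w p.1 - w p.2) ((h.smooth _).sub (h.smooth _)) ((h.compact _).sub (h.compact _))

end FieldMultiplication

section IntegrationByParts

variable {v w : Plane → ℂ}

theorem contDiff_cgrad (hv : ContDiff ℝ 2 v) (j : Fin 2) : ContDiff ℝ 1 (cgrad v j) :=
  (hv.fderiv_right (m := 1) (by norm_num)).clm_apply contDiff_const

theorem fderiv_cgrad_comm (hv : ContDiff ℝ 2 v) (i j : Fin 2) (x : Plane) :
    fderiv ℝ (cgrad v j) x (EuclideanSpace.single i 1)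
      = fderiv ℝ (cgrad v i) x (EuclideanSpace.single j 1) := by
  have h_diff : DifferentiableAt ℝ (fderiv ℝ v) x :=
    (hv.fderiv_right (m := 1) (by norm_num)).differentiable one_ne_zero x
  have h_second (k : Fin 2) (y : Plane) :
      fderiv ℝ (cgrad v k) x y = fderiv ℝ (fderiv ℝ v) x y (EuclideanSpace.single k 1) := by
    have h_fderiv : fderiv ℝ (cgrad v k) x = _ := (h_diff.hasFDerivAt.clm_apply
      (hasFDerivAt_const (EuclideanSpace.single k (1 : ℝ)) x)).fderiv
    simp [h_fderiv]
  rw [h_second, h_second]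
  exact hv.contDiffAt.isSymmSndFDerivAt (by simp) _ _

theorem integral_cgrad_mul_cgrad_comm (hw : ContDiff ℝ 1 w) (hc : HasCompactSupport w)
    (hv : ContDiff ℝ 2 v) (i j : Fin 2) :
    ∫ x, cgrad w i x * cgrad v j x = ∫ x, cgrad w j x * cgrad v i x := by
  have h_parts (k l : Fin 2) : ∫ x, w x * fderiv ℝ (cgrad v l) x (EuclideanSpace.single k 1)
      = -∫ x, cgrad w k x * cgrad v l x := by
    have hv' := contDiff_cgrad hv l
    refine integral_mul_fderiv_eq_neg_fderiv_mul_of_integrable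
      (((continuous_cgrad hw k).mul hv'.continuous).integrable_of_hasCompactSupport
        (hasCompactSupport_cgrad hc k).mul_right)
      ((hw.continuous.mul ((hv'.continuous_fderiv one_ne_zero).clm_apply
        continuous_const)).integrable_of_hasCompactSupport hc.mul_right)
      ((hw.continuous.mul hv'.continuous).integrable_of_hasCompactSupport hc.mul_right)
      (fun x _ => hw.differentiable one_ne_zero x) fun x _ => hv'.differentiable one_ne_zero x
  rw [← neg_inj, ← h_parts, ← h_parts]
  simp_rw [fderiv_cgrad_comm hv i j]

theorem cgrad_conj (hw : Differentiable ℝ w) (j : Fin 2) (x : Plane) :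
    cgrad (fun y => conj (w y)) j x = conj (cgrad w j x) := by
  have h_fderiv : fderiv ℝ (fun y => conj (w y)) x = _ :=
    ((Complex.conjCLE.hasFDerivAt (x := w x)).comp x (hw x).hasFDerivAt).fderiv
  simp [cgrad, h_fderiv]

theorem integrable_cgrad_mul_conj (hw : ContDiff ℝ 1 w) (hc : HasCompactSupport w)
    (i j : Fin 2) : Integrable fun x => cgrad w i x * conj (cgrad w j x) :=
  ((continuous_cgrad hw i).mul (Complex.continuous_conj.comp
    (continuous_cgrad hw j))).integrable_of_hasCompactSupport
      (hasCompactSupport_cgrad hc i).mul_right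

theorem integral_im_cgrad_mul_conj (hw : ContDiff ℝ 2 w) (hc : HasCompactSupport w)
    (i j : Fin 2) : ∫ x, (cgrad w i x * conj (cgrad w j x)).im = 0 := by
  have hw₁ : ContDiff ℝ 1 w := hw.of_le one_le_two
  have h_conj : ContDiff ℝ 2 fun y => conj (w y) := Complex.conjCLE.contDiff.comp hw
  have h_comm := integral_cgrad_mul_cgrad_comm hw₁ hc h_conj i j
  simp_rw [cgrad_conj (hw.differentiable two_ne_zero)] at h_comm
  have h_real : conj (∫ x, cgrad w i x * conj (cgrad w j x))
      = ∫ x, cgrad w i x * conj (cgrad w j x) := by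
    rw [h_comm, ← integral_conj]
    simp_rw [map_mul, Complex.conj_conj, mul_comm (conj _)]
    exact h_comm
  have h_im : ∫ x, (cgrad w i x * conj (cgrad w j x)).im = _ :=
    integral_im (integrable_cgrad_mul_conj hw₁ hc i j)
  exact h_im.trans (Complex.conj_eq_iff_im.1 h_real)

end IntegrationByParts

section Energy

/-- The `j`-th component of `(i∇ + A) u`, where `Du` is the gradient of `u`. -/
noncomputable def magneticGrad (A : Plane → Plane) (u : Plane → ℂ) (Du : Fin 2 → Plane → ℂ)
    (j : Fin 2) (x : Plane) : ℂ :=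
  Complex.I * Du j x + ((A x j : ℝ) : ℂ) * u x

variable {B : Plane → ℝ} {A : Plane → Plane} {w : ℕ → Plane → ℂ} {u : Plane → ℂ}
  {Du : Fin 2 → Plane → ℂ}

theorem norm_pauliOp_sq (A : Plane → Plane) (u : Plane → ℂ) (Du : Fin 2 → Plane → ℂ)
    (x : Plane) :
    ‖pauliOp (fun j x => A x j) u Du x‖ ^ 2
      = ‖magneticGrad A u Du 0 x‖ ^ 2 + ‖magneticGrad A u Du 1 x‖ ^ 2
        + (A x 0 * (2 * (Du 1 x * conj (u x)).re) - A x 1 * (2 * (Du 0 x * conj (u x)).re))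
        - 2 * (Du 0 x * conj (Du 1 x)).im := by
  simp only [pauliOp, magneticGrad, Complex.sq_norm, Complex.normSq_apply, Complex.add_re,
    Complex.add_im, Complex.sub_re, Complex.sub_im, Complex.mul_re, Complex.mul_im, Complex.I_re,
    Complex.I_im, Complex.ofReal_re, Complex.ofReal_im, Complex.conj_re, Complex.conj_im]
  ring

theorem L2Tendsto.magneticGrad (hA : IsBoundedPotential B A) {Dw : ℕ → Fin 2 → Plane → ℂ}
    {j : Fin 2} (h : L2Tendsto volume w u) (hD : L2Tendsto volume (fun n => Dw n j) (Du j)) :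
    L2Tendsto volume (fun n => magneticGrad A (w n) (Dw n) j) (magneticGrad A u Du j) := by
  obtain ⟨C, hC⟩ := hA.exists_bound
  have h_grad := hD.bdd_mul (m := fun _ => Complex.I) (C := 1) aestronglyMeasurable_const
    (Eventually.of_forall fun _ => Complex.norm_I.le)
  refine h_grad.add (h.bdd_mul (Complex.continuous_ofReal.comp_aestronglyMeasurable
    (hA.aestronglyMeasurable j)) (C := C) ?_)
  filter_upwards [hC j] with x hx
  rwa [Complex.norm_real]

theorem IsH1Approx.l2Tendsto_magneticGrad (h : IsH1Approx w u Du) (hA : IsBoundedPotential B A)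
    (j : Fin 2) :
    L2Tendsto volume (fun n => magneticGrad A (w n) (cgrad (w n)) j) (magneticGrad A u Du j) :=
  h.tendsto.magneticGrad hA (Dw := fun n => cgrad (w n)) (h.tendsto_grad j)

theorem IsH1Approx.l2Tendsto_pauliOp (h : IsH1Approx w u Du) (hA : IsBoundedPotential B A) :
    L2Tendsto volume (fun n => pauliOp (fun j x => A x j) (w n) (cgrad (w n)))
      (pauliOp (fun j x => A x j) u Du) := by
  have h_second := (h.l2Tendsto_magneticGrad hA 1).bdd_mul (m := fun _ => -Complex.I) (C := 1)
    aestronglyMeasurable_const (Eventually.of_forall fun _ => by rw [norm_neg, Complex.norm_I])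
  have h_add := (h.l2Tendsto_magneticGrad hA 0).add h_second
  simp only [neg_mul, ← sub_eq_add_neg] at h_add
  exact h_add

theorem integral_norm_pauliOp_sq_smooth (hA : IsBoundedPotential B A) {w : Plane → ℂ}
    (hw : ContDiff ℝ ∞ w) (hc : HasCompactSupport w) :
    ∫ x, ‖pauliOp (fun j x => A x j) w (cgrad w) x‖ ^ 2
      = (∫ x, ‖magneticGrad A w (cgrad w) 0 x‖ ^ 2)
        + (∫ x, ‖magneticGrad A w (cgrad w) 1 x‖ ^ 2) + ∫ x, B x * ‖w x‖ ^ 2 := by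
  have hw₁ : ContDiff ℝ 1 w := hw.of_le (mod_cast le_top)
  have hφ := isTest_norm_sq hw hc
  have h_int (j : Fin 2) : Integrable fun x => ‖magneticGrad A w (cgrad w) j x‖ ^ 2 :=
    ((L2Tendsto.const (hw.continuous.memLp_of_hasCompactSupport hc)).magneticGrad hA
      (Dw := fun _ => cgrad w)
      (L2Tendsto.const (memLp_cgrad hw₁ hc j))).memLp_lim.integrable_norm_pow two_ne_zero
  have h_int_sum : Integrable fun x =>
      ‖magneticGrad A w (cgrad w) 0 x‖ ^ 2 + ‖magneticGrad A w (cgrad w) 1 x‖ ^ 2 :=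
    (h_int 0).add (h_int 1)
  have h_int_curl : Integrable fun x => A x 0 * partialDeriv 1 (fun x => ‖w x‖ ^ 2) x
      - A x 1 * partialDeriv 0 (fun x => ‖w x‖ ^ 2) x :=
    (hA.integrable_mul 0 (hφ.integrable_partialDeriv 1)).sub
      (hA.integrable_mul 1 (hφ.integrable_partialDeriv 0))
  have h_int_im : Integrable fun x => (cgrad w 0 x * conj (cgrad w 1 x)).im :=
    (integrable_cgrad_mul_conj hw₁ hc 0 1).im
  have h_int_sum_curl : Integrable fun x =>
      ‖magneticGrad A w (cgrad w) 0 x‖ ^ 2 + ‖magneticGrad A w (cgrad w) 1 x‖ ^ 2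
        + (A x 0 * partialDeriv 1 (fun x => ‖w x‖ ^ 2) x
          - A x 1 * partialDeriv 0 (fun x => ‖w x‖ ^ 2) x) := h_int_sum.add h_int_curl
  have h_diff : Differentiable ℝ w := hw.differentiable (by simp)
  simp_rw [norm_pauliOp_sq, ← partialDeriv_norm_sq (h_diff _)]
  rw [integral_sub h_int_sum_curl (h_int_im.const_mul 2), integral_const_mul,
    integral_im_cgrad_mul_conj (mod_cast contDiff_infty.1 hw 2) hc 0 1,
    integral_add h_int_sum h_int_curl, integral_add (h_int 0) (h_int 1), hA.curl_eq _ hφ,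
    mul_zero, sub_zero]

theorem mul_norm_sq_eq_sub (t : ℝ) (z : ℂ) :
    t * ‖z‖ ^ 2 = ‖((√t⁺ : ℝ) : ℂ) * z‖ ^ 2 - ‖((√t⁻ : ℝ) : ℂ) * z‖ ^ 2 := by
  rw [norm_ofReal_sqrt_mul_sq (posPart_nonneg t), norm_ofReal_sqrt_mul_sq (negPart_nonneg t),
    ← sub_mul, posPart_sub_negPart]

theorem integral_mul_norm_sq_eq_sub {v : Plane → ℂ}
    (h_pos : MemLp (fun x => ((√(B x)⁺ : ℝ) : ℂ) * v x) 2 volume)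
    (h_neg : MemLp (fun x => ((√(B x)⁻ : ℝ) : ℂ) * v x) 2 volume) :
    ∫ x, B x * ‖v x‖ ^ 2
      = (∫ x, ‖((√(B x)⁺ : ℝ) : ℂ) * v x‖ ^ 2) - ∫ x, ‖((√(B x)⁻ : ℝ) : ℂ) * v x‖ ^ 2 := by
  simp_rw [mul_norm_sq_eq_sub]
  exact integral_sub (h_pos.integrable_norm_pow two_ne_zero)
    (h_neg.integrable_norm_pow two_ne_zero)

theorem IsH1Approx.l2Tendsto_sqrt_posPart_mul (h : IsH1Approx w u Du) (hB : AdmissibleField B) :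
    L2Tendsto volume (fun n x => ((√(B x)⁺ : ℝ) : ℂ) * w n x)
      fun x => ((√(B x)⁺ : ℝ) : ℂ) * u x :=
  h.l2Tendsto_sqrt_mul hB (hB.integrable.aestronglyMeasurable.sup aestronglyMeasurable_const)
    (fun _ => posPart_nonneg _) fun _ => sup_le (le_abs_self _) (abs_nonneg _)

theorem IsH1Approx.l2Tendsto_sqrt_negPart_mul (h : IsH1Approx w u Du) (hB : AdmissibleField B) :
    L2Tendsto volume (fun n x => ((√(B x)⁻ : ℝ) : ℂ) * w n x)
      fun x => ((√(B x)⁻ : ℝ) : ℂ) * u x :=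
  h.l2Tendsto_sqrt_mul hB (hB.integrable.aestronglyMeasurable.neg.sup aestronglyMeasurable_const)
    (fun _ => negPart_nonneg _) fun _ => sup_le (neg_le_abs _) (abs_nonneg _)

theorem IsH1Approx.integrable_mul_norm_sq (h : IsH1Approx w u Du) (hB : AdmissibleField B) :
    Integrable fun x => B x * ‖u x‖ ^ 2 := by
  simp_rw [mul_norm_sq_eq_sub]
  exact ((h.l2Tendsto_sqrt_posPart_mul hB).memLp_lim.integrable_norm_pow two_ne_zero).sub
    ((h.l2Tendsto_sqrt_negPart_mul hB).memLp_lim.integrable_norm_pow two_ne_zero)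

theorem IsH1Approx.tendsto_integral_mul_norm_sq (h : IsH1Approx w u Du)
    (hB : AdmissibleField B) :
    Tendsto (fun n => ∫ x, B x * ‖w n x‖ ^ 2) atTop (𝓝 (∫ x, B x * ‖u x‖ ^ 2)) := by
  have h_pos := h.l2Tendsto_sqrt_posPart_mul hB
  have h_neg := h.l2Tendsto_sqrt_negPart_mul hB
  rw [integral_mul_norm_sq_eq_sub h_pos.memLp_lim h_neg.memLp_lim]
  exact (h_pos.integral_norm_sq.sub h_neg.integral_norm_sq).congr fun n =>
    (integral_mul_norm_sq_eq_sub (h_pos.memLp n) (h_neg.memLp n)).symm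

theorem pauliDensity_eq (B : Plane → ℝ) (A : Plane → Plane) (u : Plane → ℂ)
    (Du : Fin 2 → Plane → ℂ) :
    pauliDensity B A u Du = fun x =>
      ‖magneticGrad A u Du 0 x‖ ^ 2 + ‖magneticGrad A u Du 1 x‖ ^ 2 + B x * ‖u x‖ ^ 2 := by
  funext x
  rw [pauliDensity, Fin.sum_univ_two]
  rfl

theorem IsH1.integrable_norm_magneticGrad_sq (hu : IsH1 u Du) (hA : IsBoundedPotential B A)
    (j : Fin 2) : Integrable fun x => ‖magneticGrad A u Du j x‖ ^ 2 :=
  (hu.isH1Approx_cutoffMollify.l2Tendsto_magneticGrad hA j).memLp_lim.integrable_norm_pow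
    two_ne_zero

theorem IsH1.integrable_pauliDensity (hu : IsH1 u Du) (hB : AdmissibleField B)
    (hA : IsBoundedPotential B A) : Integrable (pauliDensity B A u Du) := by
  rw [pauliDensity_eq]
  exact ((hu.integrable_norm_magneticGrad_sq hA 0).add
    (hu.integrable_norm_magneticGrad_sq hA 1)).add
      (hu.isH1Approx_cutoffMollify.integrable_mul_norm_sq hB)

theorem IsH1.qPlus_eq (hu : IsH1 u Du) (hB : AdmissibleField B) (hA : IsBoundedPotential B A) :
    QPlus B A u Du = ∫ x, ‖pauliOp (fun j x => A x j) u Du x‖ ^ 2 := by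
  have h := hu.isH1Approx_cutoffMollify
  have h_grad := h.l2Tendsto_magneticGrad hA
  have h_int := hu.integrable_norm_magneticGrad_sq hA
  have h_int_sum : Integrable fun x =>
      ‖magneticGrad A u Du 0 x‖ ^ 2 + ‖magneticGrad A u Du 1 x‖ ^ 2 := (h_int 0).add (h_int 1)
  have h_limit := ((h_grad 0).integral_norm_sq.add (h_grad 1).integral_norm_sq).add
    (h.tendsto_integral_mul_norm_sq hB)
  rw [QPlus, pauliDensity_eq,
    integral_add h_int_sum (h.integrable_mul_norm_sq hB), integral_add (h_int 0) (h_int 1)]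
  refine tendsto_nhds_unique h_limit ((h.l2Tendsto_pauliOp hA).integral_norm_sq.congr fun n => ?_)
  exact integral_norm_pauliOp_sq_smooth hA (h.smooth n) (h.compact n)

theorem IsH1.qPlus_nonneg (hu : IsH1 u Du) (hB : AdmissibleField B)
    (hA : IsBoundedPotential B A) : 0 ≤ QPlus B A u Du := by
  rw [hu.qPlus_eq hB hA]
  positivity

end Energy

section HardyInequality

variable {B : Plane → ℝ} {A : Plane → Plane} {u : Plane → ℂ} {Du : Fin 2 → Plane → ℂ} {ρ : ℝ}

theorem IsH1.hardy_lower_bound (hu : IsH1 u Du) (hB : AdmissibleField B) (hα : 1 ≤ flux B)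
    (hA : IsBoundedPotential B A) {k K : ℝ} (hρ : 0 < ρ) (hk : 0 < k) (hK : 0 < K)
    (h_lower : ∀ x, k * gPlus (flux B) ρ ‖x‖ ≤ Real.exp (-scalarPotential B x))
    (h_upper : ∀ x, Real.exp (-scalarPotential B x) ≤ K * gPlus (flux B) ρ ‖x‖) :
    k ^ 2 * (hardyConst (flux B) * ∫ x, ‖u x‖ ^ 2 * hardyWeight ρ ‖x‖)
      ≤ K ^ 2 * QPlus B A u Du := by
  have h := hu.isH1Approx_cutoffMollify
  have h_weight := h.tendsto.bdd_mul (m := fun x => ((√(hardyWeight ρ ‖x‖) : ℝ) : ℂ))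
    (C := √(1 / ρ ^ 2)) (Complex.continuous_ofReal.comp (Real.continuous_sqrt.comp
      ((continuous_hardyWeight hρ).comp continuous_norm))).aestronglyMeasurable
    (Eventually.of_forall fun x => by
      rw [Complex.norm_real, Real.norm_of_nonneg (Real.sqrt_nonneg _)]
      exact Real.sqrt_le_sqrt (hardyWeight_le hρ _))
  have h_limit := h_weight.integral_norm_sq
  simp_rw [norm_ofReal_sqrt_mul_sq (hardyWeight_nonneg ρ _), mul_comm (hardyWeight ρ _)] at h_limit
  rw [hu.qPlus_eq hB hA]
  refine le_of_tendsto_of_tendsto' ((h_limit.const_mul _).const_mul _)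
    ((h.l2Tendsto_pauliOp hA).integral_norm_sq.const_mul _) fun n => ?_
  exact hB.hardy_lower_bound_smooth hα hA hρ hk hK h_lower h_upper
    (mod_cast contDiff_infty.1 (h.smooth n) 2) (h.compact n)

theorem exp_div_gPlus_nonneg (B : Plane → ℝ) (hρ : 0 < ρ) (x : Plane) :
    0 ≤ Real.exp (-scalarPotential B x) / gPlus (flux B) ρ ‖x‖ :=
  div_nonneg (Real.exp_pos _).le (gPlus_pos hρ).le

theorem kPlus_nonneg (B : Plane → ℝ) (hρ : 0 < ρ) : 0 ≤ kPlus B ρ :=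
  le_ciInf (exp_div_gPlus_nonneg B hρ)

theorem kPlus_mul_le (B : Plane → ℝ) (hρ : 0 < ρ) (x : Plane) :
    kPlus B ρ * gPlus (flux B) ρ ‖x‖ ≤ Real.exp (-scalarPotential B x) :=
  (le_div_iff₀ (gPlus_pos hρ)).1
    (ciInf_le ⟨0, forall_mem_range.2 (exp_div_gPlus_nonneg B hρ)⟩ x)

theorem IsH1.hardy_inequality (hu : IsH1 u Du) (hB : AdmissibleField B) (hα : 1 ≤ flux B)
    (hA : IsBoundedPotential B A) (hρ : 0 < ρ) :
    betaPlus B ρ * hardyConst (flux B) * (∫ x, ‖u x‖ ^ 2 * hardyWeight ρ ‖x‖)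
      ≤ QPlus B A u Du := by
  have hQ : 0 ≤ QPlus B A u Du := hu.qPlus_nonneg hB hA
  rcases (kPlus_nonneg B hρ).eq_or_lt with hk | hk
  · simpa [betaPlus, ← hk] using hQ
  by_cases h_bdd : BddAbove (range fun x : Plane =>
      Real.exp (-scalarPotential B x) / gPlus (flux B) ρ ‖x‖)
  · have hK : 0 < KPlus B ρ :=
      (div_pos (Real.exp_pos _) (gPlus_pos hρ)).trans_le (le_ciSup h_bdd 0)
    have h_bound := hu.hardy_lower_bound hB hα hA hρ hk hK (kPlus_mul_le B hρ)
      fun x => (div_le_iff₀ (gPlus_pos hρ)).1 (le_ciSup h_bdd x)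
    rw [betaPlus, div_pow, mul_assoc, div_mul_eq_mul_div, div_le_iff₀' (by positivity)]
    exact h_bound
  · -- The supremum of an unbounded set of reals is `0`, hence so is `betaPlus B ρ`.
    have hK : KPlus B ρ = 0 := Real.sSup_of_not_bddAbove h_bdd
    simpa [betaPlus, hK] using hQ

end HardyInequality

end PauliHardy

theorem theorem2p4_general (B : PauliHardy.Plane → ℝ) (hB : PauliHardy.AdmissibleField B)
    (hα : PauliHardy.flux B = 0 ∨ 1 ≤ PauliHardy.flux B)
    (A : PauliHardy.Plane → PauliHardy.Plane)
    (hA : A = PauliHardy.vectorPotential B ∨ PauliHardy.IsBoundedPotential B A)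
    (ρ : ℝ) (hρ : 0 < ρ)
    (u : PauliHardy.Plane → ℂ) (Du : Fin 2 → PauliHardy.Plane → ℂ)
    (hu : PauliHardy.IsH1 u Du) :
    Integrable (PauliHardy.pauliDensity B A u Du) volume ∧
      PauliHardy.betaPlus B ρ *
          (PauliHardy.flux B / (4 * PauliHardy.flux B + Real.pi)) *
          (∫ x : PauliHardy.Plane,
            ‖u x‖ ^ 2 / (ρ ^ 2 + ‖x‖ ^ 2 * (1 + Real.log (‖x‖ / ρ) ^ 2))) ≤
        PauliHardy.QPlus B A u Du := by
  have hA' : PauliHardy.IsBoundedPotential B A := hA.elim (· ▸ hB.isBoundedPotential) id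
  refine ⟨hu.integrable_pauliDensity hB hA', ?_⟩
  rcases hα with h_zero | h_one
  · rw [h_zero, zero_div, mul_zero, zero_mul]
    exact hu.qPlus_nonneg hB hA'
  · simpa only [PauliHardy.hardyWeight, PauliHardy.hardyConst, mul_one_div] using
      hu.hardy_inequality hB h_one hA' hρ

theorem theorem2p4 (B : PauliHardy.Plane → ℝ) (hB : PauliHardy.AdmissibleField B)
    (hα_nonneg : 0 ≤ PauliHardy.flux B) (hα_int : ∃ n : ℤ, PauliHardy.flux B = n)
    (A : PauliHardy.Plane → PauliHardy.Plane)
    (hA : A = PauliHardy.vectorPotential B ∨ PauliHardy.IsBoundedPotential B A)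
    (ρ : ℝ) (hρ : 0 < ρ)
    (u : PauliHardy.Plane → ℂ) (Du : Fin 2 → PauliHardy.Plane → ℂ)
    (hu : PauliHardy.IsH1 u Du) :
    Integrable (PauliHardy.pauliDensity B A u Du) volume ∧
      PauliHardy.betaPlus B ρ *
          (PauliHardy.flux B / (4 * PauliHardy.flux B + Real.pi)) *
          (∫ x : PauliHardy.Plane,
            ‖u x‖ ^ 2 / (ρ ^ 2 + ‖x‖ ^ 2 * (1 + Real.log (‖x‖ / ρ) ^ 2))) ≤
        PauliHardy.QPlus B A u Du := by
  obtain ⟨n, hn⟩ := hα_int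
  refine theorem2p4_general B hB (hα_nonneg.eq_or_lt.imp Eq.symm fun h_pos => ?_) A hA ρ hρ u Du hu
  rw [hn] at h_pos ⊢
  exact_mod_cast h_pos
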